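/- **Model.** A glue is a pair (label, strength), the label being a finite string and the strength a non-negative integer. A tile type is a unit square with a glue on each of its four sides (no rotation). An assembly over a finite tile set $T$ is a partial function $\alpha:\mathbb Z^2\dashrightarrow T$. Its binding graph joins adjacent tiles whose abutting glues are equal and of positive strength, the weight of the edge being that strength; $\alpha$ is $\tau$-stable if every cut of its binding graph has weight at least $\tau$. A supertile is the set $\tilde\alpha$ of all translations of an assembly $\alpha$. Supertiles $\tilde\alpha,\tilde\beta$ combine (at temperature $\tau$) into $\tilde\gamma$ if suitable disjoint translations of $\alpha$ and $\beta$ have a $\tau$-stable union that belongs to $\tilde\gamma$. A 2HAM system at temperature $\tau$ is a triple $\mathcal T=(T,\sigma,\tau)$ with $T$ a finite tile set and $\sigma$ a set of finite, nonempty, $\tau$-stable supertiles over $T$, each supplied in infinitely many copies. A supertile is producible if it is the result (limit) of a finite or infinite assembly sequence that starts with an element of $\sigma$ and at each step attaches a supertile that can itself be obtained from $\sigma$ by finitely many combinations; infinite supertiles may be producible. Write $\tilde\alpha\to^1\tilde\beta$ if $\tilde\alpha$ combines with some producible supertile into $\tilde\beta$, $\tilde\alpha\to^{\le1}\tilde\beta$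 if $\tilde\alpha=\tilde\beta$ or $\tilde\alpha\to^1\tilde\beta$, and $\tilde\alpha\to\tilde\beta$ if $\tilde\beta$ is the result of a finite or infinite sequence of attachments of producible supertiles starting with $\tilde\alpha$. **Simulation.** Let $\mathcal U$ and $\mathcal T$ be 2HAM systems with tile sets $U$ and $T$, let $m\ge1$, and let $R$ be a partial function from $m$-blocks over $U$ (partial functions $\{0,\dots,m-1\}^2\dashrightarrow U$) to $T$. For an assembly $\alpha$ over $U$ let $R^*(\alpha)$ be the assembly over $T$ with $R^*(\alpha)(x,y)=R(\alpha^m_{x,y})$, where $\alpha^m_{x,y}(i,j)=\alpha(mx+i,my+j)$. The assembly $\alpha$ maps cleanly if every nonempty block of $\alpha$ is, or is horizontally or vertically adjacent to, a block at a position in $\operatorname{dom}R^*(\alpha)$, or if $\alpha$ has at most one nonempty block. For a supertile $\tilde\alpha$ put $\tilde R(\tilde\alpha)=\{R^*(\alpha):\alpha\in\tilde\alpha,\ R^*(\alpha)\neq\emptyset\}$; $\tilde\alpha$ represents the supertile $\tilde\beta$ over $T$ if $\tilde R(\tilde\alpha)=\tilde\beta$. It maps cleanly if either it represents a supertile and every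 $\alpha\in\tilde\alpha$ with $R^*(\alpha)\ne\emptyset$ maps cleanly, or $\tilde R(\tilde\alpha)$ is empty and some $\alpha\in\tilde\alpha$ has at most one nonempty block. The system $\mathcal U$ *simulates* $\mathcal T$ at scale $m$ (in the weak sense) if, for some such $R$: 1. the supertiles represented by producible supertiles of $\mathcal U$ are exactly the producible supertiles of $\mathcal T$, and every producible supertile of $\mathcal U$ maps cleanly; 2. whenever $\tilde\alpha\to^1_{\mathcal U}\tilde\beta$ for producible $\tilde\alpha,\tilde\beta$ of $\mathcal U$ and $\tilde\alpha$ represents a supertile, then $\tilde\beta$ represents a supertile and $\tilde R(\tilde\alpha)\to^{\le1}_{\mathcal T}\tilde R(\tilde\beta)$; 3. whenever $\tilde\alpha\to^1_{\mathcal T}\tilde\beta$ for producible $\tilde\alpha,\tilde\beta$ of $\mathcal T$, then for every producible $\tilde\alpha'$ of $\mathcal U$ with $\tilde R(\tilde\alpha')=\tilde\alpha$ there are producible $\tilde\alpha'',\tilde\beta'$ of $\mathcal U$ with $\tilde R(\tilde\alpha'')=\tilde\alpha$, $\tilde R(\tilde\beta')=\tilde\beta$ and $\tilde\alpha'\to_{\mathcal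 U}\tilde\alpha''\to^1_{\mathcal U}\tilde\beta'$. **Theorem.** There is an absolute constant $C$ such that for each integer $\tau\ge2$ there is a tile set $U_\tau$ with $|U_\tau|\le C\tau$ such that for every 2HAM system $\mathcal T=(T,\sigma,\tau)$ there is a set $I_{\mathcal T}$ of at most $C(|T|+\|\sigma\|)$ finite, nonempty, $\tau$-stable supertiles over $U_\tau$, where $\|\sigma\|$ is the number of distinct supertiles in $\sigma$, for which the 2HAM system $\mathcal U_{\mathcal T}=(U_\tau,\,U_{\tau,\mathrm{sup}}\cup I_{\mathcal T},\,\tau)$, where $U_{\tau,\mathrm{sup}}$ is the set of single-tile supertiles over $U_\tau$, simulates $\mathcal T$ at some scale $1\le m\le C\sqrt{\log\max(|T|,2)}$. -/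

import Mathlib

namespace TwoHAM

/-! ### Tiles and assemblies -/

/-- A glue: a label (a finite string) together with a strength (a non-negative integer). -/
structure Glue where
  label : String
  strength : ℕ
deriving DecidableEq

/-- The four sides of a unit square. -/
inductive Dir
  | north
  | east
  | south
  | west

/-- The unit vector pointing in a given direction. -/
def Dir.vec : Dir → ℤ × ℤ
  | .north => (0, 1)
  | .east => (1, 0)
  | .south => (0, -1)
  | .west => (-1, 0)

/-- The opposite direction. -/
def Dir.opp : Dir → Dir
  | .north => .south
  | .east => .west
  | .south => .north
  | .west => .east

/-- A tile type: a unit square with a glue on each of its four sides (tiles do not rotate). -/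
structure TileType where
  glue : Dir → Glue

/-- An assembly over the tile set `T`: a partial function from `ℤ²` to `T`. -/
abbrev Assembly (T : Finset TileType) : Type := ℤ × ℤ → Option {t : TileType // t ∈ T}

namespace Assembly

variable {T : Finset TileType}

/-- The set of positions that carry a tile. -/
def dom (α : Assembly T) : Set (ℤ × ℤ) := {p | α p ≠ none}

/-- The translation `α + u`. -/
def translate (u : ℤ × ℤ) (α : Assembly T) : Assembly T := fun p => α (p - u)

/-- The union of two assemblies, where the first one takes precedence. -/
def union (α β : Assembly T) : Assembly T := fun p => (α p).or (β p)

/-- `α` is a subassembly of `β`. -/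
def Sub (α β : Assembly T) : Prop := ∀ p ∈ α.dom, α p = β p

/-- The assembly that consists of one tile of type `t`, at the origin. -/
def single (t : {t : TileType // t ∈ T}) : Assembly T := fun p => if p = 0 then some t else none

/-- The weight in the binding graph of `α` of the edge between `p` and its neighbour in direction
`d`: the strength of the common glue if both positions carry a tile and the abutting glues are
equal, and `0` (no edge) otherwise. -/
def bond (α : Assembly T) (p : ℤ × ℤ) (d : Dir) : ℕ :=
  match α p, α (p + d.vec) with
  | some s, some t => if s.1.glue d = t.1.glue d.opp then (s.1.glue d).strength else 0
  | _, _ => 0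

/-- `α` is `τ`-stable: every cut of the binding graph into two nonempty parts `S ∩ dom α` and
`dom α \ S` has weight at least `τ`. An edge of the cut is listed once, from its end `p` in `S` to
its end `p + d` outside `S`. Since `α` may be infinite the weight of the cut may be an infinite sum
of natural numbers; it is at least `τ` if and only if some finite partial sum is. -/
def Stable (τ : ℕ) (α : Assembly T) : Prop :=
  ∀ S : Set (ℤ × ℤ), (α.dom ∩ S).Nonempty → (α.dom \ S).Nonempty →
    ∃ F : Finset ((ℤ × ℤ) × Dir), (∀ e ∈ F, e.1 ∈ S ∧ e.1 + e.2.vec ∉ S) ∧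
      τ ≤ ∑ e ∈ F, α.bond e.1 e.2

/-- `α` is the result (the limit) of the growing sequence of assemblies `s`. -/
def IsResult (s : ℕ → Assembly T) (α : Assembly T) : Prop :=
  α.dom = ⋃ i, (s i).dom ∧ ∀ i, (s i).Sub α

end Assembly

/-! ### Supertiles -/

/-- `α ≃ β`: the assemblies are translations of each other. -/
instance translationSetoid (T : Finset TileType) : Setoid (Assembly T) where
  r α β := ∃ u : ℤ × ℤ, α.translate u = β
  iseqv :=
    { refl := fun α => ⟨0, by funext p; simp [Assembly.translate]⟩
      symm := by
        rintro α _ ⟨u, rfl⟩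
        exact ⟨-u, by funext p; simp [Assembly.translate]⟩
      trans := by
        rintro α _ _ ⟨u, rfl⟩ ⟨v, rfl⟩
        exact ⟨u + v, by funext p; simp [Assembly.translate, sub_sub, add_comm]⟩ }

/-- A supertile over `T`: a class of assemblies modulo translation. -/
abbrev Supertile (T : Finset TileType) : Type := Quotient (translationSetoid T)

/-- The supertile of an assembly. -/
def toSupertile {T : Finset TileType} (α : Assembly T) : Supertile T :=
  Quotient.mk (translationSetoid T) α

/-- `c` belongs to the combination set of `a` and `b` at temperature `τ`: suitable translations of
`a` and `b` are disjoint and their union is a `τ`-stable assembly of the supertile `c`. -/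
def Combines {T : Finset TileType} (τ : ℕ) (a b c : Supertile T) : Prop :=
  ∃ α β : Assembly T, toSupertile α = a ∧ toSupertile β = b ∧ Disjoint α.dom β.dom ∧
    (α.union β).Stable τ ∧ toSupertile (α.union β) = c

/-- The supertiles that may be supplied in an initial state: the finite, nonempty, `τ`-stable
ones. -/
def IsInput {T : Finset TileType} (τ : ℕ) (a : Supertile T) : Prop :=
  ∃ α : Assembly T, toSupertile α = a ∧ α.dom.Finite ∧ α.dom.Nonempty ∧ α.Stable τ

/-- The supertiles that consist of a single tile of the tile set. -/
def singletons (T : Finset TileType) : Set (Supertile T) :=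
  Set.range fun t : {t : TileType // t ∈ T} => toSupertile (Assembly.single t)

/-! ### Two-handed tile assembly systems -/

/-- A two-handed tile assembly system at temperature `τ`: a finite set of tile types and an initial
state, which is a set of supertiles, each of them supplied in infinitely many copies. -/
structure TAS (τ : ℕ) where
  tiles : Finset TileType
  initial : Set (Supertile tiles)
  initial_ok : ∀ a ∈ initial, IsInput τ a

namespace TAS

variable {τ : ℕ}

/-- The supertiles that occur after finitely many steps: the initial ones, and those obtained by a
`τ`-stable attachment of two supertiles that have already been obtained. -/
inductive Occurs (𝒯 : TAS τ) : Supertile 𝒯.tiles → Prop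
  | start {a : Supertile 𝒯.tiles} : a ∈ 𝒯.initial → Occurs 𝒯 a
  | attach {a b c : Supertile 𝒯.tiles} :
      Occurs 𝒯 a → Occurs 𝒯 b → Combines τ a b c → Occurs 𝒯 c

/-- An assembly sequence, followed along one growing assembly: at each step the assembly either is
unchanged or is attached `τ`-stably to an assembly whose supertile satisfies `P`. Finite sequences
are the eventually constant ones. -/
def IsSequence (𝒯 : TAS τ) (P : Supertile 𝒯.tiles → Prop) (s : ℕ → Assembly 𝒯.tiles) : Prop :=
  ∀ i, s (i + 1) = s i ∨
    ∃ β : Assembly 𝒯.tiles, P (toSupertile β) ∧ Disjoint (s i).dom β.dom ∧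
      s (i + 1) = (s i).union β ∧ (s (i + 1)).Stable τ

/-- A supertile is producible if it is the result of a finite or infinite assembly sequence that
starts with a supertile of the initial state. Infinite supertiles can be producible. -/
def Producible (𝒯 : TAS τ) (a : Supertile 𝒯.tiles) : Prop :=
  ∃ (s : ℕ → Assembly 𝒯.tiles) (α : Assembly 𝒯.tiles), toSupertile (s 0) ∈ 𝒯.initial ∧
    𝒯.IsSequence 𝒯.Occurs s ∧ Assembly.IsResult s α ∧ toSupertile α = a

/-- `a →¹ b`: the attachment of one producible supertile turns `a` into `b`. -/
def Step (𝒯 : TAS τ) (a b : Supertile 𝒯.tiles) : Prop :=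
  ∃ c, 𝒯.Producible c ∧ Combines τ a c b

/-- `a →^{≤ 1} b`. -/
def StepLE (𝒯 : TAS τ) (a b : Supertile 𝒯.tiles) : Prop := a = b ∨ 𝒯.Step a b

/-- `a → b`: a finite or infinite assembly sequence, in which producible supertiles are attached,
leads from `a` to `b`. -/
def Grows (𝒯 : TAS τ) (a b : Supertile 𝒯.tiles) : Prop :=
  ∃ (s : ℕ → Assembly 𝒯.tiles) (α : Assembly 𝒯.tiles), toSupertile (s 0) = a ∧
    𝒯.IsSequence 𝒯.Producible s ∧ Assembly.IsResult s α ∧ toSupertile α = b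

end TAS

theorem isInput_of_mem_singletons {T : Finset TileType} (τ : ℕ) {a : Supertile T}
    (ha : a ∈ singletons T) : IsInput τ a := by
  obtain ⟨t, rfl⟩ := ha
  have hd : (Assembly.single t).dom = {0} := by
    ext p
    by_cases hp : p = 0 <;> simp [Assembly.dom, Assembly.single, hp]
  refine ⟨Assembly.single t, rfl, by simp [hd], by simp [hd], ?_⟩
  rintro S ⟨p, hp, hpS⟩ ⟨q, hq, hqS⟩
  rw [hd] at hp hq
  rw [Set.mem_singleton_iff] at hp hq
  subst hp hq
  exact absurd hpS hqS

/-- The system whose initial state consists of all single tiles of `U` and the supertiles in `I`. -/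
def inputSystem (τ : ℕ) (U : Finset TileType) (I : Set (Supertile U))
    (hI : ∀ a ∈ I, IsInput τ a) : TAS τ where
  tiles := U
  initial := singletons U ∪ I
  initial_ok := fun a ha => ha.elim (isInput_of_mem_singletons τ) (hI a)

/-! ### Simulation -/

/-- An `m`-block assembly (macrotile) over `U`: a partial function on `{0, …, m - 1}²`. -/
abbrev Block (U : Finset TileType) (m : ℕ) : Type :=
  Fin m × Fin m → Option {t : TileType // t ∈ U}

/-- A partial function from the `m`-blocks over `U` to `T`. -/
abbrev BlockRep (U T : Finset TileType) (m : ℕ) : Type :=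
  Block U m → Option {t : TileType // t ∈ T}

section Representation

variable {U T : Finset TileType} {m : ℕ}

/-- The `m`-block of `α` with index `q`. -/
def Assembly.block (α : Assembly U) (m : ℕ) (q : ℤ × ℤ) : Block U m :=
  fun ij => α (m * q.1 + (ij.1 : ℕ), m * q.2 + (ij.2 : ℕ))

/-- The `m`-block of `α` with index `q` contains at least one tile. -/
def Assembly.BlockNonempty (α : Assembly U) (m : ℕ) (q : ℤ × ℤ) : Prop :=
  ∃ ij, α.block m q ij ≠ none

/-- The assembly representation function `R*`. -/
def assemblyRep (R : BlockRep U T m) (α : Assembly U) : Assembly T := fun q => R (α.block m q)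

/-- `α` maps cleanly to `R*(α)`: each nonempty block of `α` represents a tile or is horizontally or
vertically adjacent to a block that does, or `α` has at most one nonempty block. -/
def CleanAssembly (R : BlockRep U T m) (α : Assembly U) : Prop :=
  (∀ q, α.BlockNonempty m q →
    ∃ u v : ℤ, u ^ 2 + v ^ 2 < 2 ∧ q + (u, v) ∈ (assemblyRep R α).dom) ∨
  (∀ q q', α.BlockNonempty m q → α.BlockNonempty m q' → q = q')

/-- The supertile representation function: the set of all `R*(α)`, where `α` ranges over the
assemblies of the supertile `a`. Those positions of `a` relative to the block grid at which no block
represents a tile are disregarded. The set is empty if `a` does not represent any tile. -/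
def supertileRep (R : BlockRep U T m) (a : Supertile U) : Set (Assembly T) :=
  {β | β.dom.Nonempty ∧ ∃ α, toSupertile α = a ∧ assemblyRep R α = β}

/-- The set assigned to `a` by the supertile representation function is the supertile `b`. -/
def Represents (R : BlockRep U T m) (a : Supertile U) (b : Supertile T) : Prop :=
  supertileRep R a = {β | toSupertile β = b}

/-- The supertile `a` maps cleanly: either it represents a supertile, and all assemblies of `a` that
represent some tile map cleanly; or it does not represent any tile, and it fits into one block. -/
def MapsCleanly (R : BlockRep U T m) (a : Supertile U) : Prop :=
  ((∃ b, Represents R a b) ∧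
    ∀ α, toSupertile α = a → (assemblyRep R α).dom.Nonempty → CleanAssembly R α) ∨
  (supertileRep R a = ∅ ∧ ∃ α, toSupertile α = a ∧ CleanAssembly R α)

end Representation

section Simulation

variable {τ τ' : ℕ} {m : ℕ}

/-- Equivalent productions: the supertiles of `𝒯` represented by producible supertiles of `𝒰` are
exactly the producible ones, and all producible supertiles of `𝒰` map cleanly. -/
def EquivalentProductions (𝒰 : TAS τ') (𝒯 : TAS τ) (R : BlockRep 𝒰.tiles 𝒯.tiles m) : Prop :=
  {b | ∃ a, 𝒰.Producible a ∧ Represents R a b} = {b | 𝒯.Producible b} ∧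
  ∀ a, 𝒰.Producible a → MapsCleanly R a

/-- `𝒯` follows `𝒰`. -/
def Follows (𝒯 : TAS τ) (𝒰 : TAS τ') (R : BlockRep 𝒰.tiles 𝒯.tiles m) : Prop :=
  ∀ a a', 𝒰.Producible a → 𝒰.Producible a' → 𝒰.Step a a' →
    ∀ b, Represents R a b → ∃ b', Represents R a' b' ∧ 𝒯.StepLE b b'

/-- `𝒰` weakly models `𝒯`. -/
def WeaklyModels (𝒰 : TAS τ') (𝒯 : TAS τ) (R : BlockRep 𝒰.tiles 𝒯.tiles m) : Prop :=
  ∀ a b, 𝒯.Producible a → 𝒯.Producible b → 𝒯.Step a b →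
    ∀ a', 𝒰.Producible a' → Represents R a' a →
      ∃ a'', 𝒰.Producible a'' ∧ Represents R a'' a ∧ 𝒰.Grows a' a'' ∧
        ∃ b', 𝒰.Producible b' ∧ Represents R b' b ∧ 𝒰.Step a'' b'

/-- `𝒰` simulates `𝒯` at scale factor `m`, with block representation function `R`. -/
def Simulates (𝒰 : TAS τ') (𝒯 : TAS τ) (R : BlockRep 𝒰.tiles 𝒯.tiles m) : Prop :=
  EquivalentProductions 𝒰 𝒯 R ∧ Follows 𝒯 𝒰 R ∧ WeaklyModels 𝒰 𝒯 R

end Simulation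

end TwoHAM

namespace TwoHAM

/-! The simulating assemblies are built from rigid pieces. A tile `t` of the simulated system at
position `q` becomes a macrotile: a body, which is a square with combs on its four sides, and up to
eight connectors, two for each side. A piece consists of coarse cells, each made of 2 × 2 tiles, and
all bonds inside a piece have strength ⌈τ/2⌉. One such bond is too weak to hold anything at
temperature τ, but two of them suffice. A cut through a coarse cell, or between two adjacent ones,
meets at least two bonds, so pieces do not break (`tied_piece`).

A tile set of size O(τ) cannot carry the glue labels of an arbitrary system. The glues between
pieces therefore record only the place of contact and a strength, and equality of labels is checked
by shape. The teeth of a comb spell a binary code of a glue on one side of the spine and its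
complement on the other. Combs in adjacent slots interlock if their codes are equal and overlap
otherwise (`disjoint_of_compat`, `compat_of_disjoint`). The codes have O(log |T|) bits and are
written in rectangles, so blocks have side O(√log |T|). Connectors are optional, because adjacent
tiles with different glues are allowed in the simulated system; the bodies alone never touch each
other's combs.

A connector binds to its body by two bonds of strength ⌈τ/2⌉. Two facing connectors bind by a single
bond, and the strength `s` of the simulated glue, truncated at τ, is split between the two connector
pairs of a side. Each share is less than τ, so a connector cannot join anything unless its body is
present (`exists_body`); together the shares give `min s τ`, which is enough for comparing cuts with
τ.

Soundness: a free single tile never attaches, since it has at most one contact glue and interior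
glues do not face outwards (`single_attach_asm`). A matching contact glue forces the block grids to
coincide (`attach_asm`). Hence a producible supertile is a single tile, a single connector, or a
configuration of macrotiles. All bonds between different macrotiles are shares of bonds of the
represented assembly, so stability passes to the latter (`stable_rep`, `good_of_producible`).

Completeness: if both connectors are present at each positive bond, then a cut that respects
macrotiles has enough weight (`stable_asm`). An assembly sequence of the simulated system is
imitated by restricting such a full configuration to the blocks occupied at each stage
(`producible_asm`). For weak modelling, the missing connectors are added first, and then the partner
attaches in one step (`weaklyModels`). Limits are treated by unions of increasing sets of pieces. -/

open Classical in
noncomputable instance : Fintype Dir where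
  elems := {Dir.north, Dir.east, Dir.south, Dir.west}
  complete d := by cases d <;> simp

@[simp] theorem Dir.opp_opp (d : Dir) : d.opp.opp = d := by cases d <;> rfl

@[simp] theorem Dir.vec_opp (d : Dir) : d.opp.vec = -d.vec := by cases d <;> rfl

theorem Dir.vec_injective : Function.Injective Dir.vec := by
  intro d e h
  cases d <;> cases e <;> simp_all [Dir.vec]

/-! ### Assemblies under translation, union and inclusion -/

namespace Assembly

variable {T : Finset TileType}

theorem mem_dom {α : Assembly T} {p : ℤ × ℤ} : p ∈ α.dom ↔ ∃ t, α p = some t := by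
  simp [dom, Option.ne_none_iff_exists']

theorem mem_dom_of_eq_some {α : Assembly T} {p : ℤ × ℤ} {t} (h : α p = some t) : p ∈ α.dom :=
  mem_dom.2 ⟨t, h⟩

theorem eq_none_of_not_mem_dom {α : Assembly T} {p : ℤ × ℤ} (h : p ∉ α.dom) : α p = none := by
  simpa [dom] using h

@[simp] theorem translate_zero (α : Assembly T) : α.translate 0 = α := by
  funext p; simp [translate]

theorem translate_translate (u v : ℤ × ℤ) (α : Assembly T) :
    (α.translate u).translate v = α.translate (u + v) := by
  funext p; simp [translate, sub_sub, add_comm]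

theorem translate_union (u : ℤ × ℤ) (α β : Assembly T) :
    (α.union β).translate u = (α.translate u).union (β.translate u) := rfl

theorem mem_dom_translate {u p : ℤ × ℤ} {α : Assembly T} :
    p ∈ (α.translate u).dom ↔ p - u ∈ α.dom := Iff.rfl

theorem dom_union (α β : Assembly T) : (α.union β).dom = α.dom ∪ β.dom := by
  ext p
  simp only [dom, union, Set.mem_ofPred_eq, Set.mem_union]
  cases α p <;> simp

theorem union_apply_left {α β : Assembly T} {p : ℤ × ℤ} (h : p ∈ α.dom) :
    (α.union β) p = α p := by
  obtain ⟨t, ht⟩ := mem_dom.1 h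
  simp [union, ht]

theorem union_apply_right {α β : Assembly T} {p : ℤ × ℤ} (h : p ∉ α.dom) :
    (α.union β) p = β p := by
  simp [union, eq_none_of_not_mem_dom h]

theorem union_comm_of_disjoint {α β : Assembly T} (h : Disjoint α.dom β.dom) :
    α.union β = β.union α := by
  funext p
  by_cases hp : p ∈ α.dom
  · rw [union_apply_left hp, union_apply_right (Set.disjoint_left.1 h hp)]
  · rw [union_apply_right hp]
    by_cases hq : p ∈ β.dom
    · rw [union_apply_left hq]
    · rw [union_apply_right hq, eq_none_of_not_mem_dom hp, eq_none_of_not_mem_dom hq]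

theorem disjoint_dom_translate {α β : Assembly T} (u : ℤ × ℤ) (h : Disjoint α.dom β.dom) :
    Disjoint (α.translate u).dom (β.translate u).dom := by
  rw [Set.disjoint_left] at h ⊢
  exact fun p hp hq => h hp hq

theorem Sub.refl (α : Assembly T) : α.Sub α := fun _ _ => rfl

theorem Sub.mem_dom {α β : Assembly T} (h : α.Sub β) {p : ℤ × ℤ} (hp : p ∈ α.dom) :
    p ∈ β.dom := by
  have := h p hp
  simp only [dom, Set.mem_ofPred_eq] at hp ⊢
  rwa [← this]

theorem Sub.trans {α β γ : Assembly T} (h : α.Sub β) (h' : β.Sub γ) : α.Sub γ :=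
  fun p hp => (h p hp).trans (h' p (h.mem_dom hp))

theorem sub_union_left (α β : Assembly T) : α.Sub (α.union β) :=
  fun _ hp => (union_apply_left hp).symm

theorem sub_union_right {α β : Assembly T} (h : Disjoint α.dom β.dom) : β.Sub (α.union β) :=
  fun _ hp => (union_apply_right (Set.disjoint_right.1 h hp)).symm

/-! ### Bonds and cuts -/

theorem bond_eq_of_some {α : Assembly T} {p : ℤ × ℤ} {d : Dir} {s t}
    (hs : α p = some s) (ht : α (p + d.vec) = some t) :
    α.bond p d = if s.1.glue d = t.1.glue d.opp then (s.1.glue d).strength else 0 := by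
  simp [bond, hs, ht]

theorem exists_of_bond_pos {α : Assembly T} {p : ℤ × ℤ} {d : Dir} (h : 0 < α.bond p d) :
    ∃ s t, α p = some s ∧ α (p + d.vec) = some t ∧ s.1.glue d = t.1.glue d.opp ∧
      α.bond p d = (s.1.glue d).strength := by
  unfold bond at h ⊢
  cases hs : α p with
  | none => simp [hs] at h
  | some s =>
    cases ht : α (p + d.vec) with
    | none => simp [hs, ht] at h
    | some t =>
      by_cases hg : s.1.glue d = t.1.glue d.opp
      · exact ⟨s, t, rfl, rfl, hg, by simp [hg]⟩
      · simp [hs, ht, hg] at h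

theorem bond_opp (α : Assembly T) (p : ℤ × ℤ) (d : Dir) :
    α.bond (p + d.vec) d.opp = α.bond p d := by
  cases hs : α p with
  | none => simp [bond, hs]
  | some s =>
    cases ht : α (p + d.vec) with
    | none => simp [bond, hs, ht]
    | some t =>
      rw [bond_eq_of_some hs ht, bond_eq_of_some (s := t) (t := s) ht (by simpa using hs)]
      by_cases hg : s.1.glue d = t.1.glue d.opp
      · simp [hg]
      · rw [if_neg hg, if_neg]
        simpa using fun h => hg h.symm

theorem Sub.bond_le {α β : Assembly T} (h : α.Sub β) (p : ℤ × ℤ) (d : Dir) :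
    α.bond p d ≤ β.bond p d := by
  rcases Nat.eq_zero_or_pos (α.bond p d) with h0 | h0
  · omega
  · obtain ⟨s, t, hs, ht, hg, he⟩ := exists_of_bond_pos h0
    rw [he, bond_eq_of_some ((h p (mem_dom_of_eq_some hs)).symm.trans hs)
      ((h _ (mem_dom_of_eq_some ht)).symm.trans ht), if_pos hg]

theorem bond_translate (α : Assembly T) (u p : ℤ × ℤ) (d : Dir) :
    (α.translate u).bond p d = α.bond (p - u) d := by
  simp only [bond, translate]
  rw [show p + d.vec - u = p - u + d.vec by abel]

/-- The cut of the binding graph of `α` between `S` and its complement has weight at least `τ`. -/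
def Cut (τ : ℕ) (α : Assembly T) (S : Set (ℤ × ℤ)) : Prop :=
  ∃ F : Finset ((ℤ × ℤ) × Dir), (∀ e ∈ F, e.1 ∈ S ∧ e.1 + e.2.vec ∉ S) ∧
    τ ≤ ∑ e ∈ F, α.bond e.1 e.2

open Classical in
theorem Cut.compl {τ : ℕ} {α : Assembly T} {S : Set (ℤ × ℤ)} (h : Cut τ α S) : Cut τ α Sᶜ := by
  obtain ⟨F, hF, hw⟩ := h
  have hinj : Function.Injective
      (fun e : (ℤ × ℤ) × Dir => ((e.1 + e.2.vec, e.2.opp) : (ℤ × ℤ) × Dir)) := by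
    rintro ⟨p, d⟩ ⟨q, e⟩ h
    simp only [Prod.mk.injEq] at h
    have hd : d = e := by rw [← Dir.opp_opp d, h.2, Dir.opp_opp]
    subst hd
    simpa using h.1
  refine ⟨F.image fun e => (e.1 + e.2.vec, e.2.opp), ?_, ?_⟩
  · intro e he
    obtain ⟨f, hf, rfl⟩ := Finset.mem_image.1 he
    simpa using (hF f hf).symm
  · rw [Finset.sum_image fun _ _ _ _ h => hinj h]
    simpa [bond_opp] using hw

theorem cut_compl {τ : ℕ} {α : Assembly T} {S : Set (ℤ × ℤ)} : Cut τ α Sᶜ ↔ Cut τ α S :=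
  ⟨fun h => by simpa using h.compl, Cut.compl⟩

theorem Cut.mono {τ : ℕ} {α β : Assembly T} {S : Set (ℤ × ℤ)} (h : α.Sub β) (hc : Cut τ α S) :
    Cut τ β S := by
  obtain ⟨F, hF, hw⟩ := hc
  exact ⟨F, hF, hw.trans (Finset.sum_le_sum fun e _ => h.bond_le e.1 e.2)⟩

open Classical in
theorem Cut.of_pair {τ : ℕ} {α : Assembly T} {S : Set (ℤ × ℤ)} {p q : ℤ × ℤ} {d e : Dir}
    (hne : (p, d) ≠ (q, e)) (hp : p ∈ S) (hp' : p + d.vec ∉ S) (hq : q ∈ S) (hq' : q + e.vec ∉ S)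
    (hw : τ ≤ α.bond p d + α.bond q e) : Cut τ α S := by
  refine ⟨{(p, d), (q, e)}, ?_, ?_⟩
  · intro f hf
    rcases Finset.mem_insert.1 hf with rfl | hf
    · exact ⟨hp, hp'⟩
    · rw [Finset.mem_singleton.1 hf]
      exact ⟨hq, hq'⟩
  · rwa [Finset.sum_pair hne]

theorem Cut.translate {τ : ℕ} {α : Assembly T} {S : Set (ℤ × ℤ)} (u : ℤ × ℤ)
    (h : Cut τ α {p | p + u ∈ S}) : Cut τ (α.translate u) S := by
  obtain ⟨F, hF, hw⟩ := h
  refine ⟨F.map ⟨fun e => (e.1 + u, e.2), ?_⟩, ?_, ?_⟩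
  · rintro ⟨p, d⟩ ⟨q, e⟩ h
    simpa using h
  · intro e he
    obtain ⟨f, hf, rfl⟩ := Finset.mem_map.1 he
    have := hF f hf
    simp only [Set.mem_ofPred_eq] at this
    rw [add_right_comm] at this
    exact this
  · rw [Finset.sum_map]
    refine hw.trans_eq (Finset.sum_congr rfl fun e _ => ?_)
    rw [bond_translate]
    change _ = α.bond (e.1 + u - u) e.2
    rw [add_sub_cancel_right]

theorem Stable.translate {τ : ℕ} {α : Assembly T} (u : ℤ × ℤ) (h : α.Stable τ) :
    (α.translate u).Stable τ := by
  rintro S ⟨p, hp, hpS⟩ ⟨q, hq, hqS⟩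
  exact Cut.translate u (h _ ⟨p - u, hp, by simpa using hpS⟩ ⟨q - u, hq, by simpa using hqS⟩)

theorem stable_translate_iff {τ : ℕ} {α : Assembly T} {u : ℤ × ℤ} :
    (α.translate u).Stable τ ↔ α.Stable τ :=
  ⟨fun h => by simpa [translate_translate] using h.translate (-u), Stable.translate u⟩

/-- No cut of weight less than `τ` separates `p` from `q`. -/
def Tied (τ : ℕ) (α : Assembly T) (p q : ℤ × ℤ) : Prop :=
  ∀ S : Set (ℤ × ℤ), p ∈ S → q ∉ S → Cut τ α S

theorem Tied.refl (τ : ℕ) (α : Assembly T) (p : ℤ × ℤ) : Tied τ α p p :=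
  fun _ h h' => absurd h h'

theorem Tied.symm {τ : ℕ} {α : Assembly T} {p q : ℤ × ℤ} (h : Tied τ α p q) : Tied τ α q p :=
  fun S hq hp => cut_compl.1 (h Sᶜ hp (by simpa using hq))

/-- A set that separates `p` from `r` also separates `q` from one of them. Being tied is thus an
equivalence relation, and stability can be proved by chaining local ties. -/
theorem Tied.trans {τ : ℕ} {α : Assembly T} {p q r : ℤ × ℤ} (h : Tied τ α p q)
    (h' : Tied τ α q r) : Tied τ α p r := fun S hp hr =>
  (em (q ∈ S)).elim (fun hq => h' S hq hr) (fun hq => h S hp hq)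

theorem Tied.mono {τ : ℕ} {α β : Assembly T} {p q : ℤ × ℤ} (hs : α.Sub β) (h : Tied τ α p q) :
    Tied τ β p q := fun S hp hq => (h S hp hq).mono hs

theorem Stable.tied {τ : ℕ} {α : Assembly T} (h : α.Stable τ) {p q : ℤ × ℤ} (hp : p ∈ α.dom)
    (hq : q ∈ α.dom) : Tied τ α p q := fun S hpS hqS => h S ⟨p, hp, hpS⟩ ⟨q, hq, hqS⟩

theorem stable_of_tied {τ : ℕ} {α : Assembly T} (h : ∀ p ∈ α.dom, ∀ q ∈ α.dom, Tied τ α p q) :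
    α.Stable τ := by
  rintro S ⟨p, hp, hpS⟩ ⟨q, hq, hqS⟩
  exact h p hp q hq S hpS hqS

/-- Two parallel edges that together have weight `τ` tie their ends if the corresponding ends of
these edges are tied. -/
theorem tied_of_parallel {τ : ℕ} {α : Assembly T} {p q : ℤ × ℤ} {d e : Dir}
    (hne : (p, d) ≠ (q, e)) (h : Tied τ α p q) (h' : Tied τ α (p + d.vec) (q + e.vec))
    (hw : τ ≤ α.bond p d + α.bond q e) : Tied τ α p (p + d.vec) := by
  intro S hp hp'
  by_cases hq : q ∈ S
  · by_cases hq' : q + e.vec ∈ S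
    · exact h'.symm S hq' hp'
    · exact Cut.of_pair hne hp hp' hq hq' hw
  · exact h S hp hq

end Assembly

/-! ### Supertiles -/

section Supertile

variable {T : Finset TileType}

theorem toSupertile_eq_iff {α β : Assembly T} :
    toSupertile α = toSupertile β ↔ ∃ u : ℤ × ℤ, α.translate u = β :=
  Quotient.eq (r := translationSetoid T)

theorem toSupertile_translate (α : Assembly T) (u : ℤ × ℤ) :
    toSupertile (α.translate u) = toSupertile α :=
  (toSupertile_eq_iff.2 ⟨u, rfl⟩).symm

theorem exists_rep (a : Supertile T) : ∃ α, toSupertile α = a := Quotient.exists_rep a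

end Supertile

/-! ### Assembly sequences -/

namespace TAS

variable {τ : ℕ} {𝒯 : TAS τ}

open Assembly

theorem IsSequence.sub {P : Supertile 𝒯.tiles → Prop} {s : ℕ → Assembly 𝒯.tiles}
    (h : 𝒯.IsSequence P s) {i j : ℕ} (hij : i ≤ j) : (s i).Sub (s j) := by
  induction j, hij using Nat.le_induction with
  | base => exact Sub.refl _
  | succ j _ ih =>
    refine ih.trans ?_
    rcases h j with h | ⟨β, _, _, h, _⟩
    · rw [h]; exact Sub.refl _
    · rw [h]; exact sub_union_left _ _

/-- The attachment tree of a supertile becomes a sequence by following its first branch; the second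
branches are the attached supertiles, which occur by themselves. -/
theorem Occurs.exists_sequence {a : Supertile 𝒯.tiles} (ha : 𝒯.Occurs a) :
    ∀ α, toSupertile α = a → ∃ (s : ℕ → Assembly 𝒯.tiles) (n : ℕ),
      toSupertile (s 0) ∈ 𝒯.initial ∧ 𝒯.IsSequence 𝒯.Occurs s ∧ s n = α := by
  induction ha with
  | start h =>
    intro α hα
    exact ⟨fun _ => α, 0, hα ▸ h, fun _ => Or.inl rfl, rfl⟩
  | attach _ hb hc iha _ =>
    intro γ hγ
    obtain ⟨α, β, rfl, rfl, hd, hs, rfl⟩ := hc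
    obtain ⟨u, rfl⟩ := toSupertile_eq_iff.1 hγ.symm
    obtain ⟨s, n, h0, hseq, hn⟩ := iha (α.translate u) (toSupertile_translate α u)
    refine ⟨fun i => if i ≤ n then s i else (α.union β).translate u, n + 1, by simpa, ?_, by simp⟩
    intro i
    rcases lt_trichotomy i n with hi | rfl | hi
    · simpa [hi.le, Nat.succ_le_of_lt hi] using hseq i
    · right
      refine ⟨β.translate u, by rwa [toSupertile_translate], ?_, ?_, ?_⟩
      · simpa [hn] using disjoint_dom_translate u hd
      · simp [hn, translate_union]
      · simpa using hs.translate u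
    · left
      simp [not_le.2 hi, not_le.2 (hi.trans (Nat.lt_succ_self i))]

/-- An assembly sequence may start with any supertile that occurs. -/
theorem producible_of_sequence {s : ℕ → Assembly 𝒯.tiles} {α : Assembly 𝒯.tiles}
    (h0 : 𝒯.Occurs (toSupertile (s 0))) (hs : 𝒯.IsSequence 𝒯.Occurs s) (hα : IsResult s α) :
    𝒯.Producible (toSupertile α) := by
  obtain ⟨t, n, ht0, ht, htn⟩ := h0.exists_sequence (s 0) rfl
  -- The sequence `t` is run up to time `n`, where it has reached `s 0`, and then `s` takes over.
  have key : ∀ i, (if i ≤ n then t i else s (i - n)).Sub α := by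
    intro i
    split_ifs with hi
    · exact (ht.sub hi).trans (htn ▸ hα.2 0)
    · exact hα.2 _
  refine ⟨fun i => if i ≤ n then t i else s (i - n), α, by simpa, ?_, ⟨?_, key⟩, rfl⟩
  · intro i
    rcases lt_trichotomy i n with hi | rfl | hi
    · simpa [hi.le, Nat.succ_le_of_lt hi] using ht i
    · simpa [htn] using hs 0
    · have := hs (i - n)
      rw [← Nat.sub_add_comm hi.le] at this
      simpa [not_le.2 hi, not_le.2 (hi.trans (Nat.lt_succ_self i))] using this
  · refine Set.Subset.antisymm ?_ (Set.iUnion_subset fun i p hp => (key i).mem_dom hp)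
    rw [hα.1]
    refine Set.iUnion_subset fun i p hp => Set.mem_iUnion.2 ⟨i + n, ?_⟩
    rcases Nat.eq_zero_or_pos i with rfl | hi
    · simpa [htn] using hp
    · simpa [hi.ne'] using hp

theorem isResult_const (α : Assembly 𝒯.tiles) : IsResult (fun _ => α) α :=
  ⟨(Set.iUnion_const _).symm, fun _ => Sub.refl α⟩

theorem Occurs.producible {a : Supertile 𝒯.tiles} (h : 𝒯.Occurs a) : 𝒯.Producible a := by
  obtain ⟨α, rfl⟩ := exists_rep a
  exact producible_of_sequence (s := fun _ => α) h (fun _ => Or.inl rfl) (isResult_const α)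

end TAS

/-! ### The universal tile set -/

/-- A string of length `k`. -/
def strLabel (k : ℕ) : String := String.ofList (List.replicate k default)

theorem strLabel_injective : Function.Injective strLabel := by
  intro k l h
  simpa [strLabel] using congrArg String.length h

/-- The strength of the bonds inside pieces: less than `τ`, but two of them suffice. -/
def half (τ : ℕ) : ℕ := (τ + 1) / 2

def nullGlue : Glue := ⟨strLabel 0, 0⟩

/-- The glue between adjacent coarse cells of a piece. -/
def extGlue (τ : ℕ) : Glue := ⟨strLabel 1, half τ⟩

/-- The glue between the four tiles of a coarse cell. -/
def colorGlue (τ : ℕ) (c : Fin 3) : Glue := ⟨strLabel (2 + c), half τ⟩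

/-- The glue between different pieces. -/
def contactGlue (l s : ℕ) : Glue := ⟨strLabel (5 + l), s⟩

theorem colorGlue_injective (τ : ℕ) : Function.Injective (colorGlue τ) := by
  intro c c' h
  have := strLabel_injective (Glue.mk.inj h).1
  exact Fin.ext (by omega)

theorem colorGlue_ne_extGlue (τ : ℕ) (c : Fin 3) : colorGlue τ c ≠ extGlue τ := by
  intro h
  have := strLabel_injective (Glue.mk.inj h).1
  omega

theorem colorGlue_ne_nullGlue (τ : ℕ) (c : Fin 3) : colorGlue τ c ≠ nullGlue := by
  intro h
  have := strLabel_injective (Glue.mk.inj h).1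
  omega

theorem colorGlue_ne_contactGlue (τ : ℕ) (c : Fin 3) (l s : ℕ) :
    colorGlue τ c ≠ contactGlue l s := by
  intro h
  have := strLabel_injective (Glue.mk.inj h).1
  omega

theorem extGlue_ne_contactGlue (τ : ℕ) (l s : ℕ) : extGlue τ ≠ contactGlue l s := by
  intro h
  have := strLabel_injective (Glue.mk.inj h).1
  omega

theorem contactGlue_inj {l s l' s' : ℕ} : contactGlue l s = contactGlue l' s' ↔ l = l' ∧ s = s' := by
  constructor
  · intro h
    obtain ⟨h, h'⟩ := Glue.mk.inj h
    have := strLabel_injective h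
    exact ⟨by omega, h'⟩
  · rintro ⟨rfl, rfl⟩
    rfl

/-- The data that determine a tile of the universal tile set: its colour, its quadrant in a coarse
cell, which of its outer sides bind to the same piece, and at most one contact glue on an outer
side. -/
abbrev TileData (τ : ℕ) : Type :=
  Fin 3 × (Bool × Bool) × (Bool × Bool) × Option (Bool × Fin 48 × Fin τ)

/-- Each tile has one outer horizontal and one outer vertical side, according to its quadrant; `v =
true` is the vertical one. The optional datum places a contact glue on at most one of them, which
keeps the count linear in `τ`. -/
def outerGlue (τ : ℕ) (v b : Bool) : Option (Bool × Fin 48 × Fin τ) → Glue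
  | some (w, l, s) => if v = w then contactGlue l s else if b then extGlue τ else nullGlue
  | none => if b then extGlue τ else nullGlue

def dataTile (τ : ℕ) : TileData τ → TileType
  | (c, (x, y), (bx, bv), o) => ⟨fun d => match d with
    | .east => if x then outerGlue τ false bx o else colorGlue τ c
    | .west => if x then colorGlue τ c else outerGlue τ false bx o
    | .north => if y then outerGlue τ true bv o else colorGlue τ c
    | .south => if y then colorGlue τ c else outerGlue τ true bv o⟩

/-- The universal tile set. -/
noncomputable def universalTiles (τ : ℕ) : Finset TileType :=
  @Finset.image _ _ (Classical.decEq _) (dataTile τ) Finset.univ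

theorem mem_universalTiles {τ : ℕ} {t : TileType} :
    t ∈ universalTiles τ ↔ ∃ z, dataTile τ z = t := by
  classical
  simp [universalTiles]

/-- The number of data is 3 · 4 · 4 · (1 + 2 · 48 · τ) = 4608τ + 48. -/
theorem card_universalTiles_le {τ : ℕ} (h : 1 ≤ τ) : (universalTiles τ).card ≤ 4656 * τ := by
  refine (@Finset.card_image_le _ _ Finset.univ (dataTile τ) (Classical.decEq _)).trans ?_
  simp only [Finset.card_univ, Fintype.card_prod, Fintype.card_fin, Fintype.card_bool,
    Fintype.card_option]
  omega

attribute [irreducible] universalTiles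

theorem half_lt {τ : ℕ} (h : 2 ≤ τ) : half τ < τ := by unfold half; omega

theorem le_half_add_half (τ : ℕ) : τ ≤ half τ + half τ := by unfold half; omega

/-- The glues of the universal tile set. -/
theorem glue_cases {τ : ℕ} {t : TileType} (ht : t ∈ universalTiles τ) (d : Dir) :
    (∃ c, t.glue d = colorGlue τ c) ∨ t.glue d = extGlue τ ∨ t.glue d = nullGlue ∨
      ∃ l s, s < τ ∧ t.glue d = contactGlue l s := by
  obtain ⟨⟨c, ⟨x, y⟩, ⟨bx, bv⟩, o⟩, rfl⟩ := mem_universalTiles.1 ht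
  have key : ∀ v b, (outerGlue τ v b o = extGlue τ ∨ outerGlue τ v b o = nullGlue ∨
      ∃ l s, s < τ ∧ outerGlue τ v b o = contactGlue l s) := by
    intro v b
    rcases o with _ | ⟨w, l, s⟩
    · cases b <;> simp [outerGlue]
    · by_cases hv : v = w
      · exact Or.inr (Or.inr ⟨l, s, s.2, by simp [outerGlue, hv]⟩)
      · cases b <;> simp [outerGlue, hv]
  cases d <;> cases x <;> cases y <;> first | exact Or.inl ⟨c, rfl⟩ | exact Or.inr (key _ _)

/-- No single bond is sufficient for an attachment; this is what keeps loose tiles and loose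
connectors inert. -/
theorem strength_lt {τ : ℕ} (hτ : 2 ≤ τ) {t : TileType} (ht : t ∈ universalTiles τ) (d : Dir) :
    (t.glue d).strength < τ := by
  have := half_lt hτ
  rcases glue_cases ht d with ⟨c, h⟩ | h | h | ⟨l, s, hs, h⟩ <;> rw [h] <;>
    simp [colorGlue, extGlue, nullGlue, contactGlue] <;> omega

/-- A tile has at most one contact glue. -/
theorem contact_unique {τ : ℕ} {t : TileType} (ht : t ∈ universalTiles τ) {d d' : Dir}
    {l s l' s' : ℕ} (h : t.glue d = contactGlue l s) (h' : t.glue d' = contactGlue l' s') :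
    d = d' := by
  obtain ⟨⟨c, ⟨x, y⟩, ⟨bx, bv⟩, o⟩, rfl⟩ := mem_universalTiles.1 ht
  -- The optional datum names the only axis on which a contact glue can occur.
  have key : ∀ v b l s, outerGlue τ v b o = contactGlue l s → o.map Prod.fst = some v := by
    intro v b l s h
    have h1 := extGlue_ne_contactGlue τ l s
    have h2 : nullGlue ≠ contactGlue l s := by
      intro h
      have := strLabel_injective (Glue.mk.inj h).1
      omega
    rcases o with _ | ⟨w, m, r⟩
    · cases b <;> simp_all [outerGlue]
    · by_cases hv : v = w
      · simp [hv]
      · cases b <;> simp_all [outerGlue]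
  have hc := fun l s => colorGlue_ne_contactGlue τ c l s
  have hexcl : ∀ b l s, outerGlue τ true b o = contactGlue l s →
      ∀ b' l' s', outerGlue τ false b' o ≠ contactGlue l' s' := by
    intro b l s h b' l' s' h'
    have := (key _ _ _ _ h).symm.trans (key _ _ _ _ h')
    simp at this
  cases d <;> cases d' <;> cases x <;> cases y <;>
    first
    | rfl
    | exact absurd h (hc _ _)
    | exact absurd h' (hc _ _)
    | exact absurd h' (hexcl _ _ _ h _ _ _)
    | exact absurd h (hexcl _ _ _ h' _ _ _)

/-! ### Codes -/

theorem Dir.card : Nat.card Dir = 4 := by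
  have : Function.Bijective (![.north, .east, .south, .west] : Fin 4 → Dir) := by
    constructor
    · intro i j h
      fin_cases i <;> fin_cases j <;> simp_all
    · intro d
      cases d
      exacts [⟨0, rfl⟩, ⟨1, rfl⟩, ⟨2, rfl⟩, ⟨3, rfl⟩]
  simpa using (Nat.card_congr (Equiv.ofBijective _ this)).symm


/-- The glues of a tile set. -/
abbrev GlueOf (T : Finset TileType) : Type := {g : Glue // ∃ t ∈ T, ∃ d, t.glue d = g}

def glueOf {T : Finset TileType} (t : {t : TileType // t ∈ T}) (d : Dir) : GlueOf T :=
  ⟨t.1.glue d, t.1, t.2, d, rfl⟩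

/-- Codes for the glues and the tiles of a tile set. The code of a glue is a set of cells of a
rectangle that is contained in no code of another glue, the code of a tile is a set of cells of a
square. -/
structure Coding (T : Finset TileType) where
  n : ℤ
  n_pos : 0 < n
  glueCode : GlueOf T → ℤ → ℤ → Prop
  glueCode_sep : ∀ g g', g ≠ g' → ∃ x y, 0 ≤ x ∧ x < 2 * n ∧ 0 ≤ y ∧ y < n ∧
    glueCode g x y ∧ ¬ glueCode g' x y
  tileCode : {t : TileType // t ∈ T} → ℤ → ℤ → Prop
  tileCode_sep : ∀ t t', t ≠ t' → ∃ x y, 0 ≤ x ∧ x < n ∧ 0 ≤ y ∧ y < n ∧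
    ¬ (tileCode t x y ↔ tileCode t' x y)

/-- There are at most 4|T| glues and |T| tiles, so words of n² bits distinguish them. The code of a
glue is its word in one square and the complementary word in the next, so that no code contains
another. The code of a tile is only read, not matched by shape, and needs no complement. -/
theorem exists_coding (T : Finset TileType) (n : ℕ) (hn : 0 < n) (h : 4 * T.card ≤ 2 ^ (n * n)) :
    ∃ C : Coding T, C.n = n := by
  classical
  have hfun : Nat.card (Fin n → Fin n → Bool) = 2 ^ (n * n) := by
    simp [pow_mul]
  have hsurj : Function.Surjective
      (fun z : {t : TileType // t ∈ T} × Dir => glueOf z.1 z.2) := by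
    rintro ⟨g, t, ht, d, rfl⟩
    exact ⟨(⟨t, ht⟩, d), rfl⟩
  have hfin : Finite (GlueOf T) := Finite.of_surjective _ hsurj
  have hcard : Nat.card (GlueOf T) ≤ 4 * T.card := by
    refine (Nat.card_le_card_of_surjective _ hsurj).trans ?_
    rw [Nat.card_prod, Nat.card_eq_finsetCard, Dir.card, mul_comm]
  obtain ⟨f⟩ : Nonempty (GlueOf T ↪ (Fin n → Fin n → Bool)) :=
    ⟨Finite.equivFin _ |>.toEmbedding.trans <| (Fin.castLEEmb (by omega)).trans
      (Finite.equivFin (Fin n → Fin n → Bool)).symm.toEmbedding⟩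
  obtain ⟨f'⟩ : Nonempty ({t : TileType // t ∈ T} ↪ (Fin n → Fin n → Bool)) :=
    ⟨Finite.equivFin _ |>.toEmbedding.trans <| (Fin.castLEEmb (by simp at *; omega)).trans
      (Finite.equivFin (Fin n → Fin n → Bool)).symm.toEmbedding⟩
  have sep : ∀ {F G : Fin n → Fin n → Bool}, F ≠ G → ∃ i j, F i j ≠ G i j := by
    intro F G h
    by_contra! hc
    exact h (funext fun i => funext fun j => hc i j)
  refine ⟨⟨n, by exact_mod_cast hn,
    fun g x y => ∃ i j : Fin n, y = j ∧
      ((x = i ∧ f g i j = true) ∨ (x = n + i ∧ f g i j = false)), ?_,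
    fun t x y => ∃ i j : Fin n, x = i ∧ y = j ∧ f' t i j = true, ?_⟩, rfl⟩
  · intro g g' h
    obtain ⟨i, j, hij⟩ := sep (f.injective.ne h)
    have hi := i.2
    have hj := j.2
    cases hg : f g i j with
    | true =>
      rw [hg] at hij
      refine ⟨i, j, by omega, by omega, by omega, by omega, ⟨i, j, rfl, Or.inl ⟨rfl, hg⟩⟩, ?_⟩
      rintro ⟨i', j', hj', ⟨hi', h'⟩ | ⟨hi', h'⟩⟩
      · have hi : i = i' := Fin.ext (by omega)
        have hj : j = j' := Fin.ext (by omega)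
        subst hi hj
        exact hij h'.symm
      · omega
    | false =>
      rw [hg] at hij
      refine ⟨n + i, j, by omega, by omega, by omega, by omega, ⟨i, j, rfl, Or.inr ⟨rfl, hg⟩⟩, ?_⟩
      rintro ⟨i', j', hj', ⟨hi', h'⟩ | ⟨hi', h'⟩⟩
      · omega
      · have hi : i = i' := Fin.ext (by omega)
        have hj : j = j' := Fin.ext (by omega)
        subst hi hj
        exact hij h'.symm
  · intro t t' h
    obtain ⟨i, j, hij⟩ := sep (f'.injective.ne h)
    have hi := i.2
    have hj := j.2
    refine ⟨i, j, by omega, by omega, by omega, by omega, fun hiff => hij ?_⟩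
    have key : ∀ t, (∃ i' j' : Fin n, (i : ℤ) = i' ∧ (j : ℤ) = j' ∧ f' t i' j' = true) ↔
        f' t i j = true := by
      intro t
      constructor
      · rintro ⟨i', j', hi', hj', h'⟩
        have hi : i = i' := Fin.ext (by omega)
        have hj : j = j' := Fin.ext (by omega)
        subst hi hj
        exact h'
      · exact fun h => ⟨i, j, rfl, rfl, h⟩
    rw [key, key] at hiff
    exact Bool.eq_iff_iff.2 hiff

/-! ### Pieces -/

/-- The pieces of which the simulating assemblies consist: the body of the macrotile of `t` in block
`q`, and the two connectors for each side of that macrotile. -/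
inductive Piece (T : Finset TileType)
  | body (q : ℤ × ℤ) (t : {t : TileType // t ∈ T})
  | conn (q : ℤ × ℤ) (d : Dir) (j : Bool) (g : GlueOf T)

/-- The upward (`true`) or rightward (`false`) direction. -/
def posDir : Bool → Dir
  | true => .north
  | false => .east

def swapIf (ax : Bool) (p : ℤ × ℤ) : ℤ × ℤ := if ax then p else p.swap

namespace Piece

variable {T : Finset TileType}

def owner : Piece T → ℤ × ℤ
  | body q _ => q
  | conn q _ _ _ => q

def shift (v : ℤ × ℤ) : Piece T → Piece T
  | body q t => body (q + v) t
  | conn q d j g => conn (q + v) d j g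

/-- The piece `x` has a comb with code `g` in slot `a` of the vertical (`true`) or horizontal
(`false`) strip of block `b`. -/
def Slot : Piece T → Bool → ℤ × ℤ → ℤ → GlueOf T → Prop
  -- The strip between two adjacent blocks has two groups of slots, 0 to 3 and 5 to 8. Each group
  -- holds, in order, a comb of the first body, its connector, the connector of the second body, and
  -- a comb of the second body. Slot 4 stays empty and separates the groups.
  | body q t, ax, b, a, g =>
    (b = q ∧ (a = 0 ∨ a = 5) ∧ g = glueOf t (posDir ax)) ∨
      (b + (posDir ax).vec = q ∧ (a = 3 ∨ a = 8) ∧ g = glueOf t (posDir ax).opp)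
  | conn q d j g', ax, b, a, g => g = g' ∧
    ((d = posDir ax ∧ b = q ∧ a = if j then 6 else 1) ∨
      (d = (posDir ax).opp ∧ b + (posDir ax).vec = q ∧ a = if j then 7 else 2))

theorem Slot.bounds {x : Piece T} {ax b a g} (h : x.Slot ax b a g) : 0 ≤ a ∧ a ≤ 8 := by
  rcases x with ⟨q, t⟩ | ⟨q, d, j, g'⟩
  · rcases h with ⟨_, h, _⟩ | ⟨_, h, _⟩ <;> omega
  · obtain ⟨_, ⟨_, _, h⟩ | ⟨_, _, h⟩⟩ := h <;> split_ifs at h <;> omega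

theorem slot_shift {x : Piece T} {v ax b a g} :
    (x.shift v).Slot ax (b + v) a g ↔ x.Slot ax b a g := by
  rcases x with ⟨q, t⟩ | ⟨q, d, j, g'⟩ <;> simp [shift, Slot, add_right_comm b v]

@[simp] theorem shift_shift (x : Piece T) (v w : ℤ × ℤ) :
    (x.shift v).shift w = x.shift (v + w) := by
  cases x <;> simp [shift, add_assoc]

@[simp] theorem shift_zero (x : Piece T) : x.shift 0 = x := by
  cases x <;> simp [shift]

/-- Two pieces are compatible if they fit together without overlapping. -/
structure Compat (x y : Piece T) : Prop where
  body : ∀ q t t', x = .body q t → y ≠ .body q t'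
  slot : ∀ ax b a g a' g', x.Slot ax b a g → y.Slot ax b a' g' → a ≠ a' ∧
    (a' = a + 1 → g = g') ∧ (a = a' + 1 → g = g')

end Piece

namespace Coding

variable {T : Finset TileType} (C : Coding T)

/-! ### Geometry of the blocks -/

/-- The side length of the square of a body. -/
def side : ℤ := 20 * C.n + 10

/-- The side length of a block, in coarse cells. -/
def size : ℤ := 23 * C.n + 10

/-- The position of the spine of the comb in slot `a`. -/
def spine (a : ℤ) : ℤ := 2 * C.n + (2 * C.n + 1) * a

/-- The comb with code `g`. -/
def comb (g : GlueOf T) (x y : ℤ) : Prop :=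
  -- Each row of the code takes three rows of cells. On the right, row 0 is a full tooth and row 1
  -- carries the code; on the left, row 2 is a full tooth and row 1 carries the complement. The full
  -- teeth connect the code cells to the spine.
  0 ≤ y ∧ y < 3 * C.n ∧ (x = 0 ∨
    (1 ≤ x ∧ x ≤ 2 * C.n ∧ (y % 3 = 0 ∨ y % 3 = 1 ∧ C.glueCode g (x - 1) (y / 3))) ∨
    (-2 * C.n ≤ x ∧ x ≤ -1 ∧ (y % 3 = 2 ∨ y % 3 = 1 ∧ ¬ C.glueCode g (x + 2 * C.n) (y / 3))))

def blk (c : ℤ × ℤ) : ℤ × ℤ := (c.1 / C.size, c.2 / C.size)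

def loc (c : ℤ × ℤ) : ℤ × ℤ := (c.1 % C.size, c.2 % C.size)

def place (b l : ℤ × ℤ) : ℤ × ℤ := (C.size * b.1 + l.1, C.size * b.2 + l.2)

/-- The coarse cells of a piece. -/
def cells (x : Piece T) : Set (ℤ × ℤ) := {c |
  (∃ t, x = .body (C.blk c) t ∧ (C.loc c).1 < C.side ∧ (C.loc c).2 < C.side) ∨
  ∃ ax a g, x.Slot ax (C.blk c) a g ∧
    C.comb g ((swapIf ax (C.loc c)).1 - C.spine a) ((swapIf ax (C.loc c)).2 - C.side)}

theorem size_pos : 0 < C.size := by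
  have := C.n_pos
  unfold size; omega

theorem blk_place {b l : ℤ × ℤ} (h1 : 0 ≤ l.1) (h1' : l.1 < C.size) (h2 : 0 ≤ l.2)
    (h2' : l.2 < C.size) : C.blk (C.place b l) = b := by
  have h := C.size_pos
  ext
  · simp [blk, place, Int.mul_add_ediv_left _ _ h.ne', Int.ediv_eq_zero_of_lt h1 h1']
  · simp [blk, place, Int.mul_add_ediv_left _ _ h.ne', Int.ediv_eq_zero_of_lt h2 h2']

theorem loc_place {b l : ℤ × ℤ} (h1 : 0 ≤ l.1) (h1' : l.1 < C.size) (h2 : 0 ≤ l.2)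
    (h2' : l.2 < C.size) : C.loc (C.place b l) = l := by
  ext
  · simp [loc, place, Int.mul_add_emod_self_left, Int.emod_eq_of_lt h1 h1']
  · simp [loc, place, Int.mul_add_emod_self_left, Int.emod_eq_of_lt h2 h2']

theorem place_blk_loc (c : ℤ × ℤ) : C.place (C.blk c) (C.loc c) = c := by
  ext
  · exact Int.mul_ediv_add_emod _ _
  · exact Int.mul_ediv_add_emod _ _

theorem loc_bounds (c : ℤ × ℤ) :
    0 ≤ (C.loc c).1 ∧ (C.loc c).1 < C.size ∧ 0 ≤ (C.loc c).2 ∧ (C.loc c).2 < C.size :=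
  ⟨Int.emod_nonneg _ C.size_pos.ne', Int.emod_lt_of_pos _ C.size_pos,
    Int.emod_nonneg _ C.size_pos.ne', Int.emod_lt_of_pos _ C.size_pos⟩

theorem blk_add (c v : ℤ × ℤ) : C.blk (c + C.size • v) = C.blk c + v := by
  ext <;> simp [blk, Int.add_mul_ediv_left _ _ C.size_pos.ne']

theorem loc_add (c v : ℤ × ℤ) : C.loc (c + C.size • v) = C.loc c := by
  ext <;> simp [loc]

theorem cells_shift (x : Piece T) (v c : ℤ × ℤ) :
    c + C.size • v ∈ C.cells (x.shift v) ↔ c ∈ C.cells x := by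
  simp only [cells, Set.mem_ofPred_eq, blk_add, loc_add, Piece.slot_shift]
  have : ∀ t, x.shift v = .body (C.blk c + v) t ↔ x = .body (C.blk c) t := by
    intro t
    cases x <;> simp [Piece.shift]
  simp only [this]

theorem comb.bounds {C : Coding T} {g x y} (h : C.comb g x y) :
    -2 * C.n ≤ x ∧ x ≤ 2 * C.n ∧ 0 ≤ y ∧ y < 3 * C.n := by
  have := C.n_pos
  obtain ⟨h1, h2, h | ⟨h3, h4, _⟩ | ⟨h3, h4, _⟩⟩ := h <;> refine ⟨?_, ?_, h1, h2⟩ <;> omega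

/-- The gap between neighbouring spines has width `2n`, and both combs read the same code cell at
each place in it. In row 1 the left comb has the code and the right one the complement; rows 0 and 2
belong to one comb each. -/
theorem comb_disjoint {g : GlueOf T} {x y : ℤ} (h : C.comb g x y)
    (h' : C.comb g (x - (2 * C.n + 1)) y) : False := by
  obtain ⟨h1, h2, h⟩ := h
  obtain ⟨-, -, h'⟩ := h'
  have hn := C.n_pos
  rw [show x - (2 * C.n + 1) + 2 * C.n = x - 1 by ring] at h'
  by_cases hc : C.glueCode g (x - 1) (y / 3) <;> simp only [hc, not_true, not_false_iff, and_true,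
    and_false, or_false] at h h' <;> omega

/-- The last comb, in slot 8, reaches column `20n + 8`, so nine combs fit along a side of length
`20n + 10`. -/
theorem spine_bounds {a : ℤ} (h : 0 ≤ a) (h' : a ≤ 8) :
    2 * C.n ≤ C.spine a ∧ C.spine a + 2 * C.n < C.side := by
  have := C.n_pos
  unfold spine side
  constructor <;> nlinarith

theorem spine_add_one (a : ℤ) : C.spine (a + 1) = C.spine a + (2 * C.n + 1) := by
  unfold spine; ring

/-- The combs of a piece lie in the strips. -/
theorem strip_bounds {x : Piece T} {ax b a g} (h : x.Slot ax b a g) {u v : ℤ}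
    (hc : C.comb g (u - C.spine a) (v - C.side)) :
    0 ≤ u ∧ u < C.side ∧ C.side ≤ v ∧ v < C.size := by
  have h1 := C.spine_bounds h.bounds.1 h.bounds.2
  have h2 := hc.bounds
  have h3 : C.size = C.side + 3 * C.n := by unfold size side; ring
  omega

theorem side_lt_size : C.side < C.size := by
  have := C.n_pos
  unfold size side; omega

/-- The corner of a block where its two strips would meet is empty. For this reason no tile has a
contact glue on a horizontal and on a vertical side. -/
theorem loc_lt_side {x : Piece T} {c : ℤ × ℤ} (h : c ∈ C.cells x) :
    (C.loc c).1 < C.side ∨ (C.loc c).2 < C.side := by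
  rcases h with ⟨t, _, h, _⟩ | ⟨ax, a, g, h, hc⟩
  · exact Or.inl h
  · have := C.strip_bounds h hc
    cases ax
    · exact Or.inr this.2.1
    · exact Or.inl this.2.1

/-- Compatible pieces do not overlap. -/
theorem disjoint_of_compat {x y : Piece T} (h : x.Compat y) : Disjoint (C.cells x) (C.cells y) := by
  rw [Set.disjoint_left]
  rintro c (⟨t, rfl, h1, h2⟩ | ⟨ax, a, g, hs, hc⟩) (⟨t', hy, h1', h2'⟩ | ⟨ax', a', g', hs', hc'⟩)
  · exact h.body _ _ _ rfl hy
  · have := C.strip_bounds hs' hc'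
    cases ax' <;> simp [swapIf] at this <;> omega
  · have := C.strip_bounds hs hc
    cases ax <;> simp [swapIf] at this <;> omega
  · have hb := C.strip_bounds hs hc
    have hb' := C.strip_bounds hs' hc'
    -- In a strip exactly one coordinate is at least `side`, and it tells the orientation.
    have hax : ax = ax' := by
      cases ax <;> cases ax' <;> simp [swapIf] at hb hb' ⊢ <;> omega
    subst hax
    obtain ⟨hne, h1, h2⟩ := h.slot _ _ _ _ _ _ hs hs'
    have hn := C.n_pos
    have hx := hc.bounds
    have hx' := hc'.bounds
    generalize (swapIf ax (C.loc c)).1 = u at *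
    -- A comb reaches `2n` columns to each side of its spine, so combs two slots apart, at distance
    -- `2(2n + 1)`, cannot meet.
    have hd : a' - a < 2 := by
      by_contra! hlt
      have : (2 * C.n + 1) * 2 ≤ (2 * C.n + 1) * (a' - a) := by gcongr
      unfold spine at hx hx'
      linarith
    have hd' : a - a' < 2 := by
      by_contra! hlt
      have : (2 * C.n + 1) * 2 ≤ (2 * C.n + 1) * (a - a') := by gcongr
      unfold spine at hx hx'
      linarith
    rcases (by omega : a' = a + 1 ∨ a = a' + 1) with ha | ha
    · obtain rfl := h1 ha
      subst ha
      rw [spine_add_one, show u - (C.spine a + (2 * C.n + 1)) = u - C.spine a - (2 * C.n + 1) by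
        ring] at hc'
      exact C.comb_disjoint hc hc'
    · obtain rfl := h2 ha
      subst ha
      rw [spine_add_one, show u - (C.spine a' + (2 * C.n + 1)) = u - C.spine a' - (2 * C.n + 1) by
        ring] at hc
      exact C.comb_disjoint hc' hc

theorem swapIf_swapIf (ax : Bool) (p : ℤ × ℤ) : swapIf ax (swapIf ax p) = p := by
  cases ax <;> simp [swapIf]

theorem mem_cells_of_slot {x : Piece T} {ax b a g} (h : x.Slot ax b a g) {u v : ℤ}
    (hc : C.comb g (u - C.spine a) (v - C.side)) :
    C.place b (swapIf ax (u, v)) ∈ C.cells x := by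
  have hb := C.strip_bounds h hc
  have := C.side_lt_size
  have := C.n_pos
  have hl : C.loc (C.place b (swapIf ax (u, v))) = swapIf ax (u, v) := by
    apply loc_place <;> cases ax <;> simp [swapIf] <;> unfold side at * <;> omega
  have hk : C.blk (C.place b (swapIf ax (u, v))) = b := by
    apply blk_place <;> cases ax <;> simp [swapIf] <;> unfold side at * <;> omega
  right
  refine ⟨ax, a, g, by rwa [hk], ?_⟩
  rwa [hl, swapIf_swapIf]

theorem comb_spine (g : GlueOf T) {y : ℤ} (h : 0 ≤ y) (h' : y < 3 * C.n) : C.comb g 0 y :=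
  ⟨h, h', Or.inl rfl⟩

/-- Pieces that do not overlap are compatible. -/
theorem compat_of_disjoint {x y : Piece T} (h : Disjoint (C.cells x) (C.cells y)) :
    x.Compat y := by
  rw [Set.disjoint_left] at h
  have hn := C.n_pos
  -- A cell in the code of `g` but not in that of `g'` is occupied by the right teeth of the first
  -- comb and also by the complementary left teeth of the second one.
  have hadj : ∀ {x y : Piece T} {ax b a g g'}, x.Slot ax b a g → y.Slot ax b (a + 1) g' →
      g ≠ g' → ∃ c, c ∈ C.cells x ∧ c ∈ C.cells y := by
    intro x y ax b a g g' hx hy hne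
    obtain ⟨u, v, hu, hu', hv, hv', hg, hg'⟩ := C.glueCode_sep g g' hne
    refine ⟨C.place b (swapIf ax (C.spine a + 1 + u, C.side + (3 * v + 1))),
      C.mem_cells_of_slot hx ?_, C.mem_cells_of_slot hy ?_⟩
    · refine ⟨by omega, by omega, Or.inr (Or.inl ⟨by omega, by omega, Or.inr ⟨by omega, ?_⟩⟩)⟩
      rwa [show C.spine a + 1 + u - C.spine a - 1 = u by ring,
        show (C.side + (3 * v + 1) - C.side) / 3 = v by omega]
    · rw [spine_add_one]
      refine ⟨by omega, by omega, Or.inr (Or.inr ⟨by omega, by omega, Or.inr ⟨by omega, ?_⟩⟩)⟩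
      rwa [show C.spine a + 1 + u - (C.spine a + (2 * C.n + 1)) + 2 * C.n = u by ring,
        show (C.side + (3 * v + 1) - C.side) / 3 = v by omega]
  constructor
  · rintro q t t' rfl rfl
    have hs := C.side_lt_size
    have h0 : 0 < C.side := by unfold side; omega
    have hl : C.loc (C.place q (0, 0)) = (0, 0) := by
      apply loc_place <;> simp [C.size_pos]
    have hk : C.blk (C.place q (0, 0)) = q := by
      apply blk_place <;> simp [C.size_pos]
    exact h (a := C.place q (0, 0)) (Or.inl ⟨t, by rw [hk], by rw [hl]; exact ⟨h0, h0⟩⟩)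
      (Or.inl ⟨t', by rw [hk], by rw [hl]; exact ⟨h0, h0⟩⟩)
  · intro ax b a g a' g' hx hy
    refine ⟨?_, ?_, ?_⟩
    · rintro rfl
      exact h (C.mem_cells_of_slot (u := C.spine a) (v := C.side) hx
        (by simpa using C.comb_spine g le_rfl (by omega)))
        (C.mem_cells_of_slot hy (by simpa using C.comb_spine g' le_rfl (by omega)))
    · rintro rfl
      by_contra hne
      obtain ⟨c, hc, hc'⟩ := hadj hx hy hne
      exact h hc hc'
    · rintro rfl
      by_contra hne
      obtain ⟨c, hc, hc'⟩ := hadj hy hx (Ne.symm hne)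
      exact h hc' hc

end Coding

/-! ### Contact places and the tiles of a piece -/

/-- The upper or right end of an edge. -/
def head : Dir → ℤ × ℤ → ℤ × ℤ
  | .north, p => p + Dir.north.vec
  | .east, p => p + Dir.east.vec
  | .south, p => p
  | .west, p => p

/-- `true` for the horizontal directions, in which the combs of a vertical strip touch. -/
def acrossVertical : Dir → Bool
  | .north => false
  | .east => true
  | .south => false
  | .west => true

theorem head_opp (d : Dir) (p : ℤ × ℤ) : head d.opp (p + d.vec) = head d p := by
  cases d <;> ext <;> simp [head, Dir.opp, Dir.vec]

theorem head_add (d : Dir) (p v : ℤ × ℤ) : head d (p + v) = head d p + v := by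
  cases d <;> simp [head, add_right_comm]

@[simp] theorem acrossVertical_opp (d : Dir) : acrossVertical d.opp = acrossVertical d := by
  cases d <;> rfl

@[simp] theorem acrossVertical_posDir (b : Bool) : acrossVertical (posDir b) = !b := by
  cases b <;> rfl

theorem eq_posDir_or (d : Dir) :
    d = posDir (!acrossVertical d) ∨ d = (posDir (!acrossVertical d)).opp := by
  cases d <;> simp [acrossVertical, posDir, Dir.opp]

/-- The coarse cell of a tile position. -/
def coarse (p : ℤ × ℤ) : ℤ × ℤ := (p.1 / 2, p.2 / 2)

theorem coarse_add (p v : ℤ × ℤ) : coarse (p + (2 : ℤ) • v) = coarse p + v := by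
  ext <;> simp [coarse] <;> omega

/-- The strength `s` of a glue, or `τ` if that is less, is divided between the two connectors. -/
def share (τ : ℕ) (j : Bool) (s : ℕ) : ℕ := if j then min s τ / 2 else (min s τ + 1) / 2

theorem share_add_share (τ s : ℕ) : share τ false s + share τ true s = min s τ := by
  simp [share]; omega

theorem share_le_half (τ s : ℕ) (j : Bool) : share τ j s ≤ half τ := by
  cases j <;> simp [share, half] <;> omega

/-- Since `2 * k + e < 20` for `k < 10` and `e < 2`, the offset 24 separates the two orientations
and all labels are below 48. -/
def contactLabel (ax : Bool) (k e : ℕ) : ℕ := (if ax then 24 else 0) + 2 * k + e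

theorem contactLabel_inj {ax : Bool} {k e k' e' : ℕ} (he : e < 2) (he' : e' < 2)
    (h : contactLabel ax k e = contactLabel ax k' e') : k = k' ∧ e = e' := by
  unfold contactLabel at h
  omega

/-- The strength of the contact glues of a piece. -/
def Piece.strength {T : Finset TileType} (τ : ℕ) : Piece T → ℕ → ℕ → ℕ
  | .body _ _, _, _ => half τ
  | .conn _ _ j g, k, e =>
    -- The places `k = 2` and `k = 7` are those where two connectors meet. Only one of the two edges
    -- there has a bond, and it carries the share of the simulated glue.
    if k % 5 = 2 then if e = 0 then share τ j g.1.strength else 0 else half τ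

theorem Piece.strength_lt {T : Finset TileType} {τ : ℕ} (hτ : 2 ≤ τ) (x : Piece T) (k e : ℕ) :
    x.strength τ k e < τ := by
  have := half_lt hτ
  rcases x with ⟨q, t⟩ | ⟨q, d, j, g⟩
  · exact this
  · have := share_le_half τ g.1.strength j
    simp only [strength]
    split_ifs <;> omega

namespace Coding

variable {T : Finset TileType} (C : Coding T)

/-- The right (or upper) one of the two tile positions where the combs in slots `k - 1` and `k` of a
strip of block `b` touch, in two places indexed by `e`. -/
def spotPos (ax : Bool) (b : ℤ × ℤ) (k e : ℕ) : ℤ × ℤ :=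
  (2 : ℤ) • C.size • b + swapIf ax (2 * C.spine k, 2 * C.side + e)

theorem coarse_spotPos (ax : Bool) (b : ℤ × ℤ) (k : ℕ) {e : ℕ} (he : e < 2) :
    coarse (C.spotPos ax b k e) = C.place b (swapIf ax (C.spine k, C.side)) := by
  have : (e : ℤ) < 2 := by exact_mod_cast he
  rw [spotPos, add_comm, coarse_add]
  cases ax <;> ext <;> simp [coarse, place, swapIf] <;> omega

theorem coarse_spotPos_sub (ax : Bool) (b : ℤ × ℤ) (k : ℕ) {e : ℕ} (he : e < 2) :
    coarse (C.spotPos ax b k e - (posDir (!ax)).vec) =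
      C.place b (swapIf ax (C.spine k - 1, C.side)) := by
  have : (e : ℤ) < 2 := by exact_mod_cast he
  rw [spotPos, add_sub_assoc, add_comm, coarse_add]
  cases ax <;> ext <;> simp [coarse, place, swapIf, posDir, Dir.vec] <;> omega

/-- The place to the right of slot 8 has index `k = 9` and column `20n + 9`, which is still inside
the side. -/
theorem spine_nat_bounds {k : ℕ} (hk : k < 10) :
    2 * C.n ≤ C.spine k ∧ C.spine k < C.side := by
  have := C.n_pos
  have h : (k : ℤ) ≤ 9 := by omega
  have h0 : (0 : ℤ) ≤ k := by omega
  unfold spine side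
  constructor <;> nlinarith

theorem blk_loc_swapIf {ax : Bool} {b : ℤ × ℤ} {u v : ℤ} (hu : 0 ≤ u) (hu' : u < C.size)
    (hv : 0 ≤ v) (hv' : v < C.size) : C.blk (C.place b (swapIf ax (u, v))) = b ∧
      swapIf ax (C.loc (C.place b (swapIf ax (u, v)))) = (u, v) := by
  constructor
  · apply blk_place <;> cases ax <;> assumption
  · rw [loc_place, swapIf_swapIf] <;> cases ax <;> assumption

theorem side_pos : 0 < C.side := by
  have := C.n_pos
  unfold side; omega

theorem blk_loc_spotPos {ax : Bool} {b : ℤ × ℤ} {k e : ℕ} (hk : k < 10) (he : e < 2) :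
    C.blk (coarse (C.spotPos ax b k e)) = b ∧
      swapIf ax (C.loc (coarse (C.spotPos ax b k e))) = (C.spine k, C.side) := by
  have := C.spine_nat_bounds hk
  have := C.n_pos
  have := C.side_pos
  have := C.side_lt_size
  rw [coarse_spotPos _ _ _ _ he]
  exact C.blk_loc_swapIf (by omega) (by omega) (by omega) (by omega)

theorem blk_loc_spotPos_sub {ax : Bool} {b : ℤ × ℤ} {k e : ℕ} (hk : k < 10) (he : e < 2) :
    C.blk (coarse (C.spotPos ax b k e - (posDir (!ax)).vec)) = b ∧
      swapIf ax (C.loc (coarse (C.spotPos ax b k e - (posDir (!ax)).vec))) =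
        (C.spine k - 1, C.side) := by
  have := C.spine_nat_bounds hk
  have := C.n_pos
  have := C.side_pos
  have := C.side_lt_size
  rw [coarse_spotPos_sub _ _ _ _ he]
  exact C.blk_loc_swapIf (by omega) (by omega) (by omega) (by omega)

theorem spine_inj {a a' : ℤ} (h : C.spine a = C.spine a') : a = a' := by
  have := C.n_pos
  unfold spine at h
  have h' : (2 * C.n + 1) * a = (2 * C.n + 1) * a' := by linarith
  exact mul_left_cancel₀ (by omega) h'

/-- The block, the slot and the index can be read off from the position, so the choice made in
`contactAt` is forced. -/
theorem spotPos_inj {ax : Bool} {b b' : ℤ × ℤ} {k k' e e' : ℕ} (hk : k < 10) (hk' : k' < 10)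
    (he : e < 2) (he' : e' < 2) (h : C.spotPos ax b k e = C.spotPos ax b' k' e') :
    b = b' ∧ k = k' ∧ e = e' := by
  have h1 := C.blk_loc_spotPos (ax := ax) (b := b) hk he
  have h2 := C.blk_loc_spotPos (ax := ax) (b := b') hk' he'
  rw [h] at h1
  obtain rfl : b = b' := h1.1.symm.trans h2.1
  have h3 := congrArg Prod.fst (h1.2.symm.trans h2.2)
  obtain rfl : k = k' := by exact_mod_cast C.spine_inj h3
  refine ⟨rfl, rfl, ?_⟩
  unfold spotPos at h
  have h4 := add_left_cancel h
  cases ax <;> simpa [swapIf] using h4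

open Classical in
/-- The contact glue of a piece on the side `d` of the tile at `p`, if there is one. -/
noncomputable def contactAt (τ : ℕ) (x : Piece T) (p : ℤ × ℤ) (d : Dir) : Glue :=
  if h : ∃ z : ℕ × ℕ, z.1 < 10 ∧ z.2 < 2 ∧ ∃ b,
      head d p = C.spotPos (acrossVertical d) b z.1 z.2 then
    contactGlue (contactLabel (acrossVertical d) h.choose.1 h.choose.2)
      (x.strength τ h.choose.1 h.choose.2)
  else nullGlue

theorem contactAt_eq {τ : ℕ} (x : Piece T) {p : ℤ × ℤ} {d : Dir} {b : ℤ × ℤ} {k e : ℕ}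
    (hk : k < 10) (he : e < 2) (h : head d p = C.spotPos (acrossVertical d) b k e) :
    C.contactAt τ x p d =
      contactGlue (contactLabel (acrossVertical d) k e) (x.strength τ k e) := by
  have h' : ∃ z : ℕ × ℕ, z.1 < 10 ∧ z.2 < 2 ∧ ∃ b,
      head d p = C.spotPos (acrossVertical d) b z.1 z.2 := ⟨(k, e), hk, he, b, h⟩
  obtain ⟨h1, h2, b', h3⟩ := h'.choose_spec
  obtain ⟨-, h4, h5⟩ := C.spotPos_inj hk h1 he h2 (h.symm.trans h3)
  rw [contactAt, dif_pos h', ← h4, ← h5]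

theorem contactAt_cases {τ : ℕ} (x : Piece T) (p : ℤ × ℤ) (d : Dir) :
    C.contactAt τ x p d = nullGlue ∨ ∃ b k e, k < 10 ∧ e < 2 ∧
      head d p = C.spotPos (acrossVertical d) b k e ∧
      C.contactAt τ x p d =
        contactGlue (contactLabel (acrossVertical d) k e) (x.strength τ k e) := by
  by_cases h : ∃ z : ℕ × ℕ, z.1 < 10 ∧ z.2 < 2 ∧ ∃ b,
      head d p = C.spotPos (acrossVertical d) b z.1 z.2
  · obtain ⟨⟨k, e⟩, hk, he, b, h⟩ := h
    exact Or.inr ⟨b, k, e, hk, he, h, C.contactAt_eq x hk he h⟩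
  · exact Or.inl (by rw [contactAt, dif_neg h])

open Classical in
/-- The colour of a coarse cell: the body of a tile has a code in its lower left corner. -/
noncomputable def color : Piece T → ℤ × ℤ → Fin 3
  | .conn _ _ _ _, _ => 0
  | .body _ t, c =>
    if C.loc c = (0, 0) then 1
    else if 1 ≤ (C.loc c).1 ∧ (C.loc c).1 ≤ C.n ∧ 1 ≤ (C.loc c).2 ∧ (C.loc c).2 ≤ C.n ∧
      C.tileCode t ((C.loc c).1 - 1) ((C.loc c).2 - 1) then 2
    else 0

-- The glue depends on the piece alone, not on its surroundings. The colour glue inside a coarse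
-- cell also makes the colour of the cell readable from the tiles.
open Classical in
noncomputable def glueAt (τ : ℕ) (x : Piece T) (p : ℤ × ℤ) (d : Dir) : Glue :=
  if coarse (p + d.vec) = coarse p then colorGlue τ (C.color x (coarse p))
  else if coarse (p + d.vec) ∈ C.cells x then extGlue τ
  else C.contactAt τ x p d

noncomputable def tile (τ : ℕ) (x : Piece T) (p : ℤ × ℤ) : TileType := ⟨C.glueAt τ x p⟩

theorem glueAt_shift (τ : ℕ) (x : Piece T) (v p : ℤ × ℤ) (d : Dir) :
    C.glueAt τ (x.shift v) (p + (2 : ℤ) • C.size • v) d = C.glueAt τ x p d := by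
  have h1 : C.color (x.shift v) (coarse p + C.size • v) = C.color x (coarse p) := by
    cases x
    · simp only [color, Piece.shift]
      rw [loc_add]
    · rfl
  have h2 : C.contactAt τ (x.shift v) (p + (2 : ℤ) • C.size • v) d = C.contactAt τ x p d := by
    have hs : ∀ k e, (x.shift v).strength τ k e = x.strength τ k e := by
      intro k e; cases x <;> rfl
    have hb : ∀ {k e b}, head d p = C.spotPos (acrossVertical d) b k e →
        head d (p + (2 : ℤ) • C.size • v) = C.spotPos (acrossVertical d) (b + v) k e := by
      intro k e b hb
      rw [head_add, hb]
      simp only [spotPos, smul_add]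
      abel
    rcases C.contactAt_cases (τ := τ) x p d with h | ⟨b, k, e, hk, he, h, h'⟩
    · rcases C.contactAt_cases (τ := τ) (x.shift v) (p + (2 : ℤ) • C.size • v) d with
        h' | ⟨b, k, e, hk, he, h', -⟩
      · rw [h, h']
      · have h2 : head d p = C.spotPos (acrossVertical d) (b - v) k e := by
          rw [head_add] at h'
          rw [eq_sub_of_add_eq h']
          simp only [spotPos, smul_sub]
          abel
        rw [C.contactAt_eq _ hk he h2, C.contactAt_eq _ hk he h', hs]
    · rw [h', C.contactAt_eq _ hk he (hb h), hs]
  have h3 : p + (2 : ℤ) • C.size • v + d.vec = p + d.vec + (2 : ℤ) • C.size • v :=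
    add_right_comm _ _ _
  unfold glueAt
  rw [h3, coarse_add, coarse_add, h1, h2, cells_shift]
  simp only [add_left_inj]

theorem tile_shift (τ : ℕ) (x : Piece T) (v p : ℤ × ℤ) :
    C.tile τ (x.shift v) (p + (2 : ℤ) • C.size • v) = C.tile τ x p := by
  unfold tile
  congr 1
  funext d
  exact C.glueAt_shift τ x v p d

/-- A tile with a contact glue lies in the first row of a strip. -/
theorem loc_of_spot {d : Dir} {p b : ℤ × ℤ} {k e : ℕ} (hk : k < 10) (he : e < 2)
    (h : head d p = C.spotPos (acrossVertical d) b k e) :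
    (swapIf (acrossVertical d) (C.loc (coarse p))).2 = C.side := by
  rcases eq_posDir_or d with hd | hd
  · have hp : p = C.spotPos (acrossVertical d) b k e - (posDir (!acrossVertical d)).vec := by
      rw [← h, ← hd]
      cases d <;> first | (simp [head]; done) | simp [acrossVertical, posDir] at hd
    conv_lhs => rw [hp, (C.blk_loc_spotPos_sub hk he).2]
  · have hp : p = C.spotPos (acrossVertical d) b k e := by
      rw [← h]
      cases d <;> first | (simp [head]; done) | simp [acrossVertical, posDir, Dir.opp] at hd
    conv_lhs => rw [hp, (C.blk_loc_spotPos hk he).2]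

/-- The parities of `p` give the quadrant. The point is that at most one of the two outer sides has
a contact glue, as the data of a universal tile require. -/
theorem tile_mem {τ : ℕ} (hτ : 2 ≤ τ) {x : Piece T} {p : ℤ × ℤ} (hp : coarse p ∈ C.cells x) :
    C.tile τ x p ∈ universalTiles τ := by
  classical
  have hlab : ∀ ax k e, k < 10 → e < 2 → contactLabel ax k e < 48 := by
    intro ax k e hk he
    unfold contactLabel
    split_ifs <;> omega
  -- Contact glues on sides of both orientations would put the tile into the empty corner of its
  -- block.
  have hne : ∀ d d' b k e b' k' e', k < 10 → e < 2 → k' < 10 → e' < 2 →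
      acrossVertical d = true → acrossVertical d' = false →
      head d p = C.spotPos (acrossVertical d) b k e →
      head d' p = C.spotPos (acrossVertical d') b' k' e' → False := by
    intro d d' b k e b' k' e' hk he hk' he' hd hd' h h'
    have h1 := C.loc_of_spot hk he h
    have h2 := C.loc_of_spot hk' he' h'
    rw [hd] at h1
    rw [hd'] at h2
    have h3 := C.loc_lt_side hp
    simp only [swapIf, if_true] at h1
    simp [swapIf] at h2
    omega
  have hmain : ∀ d d', acrossVertical d = true → acrossVertical d' = false →
      ∃ o : Option (Bool × Fin 48 × Fin τ), ∃ bx bv,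
        (if coarse (p + d.vec) ∈ C.cells x then extGlue τ else C.contactAt τ x p d) =
          outerGlue τ false bx o ∧
        (if coarse (p + d'.vec) ∈ C.cells x then extGlue τ else C.contactAt τ x p d') =
          outerGlue τ true bv o := by
    intro d d' hd hd'
    have hopt : ∀ d, (∃ b : Bool, (if coarse (p + d.vec) ∈ C.cells x then extGlue τ
        else C.contactAt τ x p d) = if b then extGlue τ else nullGlue) ∨
        ∃ b k e, k < 10 ∧ e < 2 ∧ head d p = C.spotPos (acrossVertical d) b k e ∧
          (if coarse (p + d.vec) ∈ C.cells x then extGlue τ else C.contactAt τ x p d) =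
          contactGlue (contactLabel (acrossVertical d) k e) (x.strength τ k e) := by
      intro d
      split_ifs with hc
      · exact Or.inl ⟨true, rfl⟩
      · rcases C.contactAt_cases (τ := τ) x p d with h | h
        · exact Or.inl ⟨false, h⟩
        · exact Or.inr h
    rcases hopt d with ⟨bx, hx⟩ | ⟨b, k, e, hk, he, h, hx⟩ <;>
      rcases hopt d' with ⟨bv, hv⟩ | ⟨b', k', e', hk', he', h', hv⟩
    · exact ⟨none, bx, bv, hx, hv⟩
    · exact ⟨some (true, ⟨_, hlab (acrossVertical d') _ _ hk' he'⟩, ⟨_, x.strength_lt hτ k' e'⟩), bx, false,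
        by rw [hx]; simp [outerGlue], by rw [hv]; simp [outerGlue]⟩
    · exact ⟨some (false, ⟨_, hlab (acrossVertical d) _ _ hk he⟩, ⟨_, x.strength_lt hτ k e⟩), false, bv,
        by rw [hx]; simp [outerGlue], by rw [hv]; simp [outerGlue]⟩
    · exact (hne _ _ _ _ _ _ _ _ hk he hk' he' hd hd' h h').elim
  have hcol : ∀ d, coarse (p + d.vec) = coarse p →
      C.glueAt τ x p d = colorGlue τ (C.color x (coarse p)) := fun d h => if_pos h
  have hout : ∀ d, coarse (p + d.vec) ≠ coarse p → C.glueAt τ x p d =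
      if coarse (p + d.vec) ∈ C.cells x then extGlue τ else C.contactAt τ x p d :=
    fun d h => if_neg h
  -- An even coordinate means that the west or south side is the outer one, an odd coordinate that
  -- the east or north side is.
  obtain ⟨o, bx, bv, hx, hv⟩ := hmain (if p.1 % 2 = 0 then .west else .east)
    (if p.2 % 2 = 0 then .south else .north) (by split_ifs <;> rfl) (by split_ifs <;> rfl)
  rw [mem_universalTiles]
  refine ⟨(C.color x (coarse p), (!decide (p.1 % 2 = 0), !decide (p.2 % 2 = 0)), (bx, bv), o), ?_⟩
  refine congrArg TileType.mk (funext fun d => ?_)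
  have e1 : p.1 % 2 = 0 ∨ p.1 % 2 = 1 := Int.emod_two_eq_zero_or_one _
  have e2 : p.2 % 2 = 0 ∨ p.2 % 2 = 1 := Int.emod_two_eq_zero_or_one _
  cases d
  · rcases e2 with e2 | e2 <;> simp only [e2] at hv ⊢
    · rw [hcol _ (by ext <;> simp [coarse, Dir.vec]; omega)]; simp
    · rw [hout _ (fun h => by have := congrArg Prod.snd h; simp [coarse, Dir.vec] at this; omega)]
      simpa using hv.symm
  · rcases e1 with e1 | e1 <;> simp only [e1] at hx ⊢
    · rw [hcol _ (by ext <;> simp [coarse, Dir.vec]; omega)]; simp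
    · rw [hout _ (fun h => by have := congrArg Prod.fst h; simp [coarse, Dir.vec] at this; omega)]
      simpa using hx.symm
  · rcases e2 with e2 | e2 <;> simp only [e2] at hv ⊢
    · rw [hout _ (fun h => by have := congrArg Prod.snd h; simp [coarse, Dir.vec] at this; omega)]
      simpa using hv.symm
    · rw [hcol _ (by ext <;> simp [coarse, Dir.vec]; omega)]; simp
  · rcases e1 with e1 | e1 <;> simp only [e1] at hx ⊢
    · rw [hout _ (fun h => by have := congrArg Prod.fst h; simp [coarse, Dir.vec] at this; omega)]
      simpa using hx.symm
    · rw [hcol _ (by ext <;> simp [coarse, Dir.vec]; omega)]; simp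

end Coding

/-- The slot of the second one of the two connectors with index `j` in a strip. -/
def linkSlot (j : Bool) : ℕ := if j then 7 else 2

namespace Coding

variable {T : Finset TileType} (C : Coding T)

/-! ### Matching glues of different pieces -/

/-- The position lies on the spine of slot `k`. The combs in other slots of the strip stop short of
it, because the distance of the spines exceeds their reach `2n` by one. -/
theorem slot_of_spot {y : Piece T} {ax : Bool} {b : ℤ × ℤ} {k e : ℕ} (hk : k < 10) (he : e < 2)
    (h : coarse (C.spotPos ax b k e) ∈ C.cells y) : ∃ g, y.Slot ax b k g := by
  obtain ⟨hb, hl⟩ := C.blk_loc_spotPos (ax := ax) (b := b) hk he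
  have hn := C.n_pos
  rcases h with ⟨t, _, h1, h2⟩ | ⟨ax', a, g, hs, hc⟩
  · have := congrArg Prod.snd hl
    cases ax <;> simp [swapIf] at this <;> omega
  · have hax : ax = ax' := by
      by_contra hne
      have h1 : ∀ p, (swapIf ax' p).1 = (swapIf ax p).2 := by
        cases ax <;> cases ax' <;> simp_all [swapIf]
      have h2 := C.strip_bounds hs hc
      rw [h1, hl] at h2
      omega
    subst hax
    rw [hb] at hs
    rw [hl] at hc
    have := hc.bounds
    simp only at this
    have h1 : (k : ℤ) - a < 1 := by
      by_contra! hlt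
      have : (2 * C.n + 1) * 1 ≤ (2 * C.n + 1) * (k - a) := by gcongr
      unfold spine at *
      linarith
    have h2 : a - k < 1 := by
      by_contra! hlt
      have : (2 * C.n + 1) * 1 ≤ (2 * C.n + 1) * (a - k) := by gcongr
      unfold spine at *
      linarith
    obtain rfl : a = k := by omega
    exact ⟨g, hs⟩

/-- The combs in slots `k - 1` and `k` are the only ones that could reach this column. In the first
row a comb has no left tooth, which excludes slot `k`. -/
theorem slot_of_spot_sub {x : Piece T} {ax : Bool} {b : ℤ × ℤ} {k e : ℕ} (hk : k < 10)
    (he : e < 2) (h : coarse (C.spotPos ax b k e - (posDir (!ax)).vec) ∈ C.cells x) :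
    ∃ g, x.Slot ax b (k - 1) g := by
  obtain ⟨hb, hl⟩ := C.blk_loc_spotPos_sub (ax := ax) (b := b) hk he
  have hn := C.n_pos
  rcases h with ⟨t, _, h1, h2⟩ | ⟨ax', a, g, hs, hc⟩
  · have := congrArg Prod.snd hl
    cases ax <;> simp [swapIf] at this h1 h2 <;> omega
  · have hax : ax = ax' := by
      by_contra hne
      have h1 : ∀ p, (swapIf ax' p).1 = (swapIf ax p).2 := by
        cases ax <;> cases ax' <;> simp_all [swapIf]
      have h2 := C.strip_bounds hs hc
      rw [h1, hl] at h2
      omega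
    subst hax
    rw [hb] at hs
    rw [hl] at hc
    have := hc.bounds
    simp only at this
    have h1 : (k : ℤ) - a < 2 := by
      by_contra! hlt
      have : (2 * C.n + 1) * 2 ≤ (2 * C.n + 1) * (k - a) := by gcongr
      unfold spine at *
      linarith
    have h2 : a - k < 1 := by
      by_contra! hlt
      have : (2 * C.n + 1) * 1 ≤ (2 * C.n + 1) * (a - k) := by gcongr
      unfold spine at *
      linarith
    have hne : a ≠ k := by
      rintro rfl
      obtain ⟨-, -, h | ⟨h, -⟩ | ⟨-, -, h | ⟨h, -⟩⟩⟩ := hc <;> omega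
    obtain rfl : a = k - 1 := by omega
    exact ⟨g, hs⟩

/-- The order of the slots leaves only the pairs body–connector, connector–connector and
connector–body. Compatibility yields the equality of the glues. -/
theorem slot_pair {x y : Piece T} {ax : Bool} {b : ℤ × ℤ} {k : ℕ} {g g' : GlueOf T}
    (hx : x.Slot ax b (k - 1) g) (hy : y.Slot ax b k g') (h : x.Compat y) :
    g = g' ∧ ((∃ t j, x = .body b t ∧ y = .conn b (posDir ax) j g') ∨
      (∃ j, k = linkSlot j ∧ x = .conn b (posDir ax) j g ∧
        y = .conn (b + (posDir ax).vec) (posDir ax).opp j g') ∨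
      (∃ t j, x = .conn (b + (posDir ax).vec) (posDir ax).opp j g ∧
        y = .body (b + (posDir ax).vec) t)) := by
  refine ⟨(h.slot _ _ _ _ _ _ hx hy).2.1 (by omega), ?_⟩
  have hd : ∀ ax, posDir ax ≠ (posDir ax).opp := by
    intro ax; cases ax <;> simp [posDir, Dir.opp]
  rcases x with ⟨q, t⟩ | ⟨q, d, j, g1⟩ <;> rcases y with ⟨q', t'⟩ | ⟨q', d', j', g1'⟩
  · rcases hx with ⟨_, _, _⟩ | ⟨_, _, _⟩ <;> rcases hy with ⟨_, _, _⟩ | ⟨_, _, _⟩ <;> omega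
  · obtain ⟨rfl, ⟨rfl, rfl, h2⟩ | ⟨rfl, rfl, h2⟩⟩ := hy <;>
      rcases hx with ⟨rfl, h1, _⟩ | ⟨rfl, h1, _⟩
    · exact Or.inl ⟨t, j', rfl, rfl⟩
    · exfalso; cases j' <;> simp at h2 <;> omega
    · exfalso; cases j' <;> simp at h2 <;> omega
    · exfalso; cases j' <;> simp at h2 <;> omega
  · obtain ⟨rfl, ⟨rfl, rfl, h2⟩ | ⟨rfl, rfl, h2⟩⟩ := hx <;>
      rcases hy with ⟨rfl, h1, _⟩ | ⟨rfl, h1, _⟩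
    · exfalso; cases j <;> simp at h2 <;> omega
    · exfalso; cases j <;> simp at h2 <;> omega
    · exfalso; cases j <;> simp at h2 <;> omega
    · exact Or.inr (Or.inr ⟨t', j, rfl, rfl⟩)
  · obtain ⟨rfl, ⟨rfl, rfl, h2⟩ | ⟨rfl, rfl, h2⟩⟩ := hx <;>
      obtain ⟨rfl, ⟨rfl, rfl, h1⟩ | ⟨rfl, rfl, h1⟩⟩ := hy
    · exfalso; cases j <;> cases j' <;> simp at h1 h2 <;> omega
    · right; left
      cases j <;> cases j' <;> simp at h1 h2
      · exact ⟨false, by simp [linkSlot]; omega, rfl, rfl⟩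
      · omega
      · omega
      · exact ⟨true, by simp [linkSlot]; omega, rfl, rfl⟩
    · exfalso; cases j <;> cases j' <;> simp at h1 h2 <;> omega
    · exfalso; cases j <;> cases j' <;> simp at h1 h2 <;> omega

/-- Tiles of different pieces bind to each other only where the combs of the pieces touch. -/
theorem spots_of_match {τ : ℕ} {x y : Piece T} {p p' : ℤ × ℤ} {d : Dir}
    (hxp : coarse p ∈ C.cells x) (hx : coarse (p + d.vec) ∉ C.cells x)
    (hyp : coarse p' ∈ C.cells y) (hy : coarse (p' - d.vec) ∉ C.cells y)
    (heq : C.glueAt τ x p d = C.glueAt τ y p' d.opp) (hpos : 0 < (C.glueAt τ x p d).strength) :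
    ∃ b b' k e, k < 10 ∧ e < 2 ∧ head d p = C.spotPos (acrossVertical d) b k e ∧
      p' = p + d.vec + (2 : ℤ) • C.size • (b' - b) ∧
      C.glueAt τ x p d = contactGlue (contactLabel (acrossVertical d) k e) (x.strength τ k e) := by
  have h1 : C.glueAt τ x p d = C.contactAt τ x p d := by
    rw [glueAt, if_neg fun h => hx (by rwa [h]), if_neg hx]
  have h2 : C.glueAt τ y p' d.opp = C.contactAt τ y p' d.opp := by
    rw [sub_eq_add_neg, ← Dir.vec_opp] at hy
    rw [glueAt, if_neg fun h => hy (by rwa [h]), if_neg hy]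
  rcases C.contactAt_cases (τ := τ) x p d with h | ⟨b, k, e, hk, he, hs, h⟩
  · rw [h1, h] at hpos
    exact absurd hpos (lt_irrefl 0)
  rcases C.contactAt_cases (τ := τ) y p' d.opp with h' | ⟨b', k', e', hk', he', hs', h'⟩
  · rw [heq, h2, h'] at hpos
    exact absurd hpos (lt_irrefl 0)
  have hl := heq
  rw [h1, h2, h, h', acrossVertical_opp, contactGlue_inj] at hl
  -- Equal labels mean the same slot and index, so the two sides differ from abutting ones by a
  -- multiple of the block size.
  obtain ⟨rfl, rfl⟩ := contactLabel_inj he he' hl.1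
  refine ⟨b, b', k, e, hk, he, hs, ?_, by rw [h1, h]⟩
  have h3 : head d.opp (p + d.vec + (2 : ℤ) • C.size • (b' - b)) = head d.opp p' := by
    rw [head_add, head_opp, hs, hs', acrossVertical_opp]
    simp only [spotPos, smul_sub]
    abel
  have h4 : ∀ e (p q : ℤ × ℤ), head e p = head e q → p = q := by
    intro e p q h
    cases e <;> simpa [head] using h
  exact (h4 _ _ _ h3).symm

/-- The edge, seen from the first one, between a connector for side `d` of block `q` and the
connector for the adjacent side of the neighbouring block. -/
def linkEdge (q : ℤ × ℤ) (j : Bool) : Dir → (ℤ × ℤ) × Dir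
  | .north => (C.spotPos true q (linkSlot j) 0 - Dir.east.vec, .east)
  | .east => (C.spotPos false q (linkSlot j) 0 - Dir.north.vec, .north)
  | .south => (C.spotPos true (q + Dir.south.vec) (linkSlot j) 0, .west)
  | .west => (C.spotPos false (q + Dir.west.vec) (linkSlot j) 0, .south)

theorem linkSlot_lt (j : Bool) : linkSlot j < 10 := by cases j <;> decide

theorem linkSlot_inj {j j' : Bool} (h : linkSlot j = linkSlot j') : j = j' := by
  cases j <;> cases j' <;> simp_all [linkSlot]

theorem linkEdge_inj {q q' : ℤ × ℤ} {j j' : Bool} {d d' : Dir}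
    (h : C.linkEdge q j d = C.linkEdge q' j' d') : q = q' ∧ j = j' ∧ d = d' := by
  have hd : d = d' := by cases d <;> cases d' <;> simp_all [linkEdge]
  subst hd
  have key : ∀ {ax b b'}, C.spotPos ax b (linkSlot j) 0 = C.spotPos ax b' (linkSlot j') 0 →
      b = b' ∧ j = j' := by
    intro ax b b' h
    obtain ⟨h1, h2, -⟩ := C.spotPos_inj (linkSlot_lt j) (linkSlot_lt j') two_pos two_pos h
    exact ⟨h1, linkSlot_inj h2⟩
  cases d <;> simp only [linkEdge, Prod.mk.injEq, and_true, sub_left_inj] at h <;>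
    obtain ⟨h1, h2⟩ := key h <;> exact ⟨by simpa using h1, h2, rfl⟩

/-- The bonds between different pieces are those between a body and its connectors, and those
between two connectors for adjacent sides. -/
theorem match_cases {τ : ℕ} {x y : Piece T} {p : ℤ × ℤ} {d : Dir}
    (hxy : Disjoint (C.cells x) (C.cells y)) (hx : coarse p ∈ C.cells x)
    (hy : coarse (p + d.vec) ∈ C.cells y) (heq : C.glueAt τ x p d = C.glueAt τ y (p + d.vec) d.opp)
    (hpos : 0 < (C.glueAt τ x p d).strength) :
    (∃ q t d' j g, (x = .body q t ∧ y = .conn q d' j g) ∨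
      (x = .conn q d' j g ∧ y = .body q t)) ∨
    ∃ q d' j g, x = .conn q d' j g ∧ y = .conn (q + d'.vec) d'.opp j g ∧
      (p, d) = C.linkEdge q j d' ∧ (C.glueAt τ x p d).strength = share τ j g.1.strength := by
  have hc := C.compat_of_disjoint hxy
  obtain ⟨b, b', k, e, hk, he, hs, -, hg⟩ := C.spots_of_match hx (Set.disjoint_right.1 hxy hy) hy
    (by simpa using Set.disjoint_left.1 hxy hx) heq hpos
  rw [hg] at hpos ⊢
  -- Where two connectors meet, only the edge with index 0 has positive strength.
  have hstr : ∀ j q d' g, k = linkSlot j → x = .conn q d' j g →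
      e = 0 ∧ x.strength τ k e = share τ j g.1.strength := by
    rintro j q d' g rfl rfl
    have h5 : linkSlot j % 5 = 2 := by cases j <;> rfl
    simp only [contactGlue, Piece.strength, h5, if_true] at hpos ⊢
    split_ifs at hpos ⊢ with h0
    · exact ⟨h0, rfl⟩
    · exact absurd hpos (lt_irrefl 0)
  have hax : ∃ ax, acrossVertical d = ax := ⟨_, rfl⟩
  obtain ⟨ax, hax⟩ := hax
  rcases eq_posDir_or d with hd | hd
  · have hp : p = C.spotPos ax b k e - (posDir (!ax)).vec := by
      rw [← hax, ← hs, ← hd]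
      cases d <;> first | (simp [head]; done) | simp [acrossVertical, posDir] at hd
    have hp' : p + d.vec = C.spotPos ax b k e := by
      rw [hp, ← hax, ← hd]; abel
    rw [hp] at hx
    rw [hp'] at hy
    obtain ⟨g, hsx⟩ := C.slot_of_spot_sub hk he hx
    obtain ⟨g', hsy⟩ := C.slot_of_spot hk he hy
    obtain ⟨rfl, ⟨t, j, rfl, rfl⟩ | ⟨j, rfl, rfl, rfl⟩ | ⟨t, j, rfl, rfl⟩⟩ :=
      slot_pair hsx hsy hc
    · exact Or.inl ⟨_, t, _, j, g, Or.inl ⟨rfl, rfl⟩⟩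
    · obtain ⟨rfl, h⟩ := hstr _ _ _ _ rfl rfl
      refine Or.inr ⟨_, _, j, g, rfl, rfl, ?_, h⟩
      rw [hp, hd, hax]
      cases ax <;> rfl
    · exact Or.inl ⟨_, t, _, j, g, Or.inr ⟨rfl, rfl⟩⟩
  · have hp : p = C.spotPos ax b k e := by
      rw [← hax, ← hs]
      cases d <;> first | (simp [head]; done) | simp [acrossVertical, posDir, Dir.opp] at hd
    have hp' : p + d.vec = C.spotPos ax b k e - (posDir (!ax)).vec := by
      conv_lhs => rw [hp, hd, hax, Dir.vec_opp]
      abel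
    rw [hp] at hx
    rw [hp'] at hy
    obtain ⟨g, hsx⟩ := C.slot_of_spot hk he hx
    obtain ⟨g', hsy⟩ := C.slot_of_spot_sub hk he hy
    have hc' : y.Compat x := C.compat_of_disjoint hxy.symm
    obtain ⟨rfl, ⟨t, j, rfl, rfl⟩ | ⟨j, rfl, rfl, rfl⟩ | ⟨t, j, rfl, rfl⟩⟩ :=
      slot_pair hsy hsx hc'
    · exact Or.inl ⟨_, t, _, j, g', Or.inr ⟨rfl, rfl⟩⟩
    · obtain ⟨rfl, h⟩ := hstr _ _ _ _ rfl rfl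
      refine Or.inr ⟨_, _, j, g', rfl, by simp, ?_, h⟩
      have hb : b + (posDir ax).vec + (posDir ax).opp.vec = b := by simp
      rw [hp, hd, hax]
      cases ax
      · exact congrArg (fun z => (C.spotPos false z (linkSlot j) 0, Dir.south)) hb.symm
      · exact congrArg (fun z => (C.spotPos true z (linkSlot j) 0, Dir.west)) hb.symm
    · exact Or.inl ⟨_, t, _, j, g', Or.inl ⟨rfl, rfl⟩⟩

/-- The glues where two combs touch. -/
theorem glueAt_contact (τ : ℕ) {x y : Piece T} {ax : Bool} {b : ℤ × ℤ} {k e : ℕ} {g g' : GlueOf T}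
    (hk : k < 10) (he : e < 2) (hx : x.Slot ax b (k - 1) g) (hy : y.Slot ax b k g')
    (hxy : Disjoint (C.cells x) (C.cells y)) :
    coarse (C.spotPos ax b k e - (posDir (!ax)).vec) ∈ C.cells x ∧
    coarse (C.spotPos ax b k e) ∈ C.cells y ∧
    C.glueAt τ x (C.spotPos ax b k e - (posDir (!ax)).vec) (posDir (!ax)) =
      contactGlue (contactLabel ax k e) (x.strength τ k e) ∧
    C.glueAt τ y (C.spotPos ax b k e) (posDir (!ax)).opp =
      contactGlue (contactLabel ax k e) (y.strength τ k e) := by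
  have hn := C.n_pos
  have h1 : coarse (C.spotPos ax b k e - (posDir (!ax)).vec) ∈ C.cells x := by
    rw [coarse_spotPos_sub _ _ _ _ he]
    refine C.mem_cells_of_slot hx ⟨by omega, by omega, Or.inr (Or.inl ?_)⟩
    have : C.spine k - 1 - C.spine (k - 1) = 2 * C.n := by unfold spine; ring
    omega
  have h2 : coarse (C.spotPos ax b k e) ∈ C.cells y := by
    rw [coarse_spotPos _ _ _ _ he]
    exact C.mem_cells_of_slot hy (by simpa using C.comb_spine g' le_rfl (by omega))
  have h1' := Set.disjoint_left.1 hxy h1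
  have h2' := Set.disjoint_right.1 hxy h2
  have hh : head (posDir (!ax)) (C.spotPos ax b k e - (posDir (!ax)).vec) =
      C.spotPos (acrossVertical (posDir (!ax))) b k e := by
    cases ax <;> simp [head, posDir, acrossVertical]
  refine ⟨h1, h2, ?_, ?_⟩
  · rw [glueAt, sub_add_cancel, if_neg fun h => h2' (by rwa [h]), if_neg h2',
      C.contactAt_eq x hk he hh]
    simp
  · rw [glueAt, Dir.vec_opp, ← sub_eq_add_neg, if_neg fun h => h1' (by rwa [h]), if_neg h1',
      C.contactAt_eq (b := b) y hk he ?_]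
    · simp
    · cases ax <;> simp [head, posDir, acrossVertical, Dir.opp]

end Coding

/-! ### Connectivity -/

/-- There is a path from one cell to another in the set `P`. -/
def Joined (P : Set (ℤ × ℤ)) : ℤ × ℤ → ℤ × ℤ → Prop :=
  Relation.ReflTransGen fun a b => a ∈ P ∧ b ∈ P ∧ ∃ d : Dir, b = a + d.vec

theorem Joined.symm {P : Set (ℤ × ℤ)} {a b : ℤ × ℤ} (h : Joined P a b) : Joined P b a := by
  have : Std.Symm fun a b : ℤ × ℤ => a ∈ P ∧ b ∈ P ∧ ∃ d : Dir, b = a + d.vec :=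
    ⟨fun a b ⟨ha, hb, d, hd⟩ => ⟨hb, ha, d.opp, by rw [hd, Dir.vec_opp]; abel⟩⟩
  exact Relation.ReflTransGen.stdSymm.symm _ _ h

theorem Joined.trans {P : Set (ℤ × ℤ)} {a b c : ℤ × ℤ} (h : Joined P a b) (h' : Joined P b c) :
    Joined P a c := Relation.ReflTransGen.trans h h'

theorem joined_segment {P : Set (ℤ × ℤ)} (c : ℤ × ℤ) (d : Dir) (n : ℕ)
    (h : ∀ i : ℕ, i ≤ n → c + (i : ℤ) • d.vec ∈ P) : Joined P c (c + (n : ℤ) • d.vec) := by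
  induction n with
  | zero =>
    rw [Nat.cast_zero, zero_smul, add_zero]
    exact Relation.ReflTransGen.refl
  | succ n ih =>
    refine (ih fun i hi => h i (by omega)).tail ⟨h n (by omega), h (n + 1) le_rfl, d, ?_⟩
    push_cast
    rw [add_smul, one_smul, add_assoc]

namespace Coding

variable {T : Finset TileType} (C : Coding T)

theorem place_swapIf_add_left (ax : Bool) (b : ℤ × ℤ) (u v i : ℤ) :
    C.place b (swapIf ax (u + i, v)) =
      C.place b (swapIf ax (u, v)) + i • (posDir (!ax)).vec := by
  cases ax <;> ext <;> simp [place, swapIf, posDir, Dir.vec, add_assoc]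

theorem place_swapIf_add_right (ax : Bool) (b : ℤ × ℤ) (u v i : ℤ) :
    C.place b (swapIf ax (u, v + i)) =
      C.place b (swapIf ax (u, v)) + i • (posDir ax).vec := by
  cases ax <;> ext <;> simp [place, swapIf, posDir, Dir.vec, add_assoc]

theorem joined_left {P : Set (ℤ × ℤ)} {ax : Bool} {b : ℤ × ℤ} {u u' v : ℤ} (h : u ≤ u')
    (hP : ∀ w, u ≤ w → w ≤ u' → C.place b (swapIf ax (w, v)) ∈ P) :
    Joined P (C.place b (swapIf ax (u, v))) (C.place b (swapIf ax (u', v))) := by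
  have := joined_segment (P := P) (C.place b (swapIf ax (u, v))) (posDir (!ax)) (u' - u).toNat
    fun i hi => by
      rw [← place_swapIf_add_left]
      exact hP _ (by omega) (by omega)
  rwa [← place_swapIf_add_left, show u + ((u' - u).toNat : ℤ) = u' by omega] at this

theorem joined_right {P : Set (ℤ × ℤ)} {ax : Bool} {b : ℤ × ℤ} {u v v' : ℤ} (h : v ≤ v')
    (hP : ∀ w, v ≤ w → w ≤ v' → C.place b (swapIf ax (u, w)) ∈ P) :
    Joined P (C.place b (swapIf ax (u, v))) (C.place b (swapIf ax (u, v'))) := by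
  have := joined_segment (P := P) (C.place b (swapIf ax (u, v))) (posDir ax) (v' - v).toNat
    fun i hi => by
      rw [← place_swapIf_add_right]
      exact hP _ (by omega) (by omega)
  rwa [← place_swapIf_add_right, show v + ((v' - v).toNat : ℤ) = v' by omega] at this

/-- A comb is connected. -/
theorem joined_comb {x : Piece T} {ax : Bool} {b : ℤ × ℤ} {a : ℤ} {g : GlueOf T}
    (hs : x.Slot ax b a g) {u v : ℤ} (hc : C.comb g (u - C.spine a) (v - C.side)) {w : ℤ}
    (hw : C.side ≤ w) (hw' : w < C.size) :
    Joined (C.cells x) (C.place b (swapIf ax (C.spine a, w))) (C.place b (swapIf ax (u, v))) := by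
  have hsz : C.size = C.side + 3 * C.n := by unfold size side; ring
  have mem : ∀ {u v}, C.comb g (u - C.spine a) (v - C.side) →
      C.place b (swapIf ax (u, v)) ∈ C.cells x := fun h => C.mem_cells_of_slot hs h
  have hspine : ∀ {v v'}, C.side ≤ v → v < C.size → C.side ≤ v' → v' < C.size →
      Joined (C.cells x) (C.place b (swapIf ax (C.spine a, v)))
        (C.place b (swapIf ax (C.spine a, v'))) := by
    intro v v' h1 h2 h3 h4
    have key : ∀ w, C.side ≤ w → w < C.size → C.place b (swapIf ax (C.spine a, w)) ∈ C.cells x :=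
      fun w h h' => mem (by simpa using C.comb_spine g (by omega) (by omega))
    rcases le_total v v' with h | h
    · exact C.joined_right h fun w _ _ => key w (by omega) (by omega)
    · exact (C.joined_right h fun w _ _ => key w (by omega) (by omega)).symm
  have hright : ∀ {u v}, C.side ≤ v → v < C.size → (v - C.side) % 3 = 0 → C.spine a ≤ u →
      u ≤ C.spine a + 2 * C.n → Joined (C.cells x) (C.place b (swapIf ax (C.spine a, w)))
        (C.place b (swapIf ax (u, v))) := by
    intro u v h1 h2 h3 h4 h5
    refine (hspine hw hw' h1 h2).trans (C.joined_left h4 fun z hz hz' => mem ?_)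
    refine ⟨by omega, by omega, ?_⟩
    rcases hz.eq_or_lt with h | h
    · exact Or.inl (by omega)
    · exact Or.inr (Or.inl ⟨by omega, by omega, Or.inl h3⟩)
  have hleft : ∀ {u v}, C.side ≤ v → v < C.size → (v - C.side) % 3 = 2 → u ≤ C.spine a →
      C.spine a - 2 * C.n ≤ u → Joined (C.cells x) (C.place b (swapIf ax (C.spine a, w)))
        (C.place b (swapIf ax (u, v))) := by
    intro u v h1 h2 h3 h4 h5
    refine (hspine hw hw' h1 h2).trans (C.joined_left h4 fun z hz hz' => mem ?_).symm
    refine ⟨by omega, by omega, ?_⟩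
    rcases hz'.eq_or_lt with h | h
    · exact Or.inl (by omega)
    · exact Or.inr (Or.inr ⟨by omega, by omega, Or.inl h3⟩)
  have hc' := hc
  obtain ⟨h1, h2, h | ⟨h3, h4, h | ⟨h, -⟩⟩ | ⟨h3, h4, h | ⟨h, -⟩⟩⟩ := hc
  · obtain rfl : u = C.spine a := by omega
    exact hspine hw hw' (by omega) (by omega)
  · exact hright (by omega) (by omega) h (by omega) (by omega)
  -- A code cell on the right of the spine lies directly above a full tooth; on the left a cell of
  -- the complement lies directly below one.
  · refine (hright (u := u) (v := v - 1) (by omega) (by omega) (by omega) (by omega)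
      (by omega)).trans (C.joined_right (by omega) fun z hz hz' => mem ?_)
    rcases (by omega : z = v - 1 ∨ z = v) with rfl | rfl
    · exact ⟨by omega, by omega, Or.inr (Or.inl ⟨by omega, by omega, Or.inl (by omega)⟩)⟩
    · exact hc'
  · exact hleft (by omega) (by omega) h (by omega) (by omega)
  · refine (hleft (u := u) (v := v + 1) (by omega) (by omega) (by omega) (by omega)
      (by omega)).trans (C.joined_right (by omega) fun z hz hz' => mem ?_).symm
    rcases (by omega : z = v + 1 ∨ z = v) with rfl | rfl
    · exact ⟨by omega, by omega, Or.inr (Or.inr ⟨by omega, by omega, Or.inl (by omega)⟩)⟩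
    · exact hc'

theorem mem_square (q : ℤ × ℤ) (t : {t : TileType // t ∈ T}) {l : ℤ × ℤ} (h1 : 0 ≤ l.1)
    (h1' : l.1 < C.side) (h2 : 0 ≤ l.2) (h2' : l.2 < C.side) :
    C.place q l ∈ C.cells (.body q t) := by
  have := C.side_lt_size
  left
  rw [C.blk_place h1 (by omega) h2 (by omega), C.loc_place h1 (by omega) h2 (by omega)]
  exact ⟨t, rfl, h1', h2'⟩

theorem joined_square (q : ℤ × ℤ) (t : {t : TileType // t ∈ T}) {l : ℤ × ℤ} (h1 : 0 ≤ l.1)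
    (h1' : l.1 < C.side) (h2 : 0 ≤ l.2) (h2' : l.2 < C.side) :
    Joined (C.cells (.body q t)) (C.place q (0, 0)) (C.place q l) :=
  (C.joined_left (ax := true) (b := q) (v := 0) h1 fun w _ _ =>
    C.mem_square q t (by simp [swapIf]; omega) (by simp [swapIf]; omega) (by simp [swapIf])
      (by simp [swapIf]; omega)).trans
  (C.joined_right (ax := true) (b := q) (u := l.1) h2 fun w _ _ =>
    C.mem_square q t (by simp [swapIf]; omega) (by simp [swapIf]; omega) (by simp [swapIf]; omega)
      (by simp [swapIf]; omega))

/-- A piece is connected. -/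
theorem joined_cells (x : Piece T) {c c' : ℤ × ℤ} (hc : c ∈ C.cells x) (hc' : c' ∈ C.cells x) :
    Joined (C.cells x) c c' := by
  suffices h : ∃ r, ∀ c ∈ C.cells x, Joined (C.cells x) r c by
    obtain ⟨r, h⟩ := h
    exact (h c hc).symm.trans (h c' hc')
  have h0 := C.side_pos
  have hsz := C.side_lt_size
  rcases x with ⟨q, t⟩ | ⟨q, d, j, g⟩
  · refine ⟨C.place q (0, 0), fun c hc => ?_⟩
    have hb := C.loc_bounds c
    rcases id hc with ⟨t', ht, h1, h2⟩ | ⟨ax, a, g, hs, hcomb⟩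
    · obtain ⟨rfl, rfl⟩ := Piece.body.inj ht
      have := C.joined_square (C.blk c) t hb.1 h1 hb.2.2.1 h2
      rwa [place_blk_loc] at this
    · have hsp := C.spine_bounds hs.bounds.1 hs.bounds.2
      have hn := C.n_pos
      have hpt : C.place (C.blk c) (swapIf ax ((swapIf ax (C.loc c)).1, (swapIf ax (C.loc c)).2)) =
          c := by
        rw [Prod.mk.eta, swapIf_swapIf, place_blk_loc]
      have hsq : ∀ v, 0 ≤ v → v < C.side → Joined (C.cells (.body q t)) (C.place q (0, 0))
          (C.place q (swapIf ax (C.spine a, v))) := by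
        intro v hv hv'
        apply C.joined_square <;> cases ax <;> simp [swapIf] <;> omega
      have hmem : ∀ v, 0 ≤ v → v < C.side →
          C.place q (swapIf ax (C.spine a, v)) ∈ C.cells (.body q t) := by
        intro v hv hv'
        apply C.mem_square <;> cases ax <;> simp [swapIf] <;> omega
      have hstep : ∀ w, C.side ≤ w → w < C.size →
          C.place (C.blk c) (swapIf ax (C.spine a, w)) ∈ C.cells (.body q t) := by
        intro w hw hw'
        have : C.size = C.side + 3 * C.n := by unfold size side; ring
        exact C.mem_cells_of_slot hs (by simpa using C.comb_spine g (by omega) (by omega))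
      rcases id hs with ⟨hq, _, _⟩ | ⟨hq, _, _⟩
      · rw [← hpt]
        refine ((hsq (C.side - 1) (by omega) (by omega)).tail
          ⟨hmem _ (by omega) (by omega), hstep C.side le_rfl hsz, posDir ax, ?_⟩).trans
          (C.joined_comb hs hcomb le_rfl hsz)
        rw [← hq]
        simpa using C.place_swapIf_add_right ax (C.blk c) (C.spine a) (C.side - 1) 1
      -- A comb on the lower or left side lies in the strip of the preceding block and meets the
      -- square at the last row of that strip, `size - 1`.
      · rw [← hpt]
        refine ((hsq 0 (by omega) (by omega)).tail
          ⟨hmem _ (by omega) (by omega), hstep (C.size - 1) (by omega) (by omega),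
            (posDir ax).opp, ?_⟩).trans
          (C.joined_comb hs hcomb (by omega) (by omega))
        rw [← hq]
        cases ax <;> ext <;> simp [place, swapIf, posDir, Dir.opp, Dir.vec] <;> ring
  · have hu : ∃ ax b a, ∀ ax' b' a' g', (Piece.conn q d j g).Slot ax' b' a' g' →
        ax' = ax ∧ b' = b ∧ a' = a ∧ g' = g := by
      cases d
      · exact ⟨true, q, if j then 6 else 1, fun ax' b' a' g' h => by
          obtain ⟨rfl, h | h⟩ := h <;> cases ax' <;> simp [posDir, Dir.opp] at h ⊢
          exact h⟩
      · exact ⟨false, q, if j then 6 else 1, fun ax' b' a' g' h => by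
          obtain ⟨rfl, h | h⟩ := h <;> cases ax' <;> simp [posDir, Dir.opp] at h ⊢
          exact h⟩
      · exact ⟨true, q - Dir.north.vec, if j then 7 else 2, fun ax' b' a' g' h => by
          obtain ⟨rfl, h | h⟩ := h <;> cases ax' <;> simp [posDir, Dir.opp] at h ⊢
          exact ⟨eq_sub_of_add_eq h.1, h.2⟩⟩
      · exact ⟨false, q - Dir.east.vec, if j then 7 else 2, fun ax' b' a' g' h => by
          obtain ⟨rfl, h | h⟩ := h <;> cases ax' <;> simp [posDir, Dir.opp] at h ⊢
          exact ⟨eq_sub_of_add_eq h.1, h.2⟩⟩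
    obtain ⟨ax, b, a, hu⟩ := hu
    refine ⟨C.place b (swapIf ax (C.spine a, C.side)), fun c hc => ?_⟩
    rcases hc with ⟨t', ht, -⟩ | ⟨ax', a', g', hs, hcomb⟩
    · cases ht
    · have hpt : C.place (C.blk c)
          (swapIf ax' ((swapIf ax' (C.loc c)).1, (swapIf ax' (C.loc c)).2)) = c := by
        rw [Prod.mk.eta, swapIf_swapIf, place_blk_loc]
      have := C.joined_comb hs hcomb le_rfl hsz
      rw [hpt] at this
      obtain ⟨rfl, h, rfl, rfl⟩ := hu _ _ _ _ hs
      rwa [h] at this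

end Coding

/-- A cut that separates two corners of a 4-cycle crosses at least two of its edges. -/
theorem Assembly.tied_of_square {U : Finset TileType} {τ w : ℕ} {α : Assembly U} {p : ℤ × ℤ}
    {d e : Dir} (hde : d ≠ e) (hde' : d ≠ e.opp) (hw : τ ≤ w + w) (h1 : w ≤ α.bond p d)
    (h2 : w ≤ α.bond p e) (h3 : w ≤ α.bond (p + e.vec) d) (h4 : w ≤ α.bond (p + d.vec) e) :
    α.Tied τ p (p + d.vec) := by
  intro S hp hp'
  by_cases hq : p + e.vec ∈ S
  · by_cases hr : p + e.vec + d.vec ∈ S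
    · have h5 : p + e.vec + d.vec + e.opp.vec = p + d.vec := by rw [Dir.vec_opp]; abel
      have h6 : w ≤ α.bond (p + e.vec + d.vec) e.opp := by
        rwa [add_right_comm, Assembly.bond_opp]
      exact Assembly.Cut.of_pair (d := d) (e := e.opp) (fun h => hde' (Prod.ext_iff.1 h).2) hp hp'
        hr (by rwa [h5]) (by omega)
    · refine Assembly.Cut.of_pair (fun h => ?_) hp hp' hq hr (by omega)
      have := (Prod.ext_iff.1 h).1
      cases e <;> simp [Dir.vec, Prod.ext_iff] at this
  · exact Assembly.Cut.of_pair (fun h => hde (Prod.ext_iff.1 h).2) hp hp' hp hq (by omega)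

/-- If the sum of some numbers is at least `τ` then this remains true if they are bounded by `τ`. -/
theorem le_sum_min {ι : Type*} {τ : ℕ} {F : Finset ι} {f : ι → ℕ} (h : τ ≤ ∑ i ∈ F, f i) :
    τ ≤ ∑ i ∈ F, min (f i) τ := by
  by_cases hc : ∃ i ∈ F, τ ≤ f i
  · obtain ⟨i, hi, hc⟩ := hc
    calc τ = min (f i) τ := (min_eq_right hc).symm
      _ ≤ _ := Finset.single_le_sum (f := fun i => min (f i) τ) (fun _ _ => Nat.zero_le _) hi
  · push Not at hc
    rwa [Finset.sum_congr rfl fun i hi => min_eq_left (hc i hi).le]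

namespace Coding

variable {T : Finset TileType} (C : Coding T) {τ : ℕ} (hτ : 2 ≤ τ)

open Assembly

/-! ### The assemblies that consist of pieces -/

/-- The tile of a piece at one of its positions. -/
noncomputable def tileOf (x : Piece T) (p : ℤ × ℤ) (h : coarse p ∈ C.cells x) :
    {t : TileType // t ∈ universalTiles τ} := ⟨C.tile τ x p, C.tile_mem hτ h⟩

open Classical in
/-- The assembly that consists of a set of pieces. -/
noncomputable def asm (K : Set (Piece T)) : Assembly (universalTiles τ) := fun p =>
  if h : ∃ x ∈ K, coarse p ∈ C.cells x then some (C.tileOf hτ h.choose p h.choose_spec.2) else none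

variable {C} {K : Set (Piece T)}

theorem mem_dom_asm {p : ℤ × ℤ} : p ∈ (C.asm hτ K).dom ↔ ∃ x ∈ K, coarse p ∈ C.cells x := by
  by_cases h : ∃ x ∈ K, coarse p ∈ C.cells x
  · simp only [mem_dom, asm, h, iff_true]
    exact ⟨_, rfl⟩
  · simp only [mem_dom, asm, h, iff_false]
    simp

theorem asm_eq (hK : K.PairwiseDisjoint C.cells) {x : Piece T} (hx : x ∈ K) {p : ℤ × ℤ}
    (hp : coarse p ∈ C.cells x) : C.asm hτ K p = some (C.tileOf hτ x p hp) := by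
  have h : ∃ x ∈ K, coarse p ∈ C.cells x := ⟨x, hx, hp⟩
  have he : h.choose = x := hK.elim_set h.choose_spec.1 hx _ h.choose_spec.2 hp
  rw [asm, dif_pos h]
  congr 1
  exact Subtype.ext (by simp only [tileOf, he])

theorem exists_of_asm_eq {p : ℤ × ℤ} {t} (h : C.asm hτ K p = some t) :
    ∃ x ∈ K, coarse p ∈ C.cells x ∧ t.1 = C.tile τ x p := by
  by_cases h' : ∃ x ∈ K, coarse p ∈ C.cells x
  · rw [asm, dif_pos h'] at h
    exact ⟨h'.choose, h'.choose_spec.1, h'.choose_spec.2, by rw [← Option.some.inj h]; rfl⟩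
  · rw [asm, dif_neg h'] at h
    cases h

theorem asm_sub {K' : Set (Piece T)} (hK : K'.PairwiseDisjoint C.cells) (h : K ⊆ K') :
    (C.asm hτ K).Sub (C.asm hτ K') := by
  intro p hp
  obtain ⟨x, hx, hp⟩ := (mem_dom_asm hτ).1 hp
  rw [asm_eq hτ (hK.subset h) hx hp, asm_eq hτ hK (h hx) hp]

theorem asm_union {K' : Set (Piece T)} (hK : (K ∪ K').PairwiseDisjoint C.cells) :
    C.asm hτ (K ∪ K') = (C.asm hτ K).union (C.asm hτ K') := by
  funext p
  by_cases h : p ∈ (C.asm hτ K).dom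
  · rw [union_apply_left h, asm_sub hτ hK Set.subset_union_left p h]
  · rw [union_apply_right h]
    by_cases h' : p ∈ (C.asm hτ K').dom
    · rw [asm_sub hτ hK Set.subset_union_right p h']
    · have h'' : p ∉ (C.asm hτ (K ∪ K')).dom := by
        rw [mem_dom_asm] at h h' ⊢
        rintro ⟨x, hx | hx, hp⟩
        exacts [h ⟨x, hx, hp⟩, h' ⟨x, hx, hp⟩]
      rw [eq_none_of_not_mem_dom h', eq_none_of_not_mem_dom h'']

variable (C) in
theorem pairwiseDisjoint_shift (v : ℤ × ℤ) (hK : K.PairwiseDisjoint C.cells) :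
    (Piece.shift v '' K).PairwiseDisjoint C.cells := by
  rintro _ ⟨x, hx, rfl⟩ _ ⟨y, hy, rfl⟩ hne
  refine Set.disjoint_left.2 fun c hc hc' => ?_
  have h1 := (C.cells_shift x v (c - C.size • v)).1 (by simpa using hc)
  have h2 := (C.cells_shift y v (c - C.size • v)).1 (by simpa using hc')
  exact hne (by rw [hK.elim_set hx hy _ h1 h2])

theorem asm_shift (v : ℤ × ℤ) (hK : K.PairwiseDisjoint C.cells) :
    C.asm hτ (Piece.shift v '' K) = (C.asm hτ K).translate ((2 : ℤ) • C.size • v) := by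
  have hK' := C.pairwiseDisjoint_shift v hK
  have hc : ∀ p, coarse p = coarse (p - (2 : ℤ) • C.size • v) + C.size • v := fun p => by
    rw [← coarse_add, sub_add_cancel]
  funext p
  by_cases h : ∃ x ∈ K, coarse (p - (2 : ℤ) • C.size • v) ∈ C.cells x
  · obtain ⟨x, hx, hp⟩ := h
    have hp' : coarse p ∈ C.cells (x.shift v) := by
      rw [hc, cells_shift]
      exact hp
    change C.asm hτ _ p = C.asm hτ K (p - _)
    rw [asm_eq hτ hK' ⟨x, hx, rfl⟩ hp', asm_eq hτ hK hx hp]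
    refine congrArg some (Subtype.ext ?_)
    have := C.tile_shift τ x v (p - (2 : ℤ) • C.size • v)
    rwa [sub_add_cancel] at this
  · have h1 : p ∉ (C.asm hτ (Piece.shift v '' K)).dom := by
      rw [mem_dom_asm]
      rintro ⟨_, ⟨x, hx, rfl⟩, hp⟩
      rw [hc, cells_shift] at hp
      exact h ⟨x, hx, hp⟩
    have h2 : p ∉ ((C.asm hτ K).translate ((2 : ℤ) • C.size • v)).dom := by
      rwa [mem_dom_translate, mem_dom_asm]
    rw [eq_none_of_not_mem_dom h1, eq_none_of_not_mem_dom h2]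

theorem pairwiseDisjoint_union {K' : Set (Piece T)} (hK : K.PairwiseDisjoint C.cells)
    (hK' : K'.PairwiseDisjoint C.cells) (h : Disjoint (C.asm hτ K).dom (C.asm hτ K').dom) :
    (K ∪ K').PairwiseDisjoint C.cells := by
  rw [Set.pairwiseDisjoint_union]
  refine ⟨hK, hK', fun x hx y hy _ => Set.disjoint_left.2 fun c hc hc' => ?_⟩
  have h2 : coarse ((2 : ℤ) • c) = c := by ext <;> simp [coarse]
  exact Set.disjoint_left.1 h ((mem_dom_asm hτ (p := (2 : ℤ) • c)).2 ⟨x, hx, by rwa [h2]⟩)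
    ((mem_dom_asm hτ).2 ⟨y, hy, by rwa [h2]⟩)

theorem bond_asm (hK : K.PairwiseDisjoint C.cells) {x y : Piece T} (hx : x ∈ K) (hy : y ∈ K)
    {p : ℤ × ℤ} {d : Dir} (hp : coarse p ∈ C.cells x) (hp' : coarse (p + d.vec) ∈ C.cells y) :
    (C.asm hτ K).bond p d = if C.glueAt τ x p d = C.glueAt τ y (p + d.vec) d.opp then
      (C.glueAt τ x p d).strength else 0 :=
  bond_eq_of_some (asm_eq hτ hK hx hp) (asm_eq hτ hK hy hp')

theorem half_le_bond (hK : K.PairwiseDisjoint C.cells) {x : Piece T} (hx : x ∈ K) {p : ℤ × ℤ}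
    {d : Dir} (hp : coarse p ∈ C.cells x) (hp' : coarse (p + d.vec) ∈ C.cells x) :
    half τ ≤ (C.asm hτ K).bond p d := by
  rw [bond_asm hτ hK hx hx hp hp']
  have h : p + d.vec + d.opp.vec = p := by simp
  unfold glueAt
  rw [h]
  by_cases hc : coarse (p + d.vec) = coarse p
  · simp [hc, colorGlue]
  · rw [if_neg hc, if_pos hp', if_neg (Ne.symm hc), if_pos hp, if_pos rfl]
    exact le_rfl

/-- The tiles of a coarse cell are tied. -/
theorem tied_of_coarse_eq (hK : K.PairwiseDisjoint C.cells) {x : Piece T} (hx : x ∈ K)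
    {p p' : ℤ × ℤ} (hp : coarse p ∈ C.cells x) (hp' : coarse p' = coarse p) :
    (C.asm hτ K).Tied τ p p' := by
  -- The directions `d` and `e` lead from `p` to the other column and to the other row of its coarse
  -- cell.
  obtain ⟨d, hd, hdp⟩ : ∃ d : Dir, (d = .east ∨ d = .west) ∧
      ∀ q : ℤ × ℤ, q.1 = p.1 → coarse (q + d.vec) = coarse q ∧
      (∀ r : ℤ × ℤ, r.1 / 2 = p.1 / 2 → r.1 = p.1 ∨ r.1 = (p + d.vec).1) := by
    rcases Int.emod_two_eq_zero_or_one p.1 with h | h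
    · refine ⟨.east, Or.inl rfl, fun q hq => ⟨by ext <;> simp [coarse, Dir.vec]; omega,
        fun r hr => by simp [Dir.vec]; omega⟩⟩
    · refine ⟨.west, Or.inr rfl, fun q hq => ⟨by ext <;> simp [coarse, Dir.vec]; omega,
        fun r hr => by simp [Dir.vec]; omega⟩⟩
  obtain ⟨e, he, hep⟩ : ∃ e : Dir, (e = .north ∨ e = .south) ∧
      ∀ q : ℤ × ℤ, q.2 = p.2 → coarse (q + e.vec) = coarse q ∧
      (∀ r : ℤ × ℤ, r.2 / 2 = p.2 / 2 → r.2 = p.2 ∨ r.2 = (p + e.vec).2) := by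
    rcases Int.emod_two_eq_zero_or_one p.2 with h | h
    · refine ⟨.north, Or.inl rfl, fun q hq => ⟨by ext <;> simp [coarse, Dir.vec]; omega,
        fun r hr => by simp [Dir.vec]; omega⟩⟩
    · refine ⟨.south, Or.inr rfl, fun q hq => ⟨by ext <;> simp [coarse, Dir.vec]; omega,
        fun r hr => by simp [Dir.vec]; omega⟩⟩
  have hd2 : d.vec.2 = 0 := by rcases hd with rfl | rfl <;> rfl
  have he1 : e.vec.1 = 0 := by rcases he with rfl | rfl <;> rfl
  have hne : d ≠ e ∧ d ≠ e.opp ∧ e ≠ d.opp := by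
    rcases hd with rfl | rfl <;> rcases he with rfl | rfl <;> simp [Dir.opp]
  have c1 : coarse (p + d.vec) = coarse p := (hdp p rfl).1
  have c2 : coarse (p + e.vec) = coarse p := (hep p rfl).1
  have c3 : coarse (p + d.vec + e.vec) = coarse p := ((hep _ (by simp [hd2])).1).trans c1
  have c4 : coarse (p + e.vec + d.vec) = coarse p := by rw [add_right_comm, c3]
  have b1 := half_le_bond hτ hK hx (d := d) hp (by rwa [c1])
  have b2 := half_le_bond hτ hK hx (d := e) hp (by rwa [c2])
  have b3 := half_le_bond hτ hK hx (p := p + d.vec) (d := e) (by rwa [c1]) (by rwa [c3])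
  have b4 := half_le_bond hτ hK hx (p := p + e.vec) (d := d) (by rwa [c2]) (by rwa [c4])
  have hw := le_half_add_half τ
  have t1 := tied_of_square hne.1 hne.2.1 hw b1 b2 b4 b3
  have t2 := tied_of_square hne.1.symm hne.2.2 hw b2 b1 b3 b4
  have b1' : half τ ≤ (C.asm hτ K).bond (p + d.vec) d.opp := by rwa [bond_opp]
  have b4' : half τ ≤ (C.asm hτ K).bond (p + d.vec + e.vec) d.opp := by
    rwa [add_right_comm, bond_opp]
  have t3 : (C.asm hτ K).Tied τ (p + d.vec) (p + d.vec + e.vec) :=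
    tied_of_square hne.2.2 (fun h => hne.1 (by simpa using h.symm)) hw b3 b1'
      (by simpa using b2) b4'
  have hr1 := (hdp p rfl).2 p' (congrArg Prod.fst hp')
  have hr2 := (hep p rfl).2 p' (congrArg Prod.snd hp')
  rcases hr1 with h1 | h1 <;> rcases hr2 with h2 | h2
  · rw [show p' = p from Prod.ext h1 h2]
    exact Tied.refl _ _ _
  · rw [show p' = p + e.vec from Prod.ext (by simp [h1, he1]) h2]
    exact t2
  · rw [show p' = p + d.vec from Prod.ext h1 (by simp [h2, hd2])]
    exact t1
  · rw [show p' = p + d.vec + e.vec from Prod.ext (by simp [h1, he1]) (by simp [h2, hd2])]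
    exact t1.trans t3

/-- Adjacent coarse cells share two tile edges. With both bonds at ⌈τ/2⌉ this ties the cells to each
other. -/
theorem exists_parallel (c : ℤ × ℤ) (d : Dir) : ∃ p p' : ℤ × ℤ, p ≠ p' ∧ coarse p = c ∧
    coarse p' = c ∧ coarse (p + d.vec) = c + d.vec ∧ coarse (p' + d.vec) = c + d.vec := by
  cases d
  · refine ⟨(2 * c.1, 2 * c.2 + 1), (2 * c.1 + 1, 2 * c.2 + 1), by simp, ?_, ?_, ?_, ?_⟩ <;>
      ext <;> simp [coarse, Dir.vec] <;> omega
  · refine ⟨(2 * c.1 + 1, 2 * c.2), (2 * c.1 + 1, 2 * c.2 + 1), by simp, ?_, ?_, ?_, ?_⟩ <;>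
      ext <;> simp [coarse, Dir.vec] <;> omega
  · refine ⟨(2 * c.1, 2 * c.2), (2 * c.1 + 1, 2 * c.2), by simp, ?_, ?_, ?_, ?_⟩ <;>
      ext <;> simp [coarse, Dir.vec] <;> omega
  · refine ⟨(2 * c.1, 2 * c.2), (2 * c.1, 2 * c.2 + 1), by simp, ?_, ?_, ?_, ?_⟩ <;>
      ext <;> simp [coarse, Dir.vec] <;> omega

/-- The tiles of a piece are tied. -/
theorem tied_piece (hK : K.PairwiseDisjoint C.cells) {x : Piece T} (hx : x ∈ K)
    {p p' : ℤ × ℤ} (hp : coarse p ∈ C.cells x) (hp' : coarse p' ∈ C.cells x) :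
    (C.asm hτ K).Tied τ p p' := by
  have key : ∀ c c', Joined (C.cells x) c c' → c ∈ C.cells x → ∀ p p', coarse p = c →
      coarse p' = c' → (C.asm hτ K).Tied τ p p' := by
    intro c c' h
    induction h with
    | refl =>
      rintro hc p p' rfl h
      exact tied_of_coarse_eq hτ hK hx hc h
    | tail _ hbc ih =>
      rintro hc p p' rfl h
      obtain ⟨hb, hc', d, rfl⟩ := hbc
      obtain ⟨q, q', hne, h1, h2, h3, h4⟩ := exists_parallel _ d
      rw [← h3] at hc'
      have t := tied_of_parallel (d := d) (e := d) (fun h => hne (Prod.ext_iff.1 h).1)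
        (tied_of_coarse_eq hτ hK hx (p := q) (p' := q') (by rwa [h1]) (by rw [h1, h2]))
        (tied_of_coarse_eq hτ hK hx (p := q + d.vec) (p' := q' + d.vec) hc' (by rw [h3, h4]))
        ((le_half_add_half τ).trans (add_le_add
          (half_le_bond hτ hK hx (by rwa [h1]) hc')
          (half_le_bond hτ hK hx (by rwa [h2]) (by rwa [h4, ← h3]))))
      exact ((ih hc p q rfl h1).trans t).trans
        (tied_of_coarse_eq hτ hK hx hc' (by rw [h, h3]))
  exact key _ _ (C.joined_cells x hp hp') hp p p' rfl rfl

variable (C) in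
theorem cells_nonempty (x : Piece T) : ∃ p, coarse p ∈ C.cells x := by
  have h2 : ∀ c : ℤ × ℤ, coarse ((2 : ℤ) • c) = c := fun c => by ext <;> simp [coarse]
  suffices h : ∃ c, c ∈ C.cells x by
    obtain ⟨c, hc⟩ := h
    exact ⟨(2 : ℤ) • c, by rwa [h2]⟩
  rcases x with ⟨q, t⟩ | ⟨q, d, j, g⟩
  · have := C.side_pos
    exact ⟨_, C.mem_square q t (l := (0, 0)) le_rfl this le_rfl this⟩
  · have hs : ∃ ax b a, (Piece.conn q d j g).Slot ax b a g := by
      rcases eq_posDir_or d with h | h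
      · exact ⟨_, q, _, rfl, Or.inl ⟨h, rfl, rfl⟩⟩
      · exact ⟨!acrossVertical d, q - (posDir (!acrossVertical d)).vec, _, rfl,
          Or.inr ⟨h, sub_add_cancel _ _, rfl⟩⟩
    obtain ⟨ax, b, a, hs⟩ := hs
    have := C.n_pos
    exact ⟨_, C.mem_cells_of_slot hs (u := C.spine a) (v := C.side)
      (by simpa using C.comb_spine g le_rfl (by omega))⟩

theorem stable_singleton (x : Piece T) : (C.asm hτ {x}).Stable τ := by
  refine stable_of_tied fun p hp p' hp' => ?_
  obtain ⟨y, hy, h⟩ := (mem_dom_asm hτ).1 hp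
  obtain ⟨y', hy', h'⟩ := (mem_dom_asm hτ).1 hp'
  rw [Set.mem_singleton_iff] at hy hy'
  subst hy hy'
  exact tied_piece hτ (Set.pairwiseDisjoint_singleton _ _) rfl h h'

end Coding

namespace Coding

variable {T : Finset TileType} {C : Coding T} {τ : ℕ} (hτ : 2 ≤ τ) {K : Set (Piece T)}

open Assembly

/-! ### Configurations -/

variable (C K) in
/-- A configuration: the pieces in `K` do not overlap, and each connector belongs to a body. -/
structure IsConfig : Prop where
  disjoint : K.PairwiseDisjoint C.cells
  attached : ∀ q d j g, Piece.conn q d j g ∈ K → ∃ t, .body q t ∈ K ∧ g = glueOf t d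

variable (K) in
open Classical in
/-- The assembly that is represented by a set of pieces. -/
noncomputable def rep : Assembly T := fun q =>
  if h : ∃ t, .body q t ∈ K then some h.choose else none

theorem rep_eq_some (hK : K.PairwiseDisjoint C.cells) {q : ℤ × ℤ} {t} :
    rep K q = some t ↔ .body q t ∈ K := by
  constructor
  · intro h
    by_cases h' : ∃ t, Piece.body q t ∈ K
    · rw [rep, dif_pos h'] at h
      exact Option.some.inj h ▸ h'.choose_spec
    · rw [rep, dif_neg h'] at h
      cases h
  · intro h
    have h' : ∃ t, Piece.body q t ∈ K := ⟨t, h⟩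
    rw [rep, dif_pos h']
    congr 1
    by_contra hne
    exact (C.compat_of_disjoint (hK h'.choose_spec h fun he => hne (Piece.body.inj he).2)).body
      _ _ _ rfl rfl

theorem mem_dom_rep {q : ℤ × ℤ} : q ∈ (rep K).dom ↔ ∃ t, .body q t ∈ K := by
  by_cases h : ∃ t, .body q t ∈ K
  · simp only [mem_dom, rep, h, iff_true]
    exact ⟨_, rfl⟩
  · simp only [mem_dom, rep, h, iff_false]
    simp

/-- The connectors of a body have its glues. -/
theorem conn_glue {x y : Piece T} (h : x.Compat y) {q d j g t} (hx : x = .conn q d j g)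
    (hy : y = .body q t) : g = glueOf t d := by
  subst hx hy
  -- The connector stands in a slot next to a comb of its body: 1 beside 0, 6 beside 5, 2 beside 3,
  -- or 7 beside 8. Compatibility forces equal glues in adjacent slots.
  rcases eq_posDir_or d with hd | hd
  · refine (h.slot (!acrossVertical d) q (if j then 6 else 1) g (if j then 5 else 0)
      (glueOf t d) ⟨rfl, Or.inl ⟨hd, rfl, rfl⟩⟩ (Or.inl ⟨rfl, ?_, by rw [← hd]⟩)).2.2 ?_
    · cases j <;> simp
    · cases j <;> rfl
  · refine (h.slot (!acrossVertical d) (q - (posDir (!acrossVertical d)).vec) (if j then 7 else 2) g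
      (if j then 8 else 3) (glueOf t d) ⟨rfl, Or.inr ⟨hd, sub_add_cancel _ _, rfl⟩⟩
      (Or.inr ⟨sub_add_cancel _ _, ?_, by rw [← hd]⟩)).2.1 ?_
    · cases j <;> simp
    · cases j <;> rfl

/-- Both edges of the place of contact carry ⌈τ/2⌉, and their ends on either side are tied inside
the two pieces. -/
theorem tied_of_slot (hK : K.PairwiseDisjoint C.cells) {x y : Piece T} (hx : x ∈ K) (hy : y ∈ K)
    (hne : x ≠ y) {ax b g g'} {k : ℕ} (hk : k < 10) (hsx : x.Slot ax b (k - 1) g)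
    (hsy : y.Slot ax b k g') (hwx : ∀ e, x.strength τ k e = half τ)
    (hwy : ∀ e, y.strength τ k e = half τ) :
    ∃ p p', coarse p ∈ C.cells x ∧ coarse p' ∈ C.cells y ∧ (C.asm hτ K).Tied τ p p' := by
  have hd := hK hx hy hne
  have key : ∀ e, e < 2 → coarse (C.spotPos ax b k e - (posDir (!ax)).vec) ∈ C.cells x ∧
      coarse (C.spotPos ax b k e - (posDir (!ax)).vec + (posDir (!ax)).vec) ∈ C.cells y ∧
      (C.asm hτ K).bond (C.spotPos ax b k e - (posDir (!ax)).vec) (posDir (!ax)) = half τ := by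
    intro e he
    obtain ⟨h1, h2, h3, h4⟩ := C.glueAt_contact τ hk he hsx hsy hd
    rw [← sub_add_cancel (C.spotPos ax b k e) (posDir (!ax)).vec] at h2 h4
    refine ⟨h1, h2, ?_⟩
    rw [bond_asm hτ hK hx hy h1 h2, h3, h4, hwx, hwy, if_pos rfl]
    rfl
  obtain ⟨h1, h2, h3⟩ := key 0 two_pos
  obtain ⟨h1', h2', h3'⟩ := key 1 one_lt_two
  refine ⟨_, _, h1, h2, tied_of_parallel (d := posDir (!ax)) (e := posDir (!ax)) ?_
    (tied_piece hτ hK hx h1 h1') (tied_piece hτ hK hy h2 h2') ?_⟩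
  · intro h
    have := (C.spotPos_inj hk hk two_pos one_lt_two (sub_left_inj.1 (Prod.ext_iff.1 h).1)).2.2
    omega
  · rw [h3, h3']
    exact le_half_add_half τ

/-- A connector is tied to its body. -/
theorem tied_conn (hK : K.PairwiseDisjoint C.cells) {q d j g t} (hx : .conn q d j g ∈ K)
    (hy : .body q t ∈ K) {p p' : ℤ × ℤ} (hp : coarse p ∈ C.cells (.conn q d j g))
    (hp' : coarse p' ∈ C.cells (.body q t)) : (C.asm hτ K).Tied τ p p' := by
  have hne : Piece.conn q d j g ≠ .body q t := nofun
  rcases eq_posDir_or d with hd | hd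
  · obtain ⟨r, r', h1, h2, h3⟩ := tied_of_slot hτ hK hy hx hne.symm (ax := !acrossVertical d)
      (b := q) (g := glueOf t d) (g' := g) (k := if j then 6 else 1) (by cases j <;> simp)
      (Or.inl ⟨rfl, by cases j <;> simp, by rw [← hd]⟩)
      ⟨rfl, Or.inl ⟨hd, rfl, by cases j <;> rfl⟩⟩ (fun _ => rfl)
      (fun e => by cases j <;> rfl)
    exact ((tied_piece hτ hK hx hp h2).trans h3.symm).trans (tied_piece hτ hK hy h1 hp')
  · obtain ⟨r, r', h1, h2, h3⟩ := tied_of_slot hτ hK hx hy hne (ax := !acrossVertical d)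
      (b := q - (posDir (!acrossVertical d)).vec) (g := g) (g' := glueOf t d)
      (k := if j then 8 else 3) (by cases j <;> simp)
      ⟨rfl, Or.inr ⟨hd, sub_add_cancel _ _, by cases j <;> rfl⟩⟩
      (Or.inr ⟨sub_add_cancel _ _, by cases j <;> simp, by rw [← hd]⟩)
      (fun e => by cases j <;> rfl) (fun _ => rfl)
    exact ((tied_piece hτ hK hx hp h1).trans h3).trans (tied_piece hτ hK hy h2 hp')

/-- The tiles of a macrotile are tied. -/
theorem tied_owner (hK : C.IsConfig K) {x y : Piece T} (hx : x ∈ K) (hy : y ∈ K)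
    (h : x.owner = y.owner) {p p' : ℤ × ℤ} (hp : coarse p ∈ C.cells x)
    (hp' : coarse p' ∈ C.cells y) : (C.asm hτ K).Tied τ p p' := by
  have key : ∀ x ∈ K, ∃ t, .body x.owner t ∈ K ∧ ∀ p p', coarse p ∈ C.cells x →
      coarse p' ∈ C.cells (.body x.owner t) → (C.asm hτ K).Tied τ p p' := by
    rintro (⟨q, t⟩ | ⟨q, d, j, g⟩) hx
    · exact ⟨t, hx, fun p p' => tied_piece hτ hK.disjoint hx⟩
    · obtain ⟨t, ht, -⟩ := hK.attached _ _ _ _ hx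
      exact ⟨t, ht, fun p p' => tied_conn hτ hK.disjoint hx ht⟩
  obtain ⟨t, ht, h1⟩ := key x hx
  obtain ⟨t', ht', h2⟩ := key y hy
  obtain ⟨r, hr⟩ := cells_nonempty C (.body x.owner t)
  rw [← h] at ht' h2
  have : t = t' := Option.some.inj
    (((rep_eq_some hK.disjoint).2 ht).symm.trans ((rep_eq_some hK.disjoint).2 ht'))
  subst this
  exact (h1 p r hp hr).trans (h2 p' r hp' hr).symm

theorem linkEdge_pos (ax : Bool) (q : ℤ × ℤ) (j : Bool) : C.linkEdge q j (posDir ax) =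
    (C.spotPos ax q (linkSlot j) 0 - (posDir (!ax)).vec, posDir (!ax)) := by
  cases ax <;> rfl

theorem linkEdge_neg (ax : Bool) (q : ℤ × ℤ) (j : Bool) : C.linkEdge q j (posDir ax).opp =
    (C.spotPos ax (q + (posDir ax).opp.vec) (linkSlot j) 0, (posDir (!ax)).opp) := by
  cases ax <;> rfl

theorem bond_link_pos (hK : K.PairwiseDisjoint C.cells) {q ax j g} (hx : .conn q (posDir ax) j g ∈ K)
    (hy : .conn (q + (posDir ax).vec) (posDir ax).opp j g ∈ K) :
    coarse (C.spotPos ax q (linkSlot j) 0 - (posDir (!ax)).vec) ∈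
        C.cells (.conn q (posDir ax) j g) ∧
      coarse (C.spotPos ax q (linkSlot j) 0) ∈
        C.cells (.conn (q + (posDir ax).vec) (posDir ax).opp j g) ∧
      (C.asm hτ K).bond (C.spotPos ax q (linkSlot j) 0 - (posDir (!ax)).vec) (posDir (!ax)) =
        share τ j g.1.strength := by
  have hne : Piece.conn q (posDir ax) j g ≠ .conn (q + (posDir ax).vec) (posDir ax).opp j g := by
    cases ax <;> simp [posDir, Dir.opp]
  have hd := hK hx hy hne
  obtain ⟨h1, h2, h3, h4⟩ := C.glueAt_contact τ (e := 0) (linkSlot_lt j) two_pos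
    (x := .conn q (posDir ax) j g) (y := .conn (q + (posDir ax).vec) (posDir ax).opp j g)
    (ax := ax) (b := q)
    ⟨rfl, Or.inl ⟨rfl, rfl, by cases j <;> rfl⟩⟩ ⟨rfl, Or.inr ⟨rfl, rfl, by cases j <;> rfl⟩⟩ hd
  refine ⟨h1, h2, ?_⟩
  have hs : ∀ q d, (Piece.conn q d j g).strength τ (linkSlot j) 0 = share τ j g.1.strength := by
    intro q d; cases j <;> rfl
  rw [← sub_add_cancel (C.spotPos ax q (linkSlot j) 0) (posDir (!ax)).vec] at h2 h4
  rw [bond_asm hτ hK hx hy h1 h2, h3, h4, hs, hs, if_pos rfl]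
  rfl

/-- The bond between two connectors for adjacent sides. -/
theorem bond_link (hK : K.PairwiseDisjoint C.cells) {q d j g} (hx : .conn q d j g ∈ K)
    (hy : .conn (q + d.vec) d.opp j g ∈ K) :
    coarse (C.linkEdge q j d).1 ∈ C.cells (.conn q d j g) ∧
      coarse ((C.linkEdge q j d).1 + (C.linkEdge q j d).2.vec) ∈
        C.cells (.conn (q + d.vec) d.opp j g) ∧
      (C.asm hτ K).bond (C.linkEdge q j d).1 (C.linkEdge q j d).2 = share τ j g.1.strength := by
  rcases eq_posDir_or d with hd | hd
  · rw [hd] at hx hy ⊢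
    rw [linkEdge_pos]
    simpa only [sub_add_cancel] using bond_link_pos hτ hK hx hy
  · generalize (!acrossVertical d) = ax at hd
    subst hd
    have hq : q = q + (posDir ax).opp.vec + (posDir ax).vec := by simp
    have := bond_link_pos hτ hK (q := q + (posDir ax).opp.vec) (by simpa using hy) (by simpa using hx)
    rw [linkEdge_neg]
    rw [← hq] at this
    simp only [Dir.opp_opp]
    obtain ⟨h1, h2, h3⟩ := this
    refine ⟨h2, by rwa [Dir.vec_opp (posDir !ax), ← sub_eq_add_neg], ?_⟩
    have := bond_opp (C.asm hτ K)
      (C.spotPos ax (q + (posDir ax).opp.vec) (linkSlot j) 0 - (posDir (!ax)).vec) (posDir (!ax))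
    rw [sub_add_cancel] at this
    rw [this, h3]

theorem bond_rep_pos (hK : K.PairwiseDisjoint C.cells) {q d} (h : 0 < (rep K).bond q d) :
    ∃ t t', .body q t ∈ K ∧ .body (q + d.vec) t' ∈ K ∧ glueOf t d = glueOf t' d.opp ∧
      (rep K).bond q d = (glueOf t d).1.strength := by
  obtain ⟨t, t', h1, h2, h3, h4⟩ := exists_of_bond_pos h
  exact ⟨t, t', (rep_eq_some hK).1 h1, (rep_eq_some hK).1 h2, Subtype.ext h3, h4⟩

variable (K) in
/-- All pairs of adjacent sides with equal glues have their connectors. -/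
def IsFull : Prop := ∀ q d, 0 < (rep K).bond q d → ∀ j, ∃ g, .conn q d j g ∈ K

open Classical in
/-- A full configuration that represents a stable assembly is stable. -/
theorem stable_asm (hK : C.IsConfig K) (hf : IsFull K) (hs : (rep K).Stable τ) :
    (C.asm hτ K).Stable τ := by
  refine stable_of_tied fun p hp p' hp' S hpS hpS' => ?_
  by_contra hcut
  -- A cut of weight less than τ cannot divide a macrotile, hence it induces a cut of the
  -- represented assembly.
  have hside : ∀ {x y}, x ∈ K → y ∈ K → x.owner = y.owner → ∀ {p p'}, coarse p ∈ C.cells x →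
      coarse p' ∈ C.cells y → p ∈ S → p' ∈ S := by
    intro x y hx hy h p p' hp hp' hpS
    by_contra hpS'
    exact hcut (tied_owner hτ hK hx hy h hp hp' S hpS hpS')
  have hdom : ∀ x ∈ K, x.owner ∈ (rep K).dom := by
    rintro (⟨q, t⟩ | ⟨q, d, j, g⟩) hx
    · exact mem_dom_rep.2 ⟨t, hx⟩
    · obtain ⟨t, ht, -⟩ := hK.attached _ _ _ _ hx
      exact mem_dom_rep.2 ⟨t, ht⟩
  obtain ⟨x, hx, hp⟩ := (mem_dom_asm hτ).1 hp
  obtain ⟨x', hx', hp'⟩ := (mem_dom_asm hτ).1 hp'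
  obtain ⟨F, hF, hw⟩ := hs {q | ∃ x ∈ K, x.owner = q ∧ ∃ p ∈ S, coarse p ∈ C.cells x}
    ⟨x.owner, hdom x hx, x, hx, rfl, p, hpS, hp⟩
    ⟨x'.owner, hdom x' hx', fun ⟨y, hy, h, r, hr, hr'⟩ => hpS' (hside hy hx' h hr' hp' hr)⟩
  have hinj : Function.Injective (fun z : ((ℤ × ℤ) × Dir) × Bool => C.linkEdge z.1.1 z.2 z.1.2) := by
    rintro ⟨⟨q, d⟩, j⟩ ⟨⟨q', d'⟩, j'⟩ h
    obtain ⟨rfl, rfl, rfl⟩ := C.linkEdge_inj h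
    rfl
  -- Fullness provides connectors on both sides of each positive bond that crosses, and both of its
  -- links cross the cut `S`.
  have hlink : ∀ e ∈ F, 0 < (rep K).bond e.1 e.2 → ∀ j,
      (C.linkEdge e.1 j e.2).1 ∈ S ∧ (C.linkEdge e.1 j e.2).1 + (C.linkEdge e.1 j e.2).2.vec ∉ S ∧
      (C.asm hτ K).bond (C.linkEdge e.1 j e.2).1 (C.linkEdge e.1 j e.2).2 =
        share τ j ((rep K).bond e.1 e.2) := by
    intro e he hpos j
    obtain ⟨t, t', ht, ht', hg, hb⟩ := bond_rep_pos hK.disjoint hpos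
    obtain ⟨g, h1⟩ := hf _ _ hpos j
    obtain ⟨g', h2⟩ := hf (e.1 + e.2.vec) e.2.opp (by rwa [bond_opp]) j
    have e1 := conn_glue (C.compat_of_disjoint (hK.disjoint h1 ht nofun)) rfl rfl
    have e2 := conn_glue (C.compat_of_disjoint (hK.disjoint h2 ht' nofun)) rfl rfl
    subst e1
    subst e2
    rw [← hg] at h2
    obtain ⟨h3, h4, h5⟩ := bond_link hτ hK.disjoint h1 h2
    obtain ⟨⟨y, hy, ho, r, hr, hr'⟩, h6⟩ := hF e he
    refine ⟨hside hy h1 ho hr' h3 hr, fun h => h6 ⟨_, h2, rfl, _, h, h4⟩, by rw [h5, hb]⟩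
  refine hcut ⟨((F.filter fun e => 0 < (rep K).bond e.1 e.2) ×ˢ Finset.univ).map ⟨_, hinj⟩, ?_, ?_⟩
  · intro e he
    obtain ⟨⟨e, j⟩, h, rfl⟩ := Finset.mem_map.1 he
    obtain ⟨he, hpos⟩ := Finset.mem_filter.1 (Finset.mem_product.1 h).1
    exact ⟨(hlink e he hpos j).1, (hlink e he hpos j).2.1⟩
  · rw [Finset.sum_map, Finset.sum_product]
    -- The two links of a bond of strength `s` have total weight `min s τ`, so the truncated sum is
    -- the one to compare with.
    refine (le_sum_min hw).trans ?_
    rw [Finset.sum_filter]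
    refine Finset.sum_le_sum fun e he => ?_
    split_ifs with hpos
    · change _ ≤ ∑ j, (C.asm hτ K).bond (C.linkEdge e.1 j e.2).1 (C.linkEdge e.1 j e.2).2
      rw [Finset.sum_congr rfl fun j _ => (hlink e he hpos j).2.2, Fintype.sum_bool, add_comm,
        share_add_share]
    · simp [Nat.eq_zero_of_not_pos hpos]

open Classical in
/-- The assembly that is represented by a stable configuration is stable. -/
theorem stable_rep (hK : C.IsConfig K) (hs : (C.asm hτ K).Stable τ) : (rep K).Stable τ := by
  rintro S ⟨q, hq, hqS⟩ ⟨q', hq', hqS'⟩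
  obtain ⟨t, ht⟩ := mem_dom_rep.1 hq
  obtain ⟨t', ht'⟩ := mem_dom_rep.1 hq'
  obtain ⟨p, hp⟩ := cells_nonempty C (.body q t)
  obtain ⟨p', hp'⟩ := cells_nonempty C (.body q' t')
  -- The cut of the represented assembly is lifted to the union of the macrotiles owned by `S`.
  obtain ⟨F, hF, hw⟩ := hs {p | ∃ x ∈ K, coarse p ∈ C.cells x ∧ x.owner ∈ S}
    ⟨p, (mem_dom_asm hτ).2 ⟨_, ht, hp⟩, _, ht, hp, hqS⟩
    ⟨p', (mem_dom_asm hτ).2 ⟨_, ht', hp'⟩, by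
      rintro ⟨y, hy, hy', ho⟩
      rw [hK.disjoint.elim_set hy ht' _ hy' hp'] at ho
      exact hqS' ho⟩
  -- Bonds within a piece or between a body and its connectors stay in one macrotile. A crossing
  -- bond is therefore a link, and its weight is a share of a bond of the represented assembly.
  have key : ∀ e : {e // e ∈ F.filter fun e => 0 < (C.asm hτ K).bond e.1 e.2},
      ∃ z : ((ℤ × ℤ) × Dir) × Bool, e.1 = C.linkEdge z.1.1 z.2 z.1.2 ∧
        (C.asm hτ K).bond e.1.1 e.1.2 = share τ z.2 ((rep K).bond z.1.1 z.1.2) ∧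
        z.1.1 ∈ S ∧ z.1.1 + z.1.2.vec ∉ S := by
    rintro ⟨⟨r, d⟩, he⟩
    obtain ⟨he, hpos⟩ := Finset.mem_filter.1 he
    obtain ⟨⟨x, hx, hxr, hxS⟩, h2⟩ := hF _ he
    simp only at hpos hxr h2
    obtain ⟨s, s', -, h3, -, -⟩ := exists_of_bond_pos hpos
    obtain ⟨y, hy, hyr, -⟩ := exists_of_asm_eq hτ h3
    have hyS : y.owner ∉ S := fun h => h2 ⟨y, hy, hyr, h⟩
    have hb := bond_asm hτ hK.disjoint hx hy hxr hyr
    have hne : x ≠ y := fun h => hyS (h ▸ hxS)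
    rw [hb] at hpos
    split_ifs at hpos with hg
    · rw [if_pos hg] at hb
      rcases C.match_cases (hK.disjoint hx hy hne) hxr hyr hg hpos with
        ⟨q, t, d', j, g, ⟨rfl, rfl⟩ | ⟨rfl, rfl⟩⟩ | ⟨q, d', j, g, rfl, rfl, hl, hst⟩
      · exact absurd hxS hyS
      · exact absurd hxS hyS
      · refine ⟨((q, d'), j), hl, ?_, hxS, hyS⟩
        obtain ⟨t1, ht1, hg1⟩ := hK.attached _ _ _ _ hx
        obtain ⟨t2, ht2, hg2⟩ := hK.attached _ _ _ _ hy
        have : (rep K).bond q d' = g.1.strength := by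
          rw [bond_eq_of_some ((rep_eq_some hK.disjoint).2 ht1) ((rep_eq_some hK.disjoint).2 ht2),
            if_pos]
          · rw [hg1]; rfl
          · exact congrArg Subtype.val (hg1.symm.trans hg2)
        rw [this, ← hst]
        exact hb
    · exact absurd hpos (lt_irrefl 0)
  choose f hf using key
  have hinj : Function.Injective f := by
    intro e e' h
    exact Subtype.ext ((hf e).1.trans (h ▸ (hf e').1.symm))
  refine ⟨Finset.univ.image fun e => (f e).1, ?_, ?_⟩
  · intro e he
    obtain ⟨e', -, rfl⟩ := Finset.mem_image.1 he
    exact ⟨(hf e').2.2.1, (hf e').2.2.2⟩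
  · calc τ ≤ ∑ e ∈ F, (C.asm hτ K).bond e.1 e.2 := hw
      _ = ∑ e ∈ F.filter fun e => 0 < (C.asm hτ K).bond e.1 e.2, (C.asm hτ K).bond e.1 e.2 := by
        rw [Finset.sum_filter]
        refine Finset.sum_congr rfl fun e _ => ?_
        split_ifs with h
        · rfl
        · exact Nat.eq_zero_of_not_pos h
      _ = ∑ e : {e // e ∈ F.filter fun e => 0 < (C.asm hτ K).bond e.1 e.2},
          (C.asm hτ K).bond e.1.1 e.1.2 := (Finset.sum_coe_sort _ _).symm
      _ = ∑ e, share τ (f e).2 ((rep K).bond (f e).1.1 (f e).1.2) :=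
        Finset.sum_congr rfl fun e _ => (hf e).2.1
      _ = ∑ z ∈ Finset.univ.image f, share τ z.2 ((rep K).bond z.1.1 z.1.2) := by
        rw [Finset.sum_image fun _ _ _ _ h => hinj h]
      _ ≤ ∑ z ∈ (Finset.univ.image fun e => (f e).1) ×ˢ Finset.univ,
          share τ z.2 ((rep K).bond z.1.1 z.1.2) := by
        refine Finset.sum_le_sum_of_subset fun z hz => ?_
        obtain ⟨e, -, rfl⟩ := Finset.mem_image.1 hz
        exact Finset.mem_product.2 ⟨Finset.mem_image_of_mem _ (Finset.mem_univ e),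
          Finset.mem_univ _⟩
      _ ≤ _ := by
        -- Each edge of the represented assembly has only two links, and their shares add up to at
        -- most its weight.
        rw [Finset.sum_product]
        refine Finset.sum_le_sum fun e _ => ?_
        rw [Fintype.sum_bool, add_comm, share_add_share]
        exact min_le_left _ _

end Coding

theorem Assembly.IsResult.unique {U : Finset TileType} {s : ℕ → Assembly U} {α β : Assembly U}
    (h : Assembly.IsResult s α) (h' : Assembly.IsResult s β) : α = β := by
  have hd : α.dom = β.dom := h.1.trans h'.1.symm
  funext p
  by_cases hp : p ∈ α.dom
  · have hp' := hp
    rw [h.1] at hp'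
    obtain ⟨i, hi⟩ := Set.mem_iUnion.1 hp'
    rw [← h.2 i p hi, h'.2 i p hi]
  · have hp' : p ∉ β.dom := by rwa [← hd]
    rw [Assembly.eq_none_of_not_mem_dom hp, Assembly.eq_none_of_not_mem_dom hp']

open Assembly in
theorem Assembly.Stable.exists_bond {U : Finset TileType} {τ : ℕ} (hτ : 0 < τ) {α β : Assembly U}
    (hs : (α.union β).Stable τ) (hd : Disjoint α.dom β.dom) (hα : α.dom.Nonempty)
    (hβ : β.dom.Nonempty) : ∃ p d, p ∈ α.dom ∧ p + d.vec ∈ β.dom ∧ 0 < (α.union β).bond p d := by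
  obtain ⟨p, hp⟩ := hα
  obtain ⟨q, hq⟩ := hβ
  obtain ⟨F, hF, hw⟩ := hs α.dom ⟨p, by rw [dom_union]; exact ⟨Or.inl hp, hp⟩⟩
    ⟨q, by rw [dom_union]; exact ⟨Or.inr hq, Set.disjoint_right.1 hd hq⟩⟩
  obtain ⟨e, he, hpos⟩ : ∃ e ∈ F, 0 < (α.union β).bond e.1 e.2 := by
    by_contra! hc
    rw [Finset.sum_eq_zero fun e he => Nat.le_zero.1 (hc e he)] at hw
    omega
  obtain ⟨s, t, -, ht, -, -⟩ := exists_of_bond_pos hpos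
  have hmem := mem_dom_of_eq_some ht
  rw [dom_union] at hmem
  exact ⟨e.1, e.2, (hF e he).1, hmem.resolve_left (hF e he).2, hpos⟩

open Assembly Classical in
/-- A tile that can bind on one side only, and not with strength `τ`, does not attach. -/
theorem Assembly.not_stable_of_bond_unique {U : Finset TileType} {τ : ℕ} {α : Assembly U}
    {u v : ℤ × ℤ} (hu : u ∈ α.dom) (hv : v ∈ α.dom) (huv : v ≠ u)
    (h : ∀ d d', 0 < α.bond u d → 0 < α.bond u d' → d = d') (hlt : ∀ d, α.bond u d < τ) :
    ¬ α.Stable τ := by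
  intro hs
  obtain ⟨F, hF, hw⟩ := hs {u} ⟨u, hu, rfl⟩ ⟨v, hv, huv⟩
  by_cases hd : ∃ d, 0 < α.bond u d
  · obtain ⟨d, hd⟩ := hd
    have : ∑ e ∈ F, α.bond e.1 e.2 ≤ α.bond u d := by
      rw [← Finset.sum_filter_add_sum_filter_not F (fun e => e = (u, d))]
      have h1 : ∑ e ∈ F with e = (u, d), α.bond e.1 e.2 ≤ ∑ e ∈ {(u, d)}, α.bond e.1 e.2 :=
        Finset.sum_le_sum_of_subset fun e he => by simp at he ⊢; exact he.2
      have h2 : ∑ e ∈ F with ¬ e = (u, d), α.bond e.1 e.2 = 0 := by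
        refine Finset.sum_eq_zero fun e he => ?_
        obtain ⟨he, hne⟩ := Finset.mem_filter.1 he
        by_contra hb
        have he1 : e.1 = u := (hF e he).1
        refine hne (Prod.ext he1 (h _ _ ?_ hd))
        rw [← he1]
        exact Nat.pos_of_ne_zero hb
      simpa [h2] using h1
    have := hlt d
    omega
  · push Not at hd
    rw [Finset.sum_eq_zero fun e he => ?_] at hw
    · have := hlt .north
      omega
    · have he1 : e.1 = u := (hF e he).1
      rw [he1]
      exact Nat.le_zero.1 (hd _)

namespace Coding

variable {T : Finset TileType} {C : Coding T} {τ : ℕ} (hτ : 2 ≤ τ) {K : Set (Piece T)}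

open Assembly

/-! ### Attachments -/

theorem asm_dom_nonempty (h : K.Nonempty) : (C.asm hτ K).dom.Nonempty := by
  obtain ⟨x, hx⟩ := h
  obtain ⟨p, hp⟩ := cells_nonempty C x
  exact ⟨p, (mem_dom_asm hτ).2 ⟨x, hx, hp⟩⟩

theorem translate_single_dom (t : {t : TileType // t ∈ T}) (u : ℤ × ℤ) :
    ((single t).translate u).dom = {u} := by
  ext p
  by_cases hp : p = u <;> simp [dom, single, Assembly.translate, sub_eq_zero, hp]

/-- Two tiles share only one edge, and its strength is less than τ. -/
theorem single_attach_single (hτ : 2 ≤ τ) {u v : ℤ × ℤ} {s t : {t : TileType // t ∈ universalTiles τ}}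
    (hd : Disjoint ((single s).translate u).dom ((single t).translate v).dom)
    (hs : (((single s).translate u).union ((single t).translate v)).Stable τ) : False := by
  have hlt : ∀ p d, (((single s).translate u).union ((single t).translate v)).bond p d < τ := by
    intro p d
    rcases Nat.eq_zero_or_pos
      ((((single s).translate u).union ((single t).translate v)).bond p d) with h | h
    · rw [h]; omega
    · obtain ⟨s', -, -, -, -, h⟩ := exists_of_bond_pos h
      rw [h]
      exact strength_lt hτ s'.2 d
  rw [translate_single_dom, translate_single_dom, Set.disjoint_singleton] at hd
  have hdom : (((single s).translate u).union ((single t).translate v)).dom = {u} ∪ {v} := by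
    rw [dom_union, translate_single_dom, translate_single_dom]
  refine not_stable_of_bond_unique (u := u) (v := v) ?_ ?_ hd.symm ?_ (hlt u) hs
  · rw [hdom]; exact Or.inl rfl
  · rw [hdom]; exact Or.inr rfl
  · have key : ∀ d, 0 < (((single s).translate u).union ((single t).translate v)).bond u d →
        u + d.vec = v := by
      intro d h
      obtain ⟨-, t', -, ht, -, -⟩ := exists_of_bond_pos h
      have := mem_dom_of_eq_some ht
      rw [hdom] at this
      refine this.resolve_left fun h => ?_
      have : u + d.vec = u := h
      cases d <;> simp [Dir.vec, Prod.ext_iff] at this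
    intro d d' h h'
    exact Dir.vec_injective (add_left_cancel ((key d h).trans (key d' h').symm))

/-- A piece shows the outside only contact glues and the null glue, and a tile has at most one
contact glue. The tile could thus bind on one side only, with strength less than τ. -/
theorem single_attach_asm (hne : K.Nonempty) {u v : ℤ × ℤ}
    {t : {t : TileType // t ∈ universalTiles τ}}
    (hd : Disjoint ((single t).translate u).dom ((C.asm hτ K).translate v).dom)
    (hs : (((single t).translate u).union ((C.asm hτ K).translate v)).Stable τ) : False := by
  obtain ⟨q, hq⟩ := asm_dom_nonempty (C := C) hτ hne
  have hu : u ∈ ((single t).translate u).dom := by rw [translate_single_dom]; rfl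
  have hq' : q + v ∈ ((C.asm hτ K).translate v).dom := by
    rw [mem_dom_translate, add_sub_cancel_right]; exact hq
  refine not_stable_of_bond_unique (u := u) (v := q + v) (by rw [dom_union]; exact Or.inl hu)
    (by rw [dom_union]; exact Or.inr hq') ?_ ?_ ?_ hs
  · rintro rfl
    exact Set.disjoint_left.1 hd hu hq'
  · have key : ∀ d, 0 < (((single t).translate u).union ((C.asm hτ K).translate v)).bond u d →
        ∃ l s, t.1.glue d = contactGlue l s := by
      intro d h
      obtain ⟨t1, t2, h1, h2, h3, h4⟩ := exists_of_bond_pos h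
      rw [h4, h3] at h
      rw [union_apply_left hu] at h1
      obtain rfl : t1 = t := by simpa [Assembly.translate, single, eq_comm] using h1
      have hu' : u + d.vec ∉ ((single t1).translate u).dom := by
        rw [translate_single_dom]
        intro h
        have : u + d.vec = u := h
        cases d <;> simp [Dir.vec, Prod.ext_iff] at this
      rw [union_apply_right hu'] at h2
      obtain ⟨x, hx, hp, htile⟩ := exists_of_asm_eq (C := C) hτ h2
      have hnot : coarse (u + d.vec - v + d.opp.vec) ∉ C.cells x := by
        intro hc
        refine Set.disjoint_left.1 hd hu ?_
        rw [mem_dom_translate]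
        refine (mem_dom_asm hτ).2 ⟨x, hx, ?_⟩
        rwa [Dir.vec_opp, show u + d.vec - v + -d.vec = u - v by abel] at hc
      have hg : t2.1.glue d.opp = C.contactAt τ x (u + d.vec - v) d.opp := by
        rw [htile]
        change C.glueAt τ x _ _ = _
        rw [glueAt, if_neg fun hc => hnot (by rwa [hc]), if_neg hnot]
      rw [h3, hg]
      rcases C.contactAt_cases (τ := τ) x (u + d.vec - v) d.opp with h' | ⟨b, k, e, -, -, -, h'⟩
      · rw [hg, h'] at h
        exact absurd h (lt_irrefl 0)
      · exact ⟨_, _, h'⟩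
    intro d d' h h'
    obtain ⟨l, s, h⟩ := key d h
    obtain ⟨l', s', h'⟩ := key d' h'
    exact contact_unique t.2 h h'
  · intro d
    rcases Nat.eq_zero_or_pos
      ((((single t).translate u).union ((C.asm hτ K).translate v)).bond u d) with h | h
    · rw [h]; omega
    · obtain ⟨s', -, -, -, -, h⟩ := exists_of_bond_pos h
      rw [h]
      exact strength_lt hτ s'.2 d

open Classical in
/-- A connector is part of a larger stable assembly only together with its body. -/
theorem exists_body (hK : K.PairwiseDisjoint C.cells) (hs : (C.asm hτ K).Stable τ) {q d j g}
    (hc : .conn q d j g ∈ K) {x : Piece T} (hx : x ∈ K) (hxc : x ≠ .conn q d j g) :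
    ∃ t, .body q t ∈ K ∧ g = glueOf t d := by
  by_contra hno
  push Not at hno
  obtain ⟨p, hp⟩ := cells_nonempty C (.conn q d j g)
  obtain ⟨p', hp'⟩ := cells_nonempty C x
  obtain ⟨F, hF, hw⟩ := hs {p | coarse p ∈ C.cells (.conn q d j g)}
    ⟨p, (mem_dom_asm hτ).2 ⟨_, hc, hp⟩, hp⟩
    ⟨p', (mem_dom_asm hτ).2 ⟨_, hx, hp'⟩, fun h => hxc (hK.elim_set hx hc _ hp' h)⟩
  have key : ∀ e ∈ F, 0 < (C.asm hτ K).bond e.1 e.2 → e = C.linkEdge q j d ∧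
      (C.asm hτ K).bond e.1 e.2 ≤ half τ := by
    rintro ⟨r, d'⟩ he hpos
    obtain ⟨h1, h2⟩ := hF _ he
    simp only [Set.mem_ofPred_eq] at h1 h2 hpos ⊢
    obtain ⟨s, s', -, h3, -, -⟩ := exists_of_bond_pos hpos
    obtain ⟨y, hy, hyr, -⟩ := exists_of_asm_eq hτ h3
    have hne : Piece.conn q d j g ≠ y := by
      rintro rfl
      exact h2 hyr
    have hd := hK hc hy hne
    have hb := bond_asm hτ hK hc hy h1 hyr
    rw [hb] at hpos ⊢
    split_ifs at hpos ⊢ with hg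
    · rcases C.match_cases hd h1 hyr hg hpos with
        ⟨q', t, d'', j', g', ⟨h, -⟩ | ⟨h, rfl⟩⟩ | ⟨q', d'', j', g', h, -, hl, hst⟩
      · cases h
      · cases h
        exact absurd (conn_glue (C.compat_of_disjoint hd) rfl rfl) (hno t hy)
      · cases h
        exact ⟨hl, hst ▸ share_le_half _ _ _⟩
    · exact absurd hpos (lt_irrefl 0)
  have hlt := half_lt hτ
  have : ∑ e ∈ F, (C.asm hτ K).bond e.1 e.2 ≤ half τ := by
    by_cases hF' : ∃ e ∈ F, 0 < (C.asm hτ K).bond e.1 e.2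
    · obtain ⟨e, he, hpos⟩ := hF'
      obtain ⟨h1, h2⟩ := key e he hpos
      rw [Finset.sum_eq_single_of_mem e he]
      · exact h2
      · intro e' he' hne
        by_contra hb
        exact hne ((key e' he' (Nat.pos_of_ne_zero hb)).1.trans h1.symm)
    · push Not at hF'
      rw [Finset.sum_eq_zero fun e he => Nat.le_zero.1 (hF' e he)]
      exact Nat.zero_le _
  omega

theorem rep_shift (hK : K.PairwiseDisjoint C.cells) (w : ℤ × ℤ) :
    rep (Piece.shift w '' K) = (rep K).translate w := by
  have hK' := C.pairwiseDisjoint_shift w hK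
  funext q
  have key : ∀ t, rep (Piece.shift w '' K) q = some t ↔ (rep K).translate w q = some t := by
    intro t
    rw [rep_eq_some hK']
    change _ ↔ rep K (q - w) = some t
    rw [rep_eq_some hK]
    constructor
    · rintro ⟨x, hx, h⟩
      rcases x with ⟨q', t'⟩ | ⟨q', d, j, g⟩
      · obtain ⟨rfl, rfl⟩ := Piece.body.inj h
        rwa [add_sub_cancel_right]
      · cases h
    · exact fun h => ⟨_, h, by simp [Piece.shift]⟩
  exact Option.ext key

theorem rep_union {K' : Set (Piece T)} (hK : (K ∪ K').PairwiseDisjoint C.cells) :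
    rep (K ∪ K') = (rep K).union (rep K') := by
  have h1 := hK.subset Set.subset_union_left
  have h2 := hK.subset Set.subset_union_right
  funext q
  by_cases h : q ∈ (rep K).dom
  · rw [union_apply_left h]
    obtain ⟨t, ht⟩ := mem_dom_rep.1 h
    rw [(rep_eq_some h1).2 ht, (rep_eq_some hK).2 (Or.inl ht)]
  · rw [union_apply_right h]
    refine Option.ext fun t => ?_
    rw [rep_eq_some hK, rep_eq_some h2]
    refine ⟨fun h' => h'.resolve_left fun h' => h (mem_dom_rep.2 ⟨t, h'⟩), Or.inr⟩

theorem disjoint_rep {K' : Set (Piece T)} (hK : (K ∪ K').PairwiseDisjoint C.cells)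
    (h : Disjoint K K') : Disjoint (rep K).dom (rep K').dom := by
  refine Set.disjoint_left.2 fun q hq hq' => ?_
  obtain ⟨t, ht⟩ := mem_dom_rep.1 hq
  obtain ⟨t', ht'⟩ := mem_dom_rep.1 hq'
  have : t = t' := Option.some.inj
    (((rep_eq_some hK).2 (Or.inl ht)).symm.trans ((rep_eq_some hK).2 (Or.inr ht')))
  subst this
  exact Set.disjoint_left.1 h ht ht'

/-- If two assemblies that consist of pieces bind to each other then their blocks are aligned, and
the result is a configuration. -/
theorem attach_asm {K' : Set (Piece T)} (hK : K.PairwiseDisjoint C.cells) (hne : K.Nonempty)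
    (hK' : K'.PairwiseDisjoint C.cells) (hne' : K'.Nonempty) {u v : ℤ × ℤ}
    (hd : Disjoint ((C.asm hτ K).translate u).dom ((C.asm hτ K').translate v).dom)
    (hs : (((C.asm hτ K).translate u).union ((C.asm hτ K').translate v)).Stable τ) :
    ∃ w, C.IsConfig (K ∪ Piece.shift w '' K') ∧ Disjoint K (Piece.shift w '' K') ∧
      ((C.asm hτ K).translate u).union ((C.asm hτ K').translate v) =
        (C.asm hτ (K ∪ Piece.shift w '' K')).translate u ∧
      (rep (K ∪ Piece.shift w '' K')).Stable τ := by
  have hn : ∀ {L : Set (Piece T)} {r}, L.Nonempty → ((C.asm hτ L).translate r).dom.Nonempty := by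
    intro L r hL
    obtain ⟨p, hp⟩ := asm_dom_nonempty (C := C) hτ hL
    exact ⟨p + r, by rw [mem_dom_translate, add_sub_cancel_right]; exact hp⟩
  obtain ⟨p, d, hp, hp', hpos⟩ := hs.exists_bond (by omega) hd (hn hne) (hn hne')
  obtain ⟨s, t, h1, h2, h3, h4⟩ := exists_of_bond_pos hpos
  rw [union_apply_left hp] at h1
  rw [union_apply_right (Set.disjoint_right.1 hd hp')] at h2
  rw [h4] at hpos
  obtain ⟨x, hx, hxp, hxt⟩ := exists_of_asm_eq (C := C) hτ h1
  obtain ⟨y, hy, hyp, hyt⟩ := exists_of_asm_eq (C := C) hτ h2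
  rw [hxt] at hpos
  rw [hxt, hyt] at h3
  -- One bond between the two assemblies is enough to align their block grids.
  obtain ⟨b, b', k, e, -, -, -, hal, -⟩ := C.spots_of_match (τ := τ) (p := p - u)
    (p' := p + d.vec - v) hxp
    (fun h => Set.disjoint_right.1 hd hp' (by
      rw [mem_dom_translate]
      refine (mem_dom_asm hτ).2 ⟨x, hx, ?_⟩
      rwa [show p + d.vec - u = p - u + d.vec by abel])) hyp
    (fun h => Set.disjoint_left.1 hd hp (by
      rw [mem_dom_translate]
      refine (mem_dom_asm hτ).2 ⟨y, hy, ?_⟩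
      rwa [show p - v = p + d.vec - v - d.vec by abel])) h3 hpos
  have hv : v = (2 : ℤ) • C.size • (b - b') + u := by
    have : v = p + d.vec - (p + d.vec - v) := by abel
    rw [this, hal]
    simp only [smul_sub]
    abel
  have hsh := C.pairwiseDisjoint_shift (b - b') hK'
  have he : (C.asm hτ K').translate v =
      (C.asm hτ (Piece.shift (b - b') '' K')).translate u := by
    rw [asm_shift hτ _ hK', translate_translate, ← hv]
  rw [he] at hd hs ⊢
  have hd' : Disjoint (C.asm hτ K).dom (C.asm hτ (Piece.shift (b - b') '' K')).dom := by
    simpa [translate_translate] using disjoint_dom_translate (-u) hd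
  have hun := pairwiseDisjoint_union hτ hK hsh hd'
  rw [← translate_union, ← asm_union hτ hun, stable_translate_iff] at hs
  have hdis : Disjoint K (Piece.shift (b - b') '' K') := by
    refine Set.disjoint_left.2 fun x hx hx' => ?_
    obtain ⟨p, hp⟩ := cells_nonempty C x
    exact Set.disjoint_left.1 hd' ((mem_dom_asm hτ).2 ⟨x, hx, hp⟩) ((mem_dom_asm hτ).2 ⟨x, hx', hp⟩)
  -- The union contains a piece other than any given connector, so `exists_body` supplies the body
  -- of every connector.
  have hcfg : C.IsConfig (K ∪ Piece.shift (b - b') '' K') := by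
    refine ⟨hun, fun q d j g hc => ?_⟩
    obtain ⟨x, hx⟩ := hne
    obtain ⟨y, hy⟩ := hne'.image (Piece.shift (b - b'))
    have hxy : x ≠ y := fun h => Set.disjoint_left.1 hdis hx (h ▸ hy)
    by_cases hxc : x = .conn q d j g
    · exact exists_body hτ hun hs hc (Or.inr hy) (hxc ▸ hxy.symm)
    · exact exists_body hτ hun hs hc (Or.inl hx) hxc
  exact ⟨b - b', hcfg, hdis, by rw [← translate_union, ← asm_union hτ hun],
    stable_rep hτ hcfg hs⟩

/-! ### The supertiles of the simulating system -/

variable (C) in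
/-- The supertiles of the simulating system: single tiles, single connectors, and configurations
that represent supertiles with the property `P`. -/
def Good (P : Supertile T → Prop) (a : Supertile (universalTiles τ)) : Prop :=
  a ∈ singletons (universalTiles τ) ∨
  (∃ q d j g, a = toSupertile (C.asm hτ {.conn q d j g})) ∨
  ∃ K, C.IsConfig K ∧ K.Nonempty ∧ P (toSupertile (rep K)) ∧ a = toSupertile (C.asm hτ K)

theorem rep_conn (q d j g) : rep ({.conn q d j g} : Set (Piece T)) = fun _ => none := by
  funext q'
  rw [rep, dif_neg]
  rintro ⟨t, h⟩
  cases h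

theorem union_none (α : Assembly T) : α.union (fun _ => none) = α := by
  funext p
  simp [union]

theorem not_stable_single {P : Supertile T → Prop} {t : {t : TileType // t ∈ universalTiles τ}}
    {u : ℤ × ℤ} {β : Assembly (universalTiles τ)} (hβ : C.Good hτ P (toSupertile β))
    (hd : Disjoint ((single t).translate u).dom β.dom) :
    ¬ (((single t).translate u).union β).Stable τ := by
  intro hs
  rcases hβ with ⟨t', h⟩ | ⟨q, d, j, g, h⟩ | ⟨K, hK, hne, -, h⟩
  · obtain ⟨v, rfl⟩ := toSupertile_eq_iff.1 h
    exact single_attach_single hτ hd hs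
  · obtain ⟨v, rfl⟩ := toSupertile_eq_iff.1 h.symm
    exact single_attach_asm hτ (Set.singleton_nonempty _) hd hs
  · obtain ⟨v, rfl⟩ := toSupertile_eq_iff.1 h.symm
    exact single_attach_asm hτ hne hd hs

/-- An attached connector leaves the represented assembly unchanged, and an attached configuration
adds what it represents. These are the two cases of `StepLE`. -/
theorem attach_config {P : Supertile T → Prop} (hK : C.IsConfig K) (hne : K.Nonempty) {u : ℤ × ℤ}
    {β : Assembly (universalTiles τ)} (hβ : C.Good hτ P (toSupertile β))
    (hd : Disjoint ((C.asm hτ K).translate u).dom β.dom)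
    (hs : (((C.asm hτ K).translate u).union β).Stable τ) :
    ∃ K', K ⊆ K' ∧ C.IsConfig K' ∧
      ((C.asm hτ K).translate u).union β = (C.asm hτ K').translate u ∧
      (rep K' = rep K ∨ ∃ γ, P (toSupertile γ) ∧ Disjoint (rep K).dom γ.dom ∧
        rep K' = (rep K).union γ ∧ (rep K').Stable τ) := by
  rcases hβ with ⟨t', h⟩ | ⟨q, d, j, g, h⟩ | ⟨K', hK', hne', hP, h⟩
  · obtain ⟨v, rfl⟩ := toSupertile_eq_iff.1 h
    rw [union_comm_of_disjoint hd] at hs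
    exact (single_attach_asm hτ hne hd.symm hs).elim
  · obtain ⟨v, rfl⟩ := toSupertile_eq_iff.1 h.symm
    obtain ⟨w, h1, h2, h3, h4⟩ := attach_asm hτ hK.disjoint hne (Set.pairwiseDisjoint_singleton _ _)
      ⟨_, rfl⟩ hd hs
    refine ⟨_, Set.subset_union_left, h1, h3, Or.inl ?_⟩
    rw [rep_union h1.disjoint, Set.image_singleton]
    exact (congrArg _ (rep_conn _ _ _ _)).trans (union_none _)
  · obtain ⟨v, rfl⟩ := toSupertile_eq_iff.1 h.symm
    obtain ⟨w, h1, h2, h3, h4⟩ := attach_asm hτ hK.disjoint hne hK'.disjoint hne' hd hs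
    refine ⟨_, Set.subset_union_left, h1, h3, Or.inr ⟨_, ?_, disjoint_rep h1.disjoint h2,
      rep_union h1.disjoint, h4⟩⟩
    rwa [rep_shift hK'.disjoint, toSupertile_translate]

/-- Two connectors do not bind to each other, as neither has a body. The partner is therefore a
configuration, and the connector adds nothing to what it represents. -/
theorem attach_conn {P : Supertile T → Prop} {u : ℤ × ℤ} {q d j g}
    {β : Assembly (universalTiles τ)} (hβ : C.Good hτ P (toSupertile β))
    (hd : Disjoint ((C.asm hτ {.conn q d j g}).translate u).dom β.dom)
    (hs : (((C.asm hτ {.conn q d j g}).translate u).union β).Stable τ) :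
    ∃ K', C.IsConfig K' ∧ K'.Nonempty ∧ P (toSupertile (rep K')) ∧
      ((C.asm hτ {.conn q d j g}).translate u).union β = (C.asm hτ K').translate u := by
  rcases hβ with ⟨t', h⟩ | ⟨q', d', j', g', h⟩ | ⟨K', hK', hne', hP, h⟩
  · obtain ⟨v, rfl⟩ := toSupertile_eq_iff.1 h
    rw [union_comm_of_disjoint hd] at hs
    exact (single_attach_asm hτ (Set.singleton_nonempty _) hd.symm hs).elim
  · obtain ⟨v, rfl⟩ := toSupertile_eq_iff.1 h.symm
    obtain ⟨w, h1, h2, h3, h4⟩ := attach_asm hτ (Set.pairwiseDisjoint_singleton _ _) ⟨_, rfl⟩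
      (Set.pairwiseDisjoint_singleton _ _) ⟨_, rfl⟩ hd hs
    obtain ⟨t, ht | ⟨x, hx, ht⟩, -⟩ := h1.attached q d j g (Or.inl rfl)
    · cases ht
    · rw [Set.mem_singleton_iff] at hx
      subst hx
      cases ht
  · obtain ⟨v, rfl⟩ := toSupertile_eq_iff.1 h.symm
    obtain ⟨w, h1, h2, h3, h4⟩ := attach_asm hτ (Set.pairwiseDisjoint_singleton _ _) ⟨_, rfl⟩
      hK'.disjoint hne' hd hs
    refine ⟨_, h1, ⟨_, Or.inl rfl⟩, ?_, h3⟩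
    have : rep ({.conn q d j g} ∪ Piece.shift w '' K') = (rep K').translate w := by
      rw [rep_union h1.disjoint, rep_conn, rep_shift hK'.disjoint]
      rfl
    rwa [this, toSupertile_translate]

end Coding

theorem Assembly.IsResult.shift {U : Finset TileType} {s : ℕ → Assembly U} {α : Assembly U}
    (h : Assembly.IsResult s α) (hs : ∀ {i j}, i ≤ j → (s i).Sub (s j)) (k : ℕ) :
    Assembly.IsResult (fun i => s (k + i)) α := by
  refine ⟨?_, fun i => h.2 _⟩
  rw [h.1]
  ext p
  simp only [Set.mem_iUnion]
  exact ⟨fun ⟨i, hi⟩ => ⟨i, (hs (Nat.le_add_left i k)).mem_dom hi⟩, fun ⟨i, hi⟩ => ⟨k + i, hi⟩⟩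

theorem Assembly.IsResult.translate {U : Finset TileType} {s : ℕ → Assembly U} {α : Assembly U}
    (h : Assembly.IsResult s α) (u : ℤ × ℤ) :
    Assembly.IsResult (fun i => (s i).translate u) (α.translate u) := by
  refine ⟨?_, fun i p hp => h.2 i (p - u) (Assembly.mem_dom_translate.1 hp)⟩
  ext p
  rw [Assembly.mem_dom_translate, h.1]
  simp only [Set.mem_iUnion, Assembly.mem_dom_translate]

theorem TAS.IsSequence.occurs {τ : ℕ} {𝒯 : TAS τ} {P : Supertile 𝒯.tiles → Prop}
    {s : ℕ → Assembly 𝒯.tiles} (hP : ∀ a, P a → 𝒯.Occurs a) (hs : 𝒯.IsSequence P s)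
    (h0 : 𝒯.Occurs (toSupertile (s 0))) (i : ℕ) : 𝒯.Occurs (toSupertile (s i)) := by
  induction i with
  | zero => exact h0
  | succ i ih =>
    rcases hs i with h | ⟨β, hβ, hd, h, hst⟩
    · rwa [h]
    · exact ih.attach (hP _ hβ) ⟨s i, β, rfl, rfl, hd, h ▸ hst, h ▸ rfl⟩

namespace Coding

variable {τ : ℕ} (hτ : 2 ≤ τ) {𝒯 : TAS τ} {C : Coding 𝒯.tiles} {K : Set (Piece 𝒯.tiles)}

open Assembly

theorem Good.mono {P Q : Supertile 𝒯.tiles → Prop} (h : ∀ a, P a → Q a)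
    {a : Supertile (universalTiles τ)} (ha : C.Good hτ P a) : C.Good hτ Q a :=
  ha.imp_right (Or.imp_right fun ⟨K, h1, h2, h3, h4⟩ => ⟨K, h1, h2, h _ h3, h4⟩)

theorem rep_isResult {K : ℕ → Set (Piece 𝒯.tiles)}
    (h : (⋃ i, K i).PairwiseDisjoint C.cells) :
    IsResult (fun i => rep (K i)) (rep (⋃ i, K i)) := by
  have hi := fun i => h.subset (Set.subset_iUnion K i)
  refine ⟨?_, fun i q hq => ?_⟩
  · ext q
    simp only [mem_dom_rep, Set.mem_iUnion]
    exact ⟨fun ⟨t, i, h⟩ => ⟨i, t, h⟩, fun ⟨i, t, h⟩ => ⟨t, i, h⟩⟩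
  · obtain ⟨t, ht⟩ := mem_dom_rep.1 hq
    exact ((rep_eq_some (hi i)).2 ht).trans ((rep_eq_some h).2 (Set.mem_iUnion_of_mem i ht)).symm

theorem asm_isResult {K : ℕ → Set (Piece 𝒯.tiles)}
    (h : (⋃ i, K i).PairwiseDisjoint C.cells) :
    IsResult (fun i => C.asm hτ (K i)) (C.asm hτ (⋃ i, K i)) := by
  refine ⟨?_, fun i => asm_sub hτ h (Set.subset_iUnion K i)⟩
  ext q
  simp only [mem_dom_asm, Set.mem_iUnion]
  exact ⟨fun ⟨t, ⟨i, h⟩, h'⟩ => ⟨i, t, h, h'⟩, fun ⟨i, t, h, h'⟩ => ⟨t, ⟨i, h⟩, h'⟩⟩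

theorem isConfig_iUnion {K : ℕ → Set (Piece 𝒯.tiles)} (hK : ∀ i, C.IsConfig (K i))
    (hm : Monotone K) : C.IsConfig (⋃ i, K i) := by
  refine ⟨fun x hx y hy hxy => ?_, fun q d j g h => ?_⟩
  · obtain ⟨i, hi⟩ := Set.mem_iUnion.1 hx
    obtain ⟨j, hj⟩ := Set.mem_iUnion.1 hy
    exact (hK (max i j)).disjoint (hm (le_max_left i j) hi) (hm (le_max_right i j) hj) hxy
  · obtain ⟨i, hi⟩ := Set.mem_iUnion.1 h
    obtain ⟨t, ht, hg⟩ := (hK i).attached q d j g hi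
    exact ⟨t, Set.mem_iUnion_of_mem i ht, hg⟩

/-! ### Soundness: the shape of producible supertiles -/

section Soundness

variable {I : Set (Supertile (universalTiles τ))} {hI : ∀ a ∈ I, IsInput τ a}

variable (C I) in
/-- The supertiles in `I` are single connectors and configurations that represent supertiles of
the initial state of the simulated system. -/
def InputsOf : Prop :=
  ∀ a ∈ I, (∃ q d j g, a = toSupertile (C.asm hτ {.conn q d j g})) ∨
    ∃ K, C.IsConfig K ∧ K.Nonempty ∧ toSupertile (rep K) ∈ 𝒯.initial ∧ a = toSupertile (C.asm hτ K)

theorem Good.attach {a b c : Supertile (universalTiles τ)} (ha : C.Good hτ 𝒯.Occurs a)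
    (hb : C.Good hτ 𝒯.Occurs b) (hc : Combines τ a b c) : C.Good hτ 𝒯.Occurs c := by
  obtain ⟨α, β, rfl, rfl, hd, hs, rfl⟩ := hc
  rcases ha with ⟨t, h⟩ | ⟨q, d, j, g, h⟩ | ⟨K, hK, hne, hP, h⟩
  · obtain ⟨u, rfl⟩ := toSupertile_eq_iff.1 h
    exact (not_stable_single hτ hb hd hs).elim
  · obtain ⟨u, rfl⟩ := toSupertile_eq_iff.1 h.symm
    obtain ⟨K', h1, h2, h3, h4⟩ := attach_conn hτ hb hd hs
    exact Or.inr (Or.inr ⟨K', h1, h2, h3, by rw [h4, toSupertile_translate]⟩)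
  · obtain ⟨u, rfl⟩ := toSupertile_eq_iff.1 h.symm
    obtain ⟨K', h1, h2, h3, h4⟩ := attach_config hτ hK hne hb hd hs
    refine Or.inr (Or.inr ⟨K', h2, hne.mono h1, ?_, by rw [h3, toSupertile_translate]⟩)
    rcases h4 with h4 | ⟨γ, h5, h6, h7, h8⟩
    · rwa [h4]
    · exact hP.attach h5 ⟨_, _, rfl, rfl, h6, h7 ▸ h8, h7 ▸ rfl⟩

theorem good_of_occurs (hin : C.InputsOf hτ I) {a : Supertile (universalTiles τ)}
    (ha : (inputSystem τ (universalTiles τ) I hI).Occurs a) : C.Good hτ 𝒯.Occurs a := by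
  have key : ∀ {b : Supertile (inputSystem τ (universalTiles τ) I hI).tiles},
      (inputSystem τ (universalTiles τ) I hI).Occurs b → C.Good hτ 𝒯.Occurs b := by
    intro b hb
    induction hb with
    | start h =>
      rcases h with h | h
      · exact Or.inl h
      · rcases hin _ h with h | ⟨K, h1, h2, h3, h4⟩
        · exact Or.inr (Or.inl h)
        · exact Or.inr (Or.inr ⟨K, h1, h2, .start h3, h4⟩)
    | attach _ _ hc iha ihb => exact iha.attach hτ ihb hc
  exact key ha

/-- The stages of the sequence are given by increasing sets of pieces in one fixed translation.
Their union gives the limit, and the represented assemblies form an assembly sequence of the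
simulated system. -/
theorem good_of_sequence (hin : C.InputsOf hτ I) {s : ℕ → Assembly (universalTiles τ)}
    {α : Assembly (universalTiles τ)}
    (hs : (inputSystem τ (universalTiles τ) I hI).IsSequence
      (inputSystem τ (universalTiles τ) I hI).Occurs s) (hα : IsResult s α) (hK : C.IsConfig K)
    (hne : K.Nonempty) (hP : 𝒯.Occurs (toSupertile (rep K))) {u : ℤ × ℤ}
    (h0 : s 0 = (C.asm hτ K).translate u) :
    C.Good hτ 𝒯.Producible (toSupertile α) := by
  let X := {x : ℕ × Set (Piece 𝒯.tiles) // C.IsConfig x.2 ∧ x.2.Nonempty ∧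
    s x.1 = (C.asm hτ x.2).translate u}
  have step : ∀ x : X, ∃ y : X, y.1.1 = x.1.1 + 1 ∧ x.1.2 ⊆ y.1.2 ∧
      (rep y.1.2 = rep x.1.2 ∨ ∃ γ, 𝒯.Occurs (toSupertile γ) ∧ Disjoint (rep x.1.2).dom γ.dom ∧
        rep y.1.2 = (rep x.1.2).union γ ∧ (rep y.1.2).Stable τ) := by
    rintro ⟨⟨i, K⟩, hK, hne, hi⟩
    rcases hs i with h | ⟨β, hβ, hd, h, hst⟩
    · exact ⟨⟨⟨i + 1, K⟩, hK, hne, h.trans hi⟩, rfl, subset_rfl, Or.inl rfl⟩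
    · dsimp only at hi
      rw [h] at hst
      rw [hi] at hd h hst
      obtain ⟨K', h1, h2, h3, h4⟩ := attach_config hτ hK hne (good_of_occurs hτ hin hβ) hd hst
      exact ⟨⟨⟨i + 1, K'⟩, h2, hne.mono h1, h.trans h3⟩, rfl, h1, h4⟩
  choose f hf1 hf2 hf3 using step
  let x : ℕ → X := fun i => f^[i] ⟨⟨0, K⟩, hK, hne, h0⟩
  have hx : ∀ i, x (i + 1) = f (x i) := fun i => Function.iterate_succ_apply' f i _
  have hx1 : ∀ i, (x i).1.1 = i := by
    intro i
    induction i with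
    | zero => rfl
    | succ i ih => rw [hx, hf1, ih]
  have hm : Monotone fun i => (x i).1.2 := monotone_nat_of_le_succ fun i => by
    rw [hx]; exact hf2 _
  have hcfg := isConfig_iUnion (fun i => (x i).2.1) hm
  refine Or.inr (Or.inr ⟨_, hcfg, (x 0).2.2.1.mono (Set.subset_iUnion (fun i => (x i).1.2) 0),
    ?_, ?_⟩)
  · refine TAS.producible_of_sequence (s := fun i => rep (x i).1.2) hP (fun i => ?_)
      (rep_isResult hcfg.disjoint)
    dsimp only
    rw [hx]
    exact hf3 _
  · have h1 := (asm_isResult hτ hcfg.disjoint).translate u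
    have h2 : (fun i => (C.asm hτ (x i).1.2).translate u) = s := by
      funext i
      rw [← (x i).2.2.2, hx1]
    rw [h2] at h1
    rw [hα.unique h1, toSupertile_translate]

/-- If some stage is a configuration of the required kind, the rest of the sequence is covered by
`good_of_sequence`. Otherwise the sequence is constant: a single tile never attaches, and a
connector would become a configuration with its first attachment. -/
theorem good_of_producible (hin : C.InputsOf hτ I) {a : Supertile (universalTiles τ)}
    (ha : (inputSystem τ (universalTiles τ) I hI).Producible a) : C.Good hτ 𝒯.Producible a := by
  obtain ⟨s, α, h0, hs, hα, rfl⟩ := ha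
  have hoc := hs.occurs (fun _ => id) (.start h0)
  by_cases hex : ∃ i K u, C.IsConfig K ∧ K.Nonempty ∧ 𝒯.Occurs (toSupertile (rep K)) ∧
      s i = (C.asm hτ K).translate u
  · obtain ⟨i, K, u, h1, h2, h3, h4⟩ := hex
    exact good_of_sequence hτ hin (hI := hI) (s := fun k => s (i + k)) (fun k => hs (i + k))
      (hα.shift hs.sub i) h1 h2 h3 h4
  · have hconst : ∀ i, s i = s 0 := by
      intro i
      induction i with
      | zero => rfl
      | succ i ih =>
        rcases hs i with h | ⟨β, hβ, hd, h, hst⟩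
        · exact h.trans ih
        · exfalso
          rw [h] at hst
          rcases good_of_occurs hτ hin (hoc i) with ⟨t, h'⟩ | ⟨q, d, j, g, h'⟩ | ⟨K, hK, hne, hP, h'⟩
          · obtain ⟨u, hu⟩ := toSupertile_eq_iff.1 h'
            rw [← hu] at hd hst
            exact not_stable_single hτ (good_of_occurs hτ hin hβ) hd hst
          · obtain ⟨u, hu⟩ := toSupertile_eq_iff.1 h'.symm
            rw [← hu] at hd hst
            obtain ⟨K', h1, h2, h3, h4⟩ := attach_conn hτ (good_of_occurs hτ hin hβ) hd hst
            exact hex ⟨i + 1, K', u, h1, h2, h3, by rw [h, ← hu]; exact h4⟩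
          · obtain ⟨u, hu⟩ := toSupertile_eq_iff.1 h'.symm
            exact hex ⟨i, K, u, hK, hne, hP, hu.symm⟩
    have h1 : s = fun _ => s 0 := funext hconst
    rw [h1] at hα
    rw [hα.unique (TAS.isResult_const (𝒯 := inputSystem τ (universalTiles τ) I hI) (s 0))]
    exact (good_of_occurs hτ hin (hoc 0)).mono hτ fun _ => TAS.Occurs.producible

end Soundness

end Coding

namespace Coding

section Config

variable {T : Finset TileType} {C : Coding T} {K : Set (Piece T)}

open Assembly

variable (K) in
/-- A set of pieces in which each block has at most one body, each connector belongs to a body, and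
connectors that face each other agree. -/
structure IsLayout : Prop where
  unique : ∀ q t t', Piece.body q t ∈ K → .body q t' ∈ K → t = t'
  attached : ∀ q d j g, Piece.conn q d j g ∈ K → ∃ t, .body q t ∈ K ∧ g = glueOf t d
  agree : ∀ q d j g g', Piece.conn q d j g ∈ K → .conn (q + d.vec) d.opp j g' ∈ K → g = g'

theorem IsLayout.slot (h : IsLayout K) {x y : Piece T} (hx : x ∈ K) (hy : y ∈ K) {ax b a g a' g'}
    (hs : x.Slot ax b a g) (hs' : y.Slot ax b a' g') :
    (a = a' → x = y) ∧ (a' = a + 1 → g = g') := by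
  rcases x with ⟨q, t⟩ | ⟨q, d, j, g0⟩ <;> rcases y with ⟨q', t'⟩ | ⟨q', d', j', g0'⟩
  · rcases hs with ⟨rfl, ha, rfl⟩ | ⟨rfl, ha, rfl⟩ <;>
      rcases hs' with ⟨rfl, ha', rfl⟩ | ⟨rfl, ha', rfl⟩ <;>
      refine ⟨fun h1 => ?_, fun h1 => by omega⟩ <;>
      first | (exfalso; omega) | rw [h.unique _ _ _ hx hy]
  · obtain ⟨t'', ht'', rfl⟩ := h.attached _ _ _ _ hy
    rcases hs with ⟨rfl, ha, rfl⟩ | ⟨rfl, ha, rfl⟩ <;>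
      obtain ⟨rfl, ⟨rfl, rfl, ha'⟩ | ⟨rfl, rfl, ha'⟩⟩ := hs' <;>
      cases j' <;> simp only [if_true, if_false, Bool.false_eq_true] at ha' <;>
      refine ⟨fun h1 => by omega, fun h1 => ?_⟩ <;>
      first | (exfalso; omega) | rw [h.unique _ _ _ hx ht'']
  · obtain ⟨t'', ht'', rfl⟩ := h.attached _ _ _ _ hx
    rcases hs' with ⟨rfl, ha, rfl⟩ | ⟨rfl, ha, rfl⟩ <;>
      obtain ⟨rfl, ⟨rfl, rfl, ha'⟩ | ⟨rfl, rfl, ha'⟩⟩ := hs <;>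
      cases j <;> simp only [if_true, if_false, Bool.false_eq_true] at ha' <;>
      refine ⟨fun h1 => by omega, fun h1 => ?_⟩ <;>
      first | (exfalso; omega) | rw [h.unique _ _ _ hy ht'']
  · obtain ⟨rfl, ⟨rfl, rfl, ha⟩ | ⟨rfl, rfl, ha⟩⟩ := hs <;>
      obtain ⟨rfl, ⟨rfl, h2, ha'⟩ | ⟨rfl, h2, ha'⟩⟩ := hs' <;>
      cases j <;> cases j' <;> simp only [if_true, if_false, Bool.false_eq_true] at ha ha' <;>
      refine ⟨fun h1 => ?_, fun h1 => ?_⟩ <;>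
      first
        | (exfalso; omega)
        | (subst h2; exact h.agree _ _ _ _ _ hx hy)
        | (subst h2
           obtain ⟨t, ht, rfl⟩ := h.attached _ _ _ _ hx
           obtain ⟨t', ht', rfl⟩ := h.attached _ _ _ _ hy
           rw [h.unique _ _ _ ht ht'])

/-- This combinatorial criterion frees the later constructions from the geometry of cells. -/
theorem IsLayout.isConfig (h : IsLayout K) : C.IsConfig K := by
  refine ⟨fun x hx y hy hxy => C.disjoint_of_compat ⟨?_, ?_⟩, h.attached⟩
  · rintro q t t' rfl rfl
    exact hxy (by rw [h.unique _ _ _ hx hy])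
  · intro ax b a g a' g' hs hs'
    exact ⟨fun ha => hxy ((h.slot hx hy hs hs').1 ha), (h.slot hx hy hs hs').2,
      fun ha => ((h.slot hy hx hs' hs).2 ha).symm⟩

theorem IsConfig.isLayout (hK : C.IsConfig K) : IsLayout K := by
  refine ⟨fun q t t' h h' => Option.some.inj
    (((rep_eq_some hK.disjoint).2 h).symm.trans ((rep_eq_some hK.disjoint).2 h')),
    hK.attached, fun q d j g g' h h' => ?_⟩
  have hc := C.compat_of_disjoint (hK.disjoint h h' fun he => by
    have := (Piece.conn.inj he).1
    cases d <;> simp [Dir.vec, Prod.ext_iff] at this)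
  rcases eq_posDir_or d with hd | hd
  · refine (hc.slot (!acrossVertical d) q (if j then 6 else 1) g (if j then 7 else 2) g'
      ⟨rfl, Or.inl ⟨hd, rfl, rfl⟩⟩ ⟨rfl, Or.inr ⟨by rw [← hd], by rw [← hd], rfl⟩⟩).2.1 ?_
    cases j <;> rfl
  · have hd' : d.opp = posDir (!acrossVertical d) := by
      conv_lhs => rw [hd]
      exact Dir.opp_opp _
    refine (hc.slot (!acrossVertical d) (q + d.vec) (if j then 7 else 2) g (if j then 6 else 1) g'
      ⟨rfl, Or.inr ⟨hd, ?_, rfl⟩⟩ ⟨rfl, Or.inl ⟨?_, rfl, rfl⟩⟩).2.2 ?_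
    · rw [← hd', Dir.vec_opp, add_neg_cancel_right]
    · exact hd'
    · cases j <;> rfl

theorem IsConfig.subset {K' : Set (Piece T)} (hK : C.IsConfig K) (h : K' ⊆ K)
    (ha : ∀ q d j g, Piece.conn q d j g ∈ K' → ∀ t, .body q t ∈ K → .body q t ∈ K') :
    C.IsConfig K' :=
  ⟨hK.disjoint.subset h, fun q d j g hc =>
    let ⟨t, ht, hg⟩ := hK.attached q d j g (h hc)
    ⟨t, ha q d j g hc t ht, hg⟩⟩

/-! ### Filling in connectors -/

/-- The bodies that represent the tiles of an assembly, and connectors for all its bonds. -/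
def fill (σ : Assembly T) : Set (Piece T) :=
  {x | (∃ q t, σ q = some t ∧ x = .body q t) ∨
    ∃ q d j t, σ q = some t ∧ 0 < σ.bond q d ∧ x = .conn q d j (glueOf t d)}

variable {σ : Assembly T}

theorem body_mem_fill {q t} : Piece.body q t ∈ fill σ ↔ σ q = some t := by
  constructor
  · rintro (⟨q', t', h, he⟩ | ⟨q', d, j, t', h, -, he⟩)
    · cases he
      exact h
    · cases he
  · exact fun h => Or.inl ⟨_, _, h, rfl⟩

theorem conn_mem_fill {q d j g} : Piece.conn q d j g ∈ fill σ ↔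
    ∃ t, σ q = some t ∧ 0 < σ.bond q d ∧ g = glueOf t d := by
  constructor
  · rintro (⟨q', t', h, he⟩ | ⟨q', d, j, t', h, h', he⟩)
    · cases he
    · cases he
      exact ⟨_, h, h', rfl⟩
  · rintro ⟨t, h, h', rfl⟩
    exact Or.inr ⟨_, _, _, _, h, h', rfl⟩

theorem body_mem_union_fill (hK : C.IsConfig K) (hs : (rep K).Sub σ) {q t} :
    Piece.body q t ∈ K ∪ fill σ ↔ σ q = some t := by
  rw [Set.mem_union, body_mem_fill, or_iff_right_of_imp]
  intro h
  have h' := (rep_eq_some hK.disjoint).2 h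
  rw [← hs q (mem_dom_of_eq_some h'), h']

theorem attached_union_fill (hK : C.IsConfig K) (hs : (rep K).Sub σ) {q d j g}
    (h : Piece.conn q d j g ∈ K ∪ fill σ) : ∃ t, σ q = some t ∧ g = glueOf t d := by
  rcases h with h | h
  · obtain ⟨t, ht, hg⟩ := hK.attached _ _ _ _ h
    exact ⟨t, (body_mem_union_fill hK hs).1 (Or.inl ht), hg⟩
  · obtain ⟨t, ht, -, hg⟩ := conn_mem_fill.1 h
    exact ⟨t, ht, hg⟩

/-- Only facing connectors could be in conflict. A connector is added only at a positive bond of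
`σ`, where both glues agree. -/
theorem isConfig_union_fill (hK : C.IsConfig K) (hs : (rep K).Sub σ) :
    C.IsConfig (K ∪ fill σ) := by
  refine IsLayout.isConfig ⟨fun q t t' h h' => ?_, fun q d j g h => ?_, fun q d j g g' h h' => ?_⟩
  · rw [body_mem_union_fill hK hs] at h h'
    exact Option.some.inj (h.symm.trans h')
  · obtain ⟨t, ht, hg⟩ := attached_union_fill hK hs h
    exact ⟨t, (body_mem_union_fill hK hs).2 ht, hg⟩
  · obtain ⟨t, ht, hg⟩ := attached_union_fill hK hs h
    obtain ⟨t', ht', hg'⟩ := attached_union_fill hK hs h'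
    have key : 0 < σ.bond q d → g = g' := by
      intro hb
      obtain ⟨s, s', h1, h2, h3, -⟩ := exists_of_bond_pos hb
      rw [ht] at h1
      rw [ht'] at h2
      cases h1
      cases h2
      rw [hg, hg']
      exact Subtype.ext h3
    rcases h with h | h
    · rcases h' with h' | h'
      · exact hK.isLayout.agree _ _ _ _ _ h h'
      · obtain ⟨-, -, hb, -⟩ := conn_mem_fill.1 h'
        rw [bond_opp] at hb
        exact key hb
    · obtain ⟨-, -, hb, -⟩ := conn_mem_fill.1 h
      exact key hb

theorem rep_union_fill (hK : C.IsConfig K) (hs : (rep K).Sub σ) : rep (K ∪ fill σ) = σ := by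
  funext q
  refine Option.ext fun t => ?_
  rw [rep_eq_some (isConfig_union_fill hK hs).disjoint, body_mem_union_fill hK hs]

theorem isFull_union_fill (hK : C.IsConfig K) (hs : (rep K).Sub σ) : IsFull (K ∪ fill σ) := by
  intro q d h j
  rw [rep_union_fill hK hs] at h
  obtain ⟨t, -, h1, -⟩ := exists_of_bond_pos h
  exact ⟨_, Or.inr (conn_mem_fill.2 ⟨t, h1, h, rfl⟩)⟩

theorem isConfig_empty : C.IsConfig ∅ := ⟨Set.pairwiseDisjoint_empty, fun _ _ _ _ h => h.elim⟩

theorem rep_empty_sub : (rep (∅ : Set (Piece T))).Sub σ := by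
  rintro q hq
  obtain ⟨t, ht⟩ := mem_dom_rep.1 hq
  exact ht.elim

/-! ### Restriction to a set of blocks -/

/-- The pieces in a set of blocks. -/
def within (K : Set (Piece T)) (S : Set (ℤ × ℤ)) : Set (Piece T) := {x ∈ K | x.owner ∈ S}

theorem isConfig_within (hK : C.IsConfig K) (S : Set (ℤ × ℤ)) : C.IsConfig (within K S) :=
  hK.subset (fun _ h => h.1) fun _ _ _ _ h _ ht => ⟨ht, h.2⟩

theorem rep_within (hK : C.IsConfig K) (h : σ.Sub (rep K)) : rep (within K σ.dom) = σ := by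
  funext q
  refine Option.ext fun t => ?_
  rw [rep_eq_some (isConfig_within hK _).disjoint]
  constructor
  · rintro ⟨ht, hq⟩
    rw [h q hq, rep_eq_some hK.disjoint]
    exact ht
  · intro ht
    have hq := mem_dom_of_eq_some ht
    rw [h q hq, rep_eq_some hK.disjoint] at ht
    exact ⟨ht, hq⟩

theorem isFull_within (hK : C.IsConfig K) (hf : IsFull K) (h : σ.Sub (rep K)) :
    IsFull (within K σ.dom) := by
  intro q d hb j
  rw [rep_within hK h] at hb
  obtain ⟨t, -, h1, -⟩ := exists_of_bond_pos hb
  obtain ⟨g, hg⟩ := hf q d (hb.trans_le (h.bond_le _ _)) j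
  exact ⟨g, hg, mem_dom_of_eq_some h1⟩

theorem owner_mem_dom (hK : C.IsConfig K) {x : Piece T} (hx : x ∈ K) : x.owner ∈ (rep K).dom := by
  rcases x with ⟨q, t⟩ | ⟨q, d, j, g⟩
  · exact mem_dom_rep.2 ⟨t, hx⟩
  · obtain ⟨t, ht, -⟩ := hK.attached _ _ _ _ hx
    exact mem_dom_rep.2 ⟨t, ht⟩

variable {τ : ℕ} (hτ : 2 ≤ τ)

theorem disjoint_asm {K₁ K₂ : Set (Piece T)} (hK : (K₁ ∪ K₂).PairwiseDisjoint C.cells)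
    (h : Disjoint K₁ K₂) : Disjoint (C.asm hτ K₁).dom (C.asm hτ K₂).dom := by
  refine Set.disjoint_left.2 fun p hp hp' => ?_
  obtain ⟨x, hx, hxp⟩ := (mem_dom_asm hτ).1 hp
  obtain ⟨y, hy, hyp⟩ := (mem_dom_asm hτ).1 hp'
  have : x = y := hK.elim_set (Or.inl hx) (Or.inr hy) _ hxp hyp
  exact Set.disjoint_left.1 h hx (this ▸ hy)

theorem asm_within (hK : C.IsConfig K) {α β : Assembly T} (hd : Disjoint α.dom β.dom)
    (h : rep K = α.union β) :
    Disjoint (C.asm hτ (within K α.dom)).dom (C.asm hτ (within K β.dom)).dom ∧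
    C.asm hτ K = (C.asm hτ (within K α.dom)).union (C.asm hτ (within K β.dom)) := by
  have hu : K = within K α.dom ∪ within K β.dom := by
    refine subset_antisymm (fun x hx => ?_) (Set.union_subset (fun _ h => h.1) fun _ h => h.1)
    have := owner_mem_dom hK hx
    rw [h, dom_union] at this
    exact this.imp (⟨hx, ·⟩) (⟨hx, ·⟩)
  have hu' := hK.disjoint
  rw [hu] at hu'
  refine ⟨disjoint_asm hτ hu' (Set.disjoint_left.2 fun x hx hx' =>
    Set.disjoint_left.1 hd hx.2 hx'.2), ?_⟩
  rw [← asm_union hτ hu', ← hu]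

/-- Adding connectors keeps a configuration stable. -/
theorem stable_of_subset {K' : Set (Piece T)} (hK' : C.IsConfig K') (h : K ⊆ K')
    (hb : ∀ q t, .body q t ∈ K' → .body q t ∈ K) (hs : (C.asm hτ K).Stable τ) :
    (C.asm hτ K').Stable τ := by
  have key : ∀ p ∈ (C.asm hτ K').dom, ∃ r ∈ (C.asm hτ K).dom, (C.asm hτ K').Tied τ p r := by
    intro p hp
    obtain ⟨x, hx, hxp⟩ := (mem_dom_asm hτ).1 hp
    obtain ⟨t, ht⟩ := mem_dom_rep.1 (owner_mem_dom hK' hx)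
    obtain ⟨r, hr⟩ := cells_nonempty C (.body x.owner t)
    exact ⟨r, (mem_dom_asm hτ).2 ⟨_, hb _ _ ht, hr⟩, tied_owner hτ hK' hx ht rfl hxp hr⟩
  refine stable_of_tied fun p hp p' hp' => ?_
  obtain ⟨r, hr, h1⟩ := key p hp
  obtain ⟨r', hr', h2⟩ := key p' hp'
  exact (h1.trans ((hs.tied hr hr').mono (asm_sub hτ hK'.disjoint h))).trans h2.symm

end Config

end Coding

theorem Assembly.IsResult.stable {U : Finset TileType} {τ : ℕ} {s : ℕ → Assembly U}
    {α : Assembly U} (h : Assembly.IsResult s α) (hm : ∀ {i j}, i ≤ j → (s i).Sub (s j))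
    (hs : ∀ i, (s i).Stable τ) : α.Stable τ := by
  refine stable_of_tied fun p hp q hq => ?_
  rw [h.1] at hp hq
  obtain ⟨i, hi⟩ := Set.mem_iUnion.1 hp
  obtain ⟨j, hj⟩ := Set.mem_iUnion.1 hq
  exact ((hs (max i j)).tied ((hm (le_max_left i j)).mem_dom hi)
    ((hm (le_max_right i j)).mem_dom hj)).mono (h.2 _)

theorem TAS.stable_of_producible {τ : ℕ} {𝒯 : TAS τ} {α : Assembly 𝒯.tiles}
    (h : 𝒯.Producible (toSupertile α)) : α.Stable τ := by
  obtain ⟨s, β, h0, hs, hβ, he⟩ := h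
  obtain ⟨u, rfl⟩ := toSupertile_eq_iff.1 he
  rw [Assembly.stable_translate_iff]
  refine hβ.stable hs.sub fun i => ?_
  induction i with
  | zero =>
    obtain ⟨γ, hγ, -, -, h⟩ := 𝒯.initial_ok _ h0
    obtain ⟨v, hv⟩ := toSupertile_eq_iff.1 hγ
    exact hv ▸ h.translate v
  | succ i ih =>
    rcases hs i with h | ⟨_, -, -, -, h⟩
    · rwa [h]
    · exact h

instance (T : Finset TileType) : Finite (GlueOf T) :=
  Finite.of_surjective (fun z : {t : TileType // t ∈ T} × Dir => glueOf z.1 z.2) (by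
    rintro ⟨g, t, ht, d, rfl⟩
    exact ⟨(⟨t, ht⟩, d), rfl⟩)

instance (T : Finset TileType) : Countable (Piece T) := by
  refine Function.Injective.countable (β := (ℤ × ℤ) × ({t : TileType // t ∈ T} ⊕
    Dir × Bool × GlueOf T)) (f := fun x => match x with
      | .body q t => (q, Sum.inl t)
      | .conn q d j g => (q, Sum.inr (d, j, g))) ?_
  rintro (⟨q, t⟩ | ⟨q, d, j, g⟩) (⟨q', t'⟩ | ⟨q', d', j', g'⟩) h <;> simp_all

namespace Coding

theorem finite_of_rep {T : Finset TileType} {C : Coding T} {K : Set (Piece T)} (hK : C.IsConfig K)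
    (h : (rep K).dom.Finite) : K.Finite := by
  refine Set.Finite.subset (h.biUnion (t := fun q =>
    (Set.range fun t => Piece.body q t) ∪
      Set.range fun z : Dir × Bool × GlueOf T => Piece.conn q z.1 z.2.1 z.2.2) fun q _ =>
        (Set.finite_range _).union (Set.finite_range _)) fun x hx => ?_
  have := owner_mem_dom hK hx
  refine Set.mem_biUnion this ?_
  rcases x with ⟨q, t⟩ | ⟨q, d, j, g⟩
  · exact Or.inl ⟨t, rfl⟩
  · exact Or.inr ⟨(d, j, g), rfl⟩

theorem mem_shift_image {T : Finset TileType} {K : Set (Piece T)} {u : ℤ × ℤ} {x : Piece T} :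
    x ∈ Piece.shift u '' K ↔ x.shift (-u) ∈ K := by
  constructor
  · rintro ⟨y, hy, rfl⟩
    rwa [Piece.shift_shift, add_neg_cancel, Piece.shift_zero]
  · exact fun h => ⟨_, h, by rw [Piece.shift_shift, neg_add_cancel, Piece.shift_zero]⟩

theorem fill_translate {T : Finset TileType} (σ : Assembly T) (u : ℤ × ℤ) :
    fill (σ.translate u) = Piece.shift u '' fill σ := by
  ext x
  rw [mem_shift_image]
  rcases x with ⟨q, t⟩ | ⟨q, d, j, g⟩
  · rw [Piece.shift, body_mem_fill, body_mem_fill, ← sub_eq_add_neg]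
    rfl
  · rw [Piece.shift, conn_mem_fill, conn_mem_fill, ← sub_eq_add_neg, Assembly.bond_translate]
    rfl

/-! ### Completeness: full configurations are producible -/

section Completeness

variable {τ : ℕ} (hτ : 2 ≤ τ) {𝒯 : TAS τ} {C : Coding 𝒯.tiles} {K : Set (Piece 𝒯.tiles)}
variable {I : Set (Supertile (universalTiles τ))} {hI : ∀ a ∈ I, IsInput τ a}

open Assembly

/-- The pieces are countable, so the missing ones, all of them connectors, can be added one at a
time in the order of an injection into ℕ. Each stage is stable because each connector is tied to its
body. -/
theorem exists_filling (hI' : ∀ d j g, toSupertile (C.asm hτ {.conn 0 d j g}) ∈ I)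
    {K' : Set (Piece 𝒯.tiles)} (hK' : C.IsConfig K') (h : K ⊆ K')
    (hb : ∀ q t, .body q t ∈ K' → .body q t ∈ K) (hs : (C.asm hτ K).Stable τ) :
    ∃ s : ℕ → Set (Piece 𝒯.tiles), s 0 = K ∧ ⋃ i, s i = K' ∧ (K'.Finite → ∃ i, s i = K') ∧
      (inputSystem τ (universalTiles τ) I hI).IsSequence
        (inputSystem τ (universalTiles τ) I hI).Occurs fun i => C.asm hτ (s i) := by
  obtain ⟨f, hf⟩ := exists_injective_nat (Piece 𝒯.tiles)
  let s : ℕ → Set (Piece 𝒯.tiles) := fun i => {x ∈ K' | x ∈ K ∨ f x < i}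
  have hsK : ∀ i, K ⊆ s i := fun i x hx => ⟨h hx, Or.inl hx⟩
  have hcfg : ∀ i, C.IsConfig (s i) := fun i => hK'.subset (fun _ hx => hx.1)
    fun q d j g _ t ht => hsK i (hb _ _ ht)
  have hst : ∀ i, (C.asm hτ (s i)).Stable τ := fun i =>
    stable_of_subset hτ (hcfg i) (hsK i) (fun q t ht => hb q t ht.1) hs
  refine ⟨s, ?_, ?_, ?_, ?_⟩
  · ext x
    exact ⟨fun hx => hx.2.resolve_right (Nat.not_lt_zero _), fun hx => hsK 0 hx⟩
  · ext x
    rw [Set.mem_iUnion]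
    exact ⟨fun ⟨i, hi⟩ => hi.1, fun hx => ⟨f x + 1, hx, Or.inr (Nat.lt_succ_self _)⟩⟩
  · intro hfin
    obtain ⟨n, hn⟩ := (hfin.image f).bddAbove
    exact ⟨n + 1, subset_antisymm (fun x hx => hx.1) fun x hx =>
      ⟨hx, Or.inr (Nat.lt_succ_of_le (hn (Set.mem_image_of_mem f hx)))⟩⟩
  · intro i
    by_cases hx : ∃ x ∈ K', x ∉ K ∧ f x = i
    · obtain ⟨x, hx, hxK, rfl⟩ := hx
      right
      rcases x with ⟨q, t⟩ | ⟨q, d, j, g⟩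
      · exact (hxK (hb _ _ hx)).elim
      have hun : s (f (.conn q d j g) + 1) = s (f (.conn q d j g)) ∪ {.conn q d j g} := by
        ext y
        constructor
        · rintro ⟨hy, hy' | hy'⟩
          · exact Or.inl ⟨hy, Or.inl hy'⟩
          · rcases (Nat.lt_succ_iff_lt_or_eq.1 hy') with hy' | hy'
            · exact Or.inl ⟨hy, Or.inr hy'⟩
            · exact Or.inr (hf hy')
        · rintro (⟨hy, hy'⟩ | rfl)
          · exact ⟨hy, hy'.imp_right Nat.lt_succ_of_lt⟩
          · exact ⟨hx, Or.inr (Nat.lt_succ_self _)⟩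
      have hcfg' := (hcfg (f (.conn q d j g) + 1)).disjoint
      refine ⟨C.asm hτ {.conn q d j g}, .start (Or.inr ?_), ?_, ?_, hst _⟩
      · have := hI' d j g
        rwa [← toSupertile_translate _ ((2 : ℤ) • C.size • q),
          ← asm_shift hτ q (Set.pairwiseDisjoint_singleton _ _), Set.image_singleton,
          Piece.shift, zero_add] at this
      · rw [hun] at hcfg'
        refine disjoint_asm hτ hcfg' (Set.disjoint_singleton_right.2 ?_)
        rintro ⟨-, h' | h'⟩
        · exact hxK h'
        · exact lt_irrefl _ h'
      · dsimp only
        rw [hun] at hcfg' ⊢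
        exact asm_union hτ hcfg'
    · left
      have : s (i + 1) = s i := by
        refine subset_antisymm (fun y hy => ⟨hy.1, hy.2.elim Or.inl fun hy' => ?_⟩)
          fun y hy => ⟨hy.1, hy.2.imp_right Nat.lt_succ_of_lt⟩
        by_cases hyK : y ∈ K
        · exact Or.inl hyK
        · refine Or.inr (lt_of_le_of_ne (Nat.le_of_lt_succ hy') fun he => ?_)
          exact hx ⟨y, hy.1, hyK, he⟩
      dsimp only
      rw [this]

theorem Combines.exists_union {U : Finset TileType} {a b : Supertile U} {γ : Assembly U}
    (h : Combines τ a b (toSupertile γ)) : ∃ α β, toSupertile α = a ∧ toSupertile β = b ∧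
      Disjoint α.dom β.dom ∧ γ = α.union β := by
  obtain ⟨α, β, rfl, rfl, hd, hs, he⟩ := h
  obtain ⟨u, rfl⟩ := toSupertile_eq_iff.1 he
  exact ⟨_, _, toSupertile_translate _ u, toSupertile_translate _ u, disjoint_dom_translate u hd,
    translate_union _ _ _⟩

theorem combines_within (hK : C.IsConfig K) (hf : IsFull K) (hs : (rep K).Stable τ)
    {α β : Assembly 𝒯.tiles} (hd : Disjoint α.dom β.dom) (h : rep K = α.union β) :
    Combines τ (toSupertile (C.asm hτ (within K α.dom))) (toSupertile (C.asm hτ (within K β.dom)))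
      (toSupertile (C.asm hτ K)) := by
  obtain ⟨h1, h2⟩ := asm_within hτ hK hd h
  exact ⟨_, _, rfl, rfl, h1, h2 ▸ stable_asm hτ hK hf hs, h2 ▸ rfl⟩

variable (C I) in
/-- The connectors and the configurations for the initial supertiles of `𝒯` are in `I`. -/
structure HasInputs : Prop where
  conn : ∀ d j g, toSupertile (C.asm hτ {.conn 0 d j g}) ∈ I
  fill : ∀ a ∈ 𝒯.initial, ∃ ρ, toSupertile ρ = a ∧ toSupertile (C.asm hτ (fill ρ)) ∈ I

/-- An attachment in the simulated system is imitated by splitting `K` along the blocks of the two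
parts. For an initial supertile the input has the necessary connectors, and the finitely many others
in `K` are attached afterwards. -/
theorem occurs_asm (hin : C.HasInputs hτ I) {a : Supertile 𝒯.tiles} (ha : 𝒯.Occurs a) :
    ∀ K, C.IsConfig K → IsFull K → toSupertile (rep K) = a →
      (inputSystem τ (universalTiles τ) I hI).Occurs (toSupertile (C.asm hτ K)) := by
  induction ha with
  | start h =>
    rintro K hK hf rfl
    obtain ⟨ρ, hρ, hmem⟩ := hin.fill _ h
    obtain ⟨u, hu⟩ := toSupertile_eq_iff.1 hρ
    have hin' := hI _ hmem
    have hfill : C.IsConfig (Coding.fill ρ) := by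
      have := isConfig_union_fill (C := C) isConfig_empty (rep_empty_sub (σ := ρ))
      rwa [Set.empty_union] at this
    have h0 : toSupertile (C.asm hτ (Coding.fill (rep K))) ∈ I := by
      have : Coding.fill (rep K) = Piece.shift u '' Coding.fill ρ := by
        rw [← hu, fill_translate]
      rwa [this, asm_shift hτ u hfill.disjoint, toSupertile_translate]
    have hst : (C.asm hτ (Coding.fill (rep K))).Stable τ := by
      obtain ⟨γ, hγ, -, -, hs⟩ := hI _ h0
      obtain ⟨v, hv⟩ := toSupertile_eq_iff.1 hγ
      exact hv ▸ hs.translate v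
    have hfin : (rep K).dom.Finite := by
      obtain ⟨γ, hγ, hfin, -, -⟩ := 𝒯.initial_ok _ h
      obtain ⟨v, hv⟩ := toSupertile_eq_iff.1 hγ
      rw [← hv]
      exact hfin.preimage (sub_left_injective.injOn)
    have hsub : Coding.fill (rep K) ⊆ K := by
      rintro (⟨q, t⟩ | ⟨q, d, j, g⟩) hx
      · exact (rep_eq_some hK.disjoint).1 (body_mem_fill.1 hx)
      · obtain ⟨t, ht, hb, rfl⟩ := conn_mem_fill.1 hx
        obtain ⟨g, hg⟩ := hf q d hb j
        obtain ⟨t', ht', rfl⟩ := hK.attached _ _ _ _ hg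
        rwa [hK.isLayout.unique _ _ _ ((rep_eq_some hK.disjoint).1 ht) ht']
    obtain ⟨s, h1, h2, h3, h4⟩ := exists_filling hτ (hI := hI) hin.conn hK hsub
      (fun q t ht => body_mem_fill.2 ((rep_eq_some hK.disjoint).2 ht)) hst
    obtain ⟨i, hi⟩ := h3 (finite_of_rep hK hfin)
    have := h4.occurs (fun _ => id) (by rw [h1]; exact .start (Or.inr h0)) i
    rwa [hi] at this
  | attach _ _ hc iha ihb =>
    rintro K hK hf rfl
    obtain ⟨α, β, h1, h2, hd, he⟩ := Combines.exists_union hc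
    have hs : (rep K).Stable τ := by
      obtain ⟨α, β, -, -, -, hs, he⟩ := hc
      obtain ⟨u, hu⟩ := toSupertile_eq_iff.1 he
      exact hu ▸ hs.translate u
    have hα : α.Sub (rep K) := he ▸ sub_union_left _ _
    have hβ : β.Sub (rep K) := he ▸ sub_union_right hd
    exact .attach (iha _ (isConfig_within hK _) (isFull_within hK hf hα) (by rw [rep_within hK hα, h1]))
      (ihb _ (isConfig_within hK _) (isFull_within hK hf hβ) (by rw [rep_within hK hβ, h2]))
      (combines_within hτ hK hf hs hd he)

/-- The sequence of the simulated system is followed by restricting `K` to the blocks occupied at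
each stage; every connector of `K` enters with its body. -/
theorem producible_asm (hin : C.HasInputs hτ I) (hK : C.IsConfig K) (hf : IsFull K)
    (hP : 𝒯.Producible (toSupertile (rep K))) :
    (inputSystem τ (universalTiles τ) I hI).Producible (toSupertile (C.asm hτ K)) := by
  obtain ⟨s, α, h0, hs, hα, he⟩ := hP
  obtain ⟨u, hu⟩ := toSupertile_eq_iff.1 he
  have h0' : 𝒯.Occurs (toSupertile ((s 0).translate u)) := by
    rw [toSupertile_translate]
    exact .start h0
  have hα' := hα.translate u
  rw [hu] at hα'
  have hsub : ∀ i, ((s i).translate u).Sub (rep K) := hα'.2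
  have hcfg := fun i => isConfig_within (C := C) hK ((s i).translate u).dom
  have hrep := fun i => rep_within hK (hsub i)
  have hfull := fun i => isFull_within hK hf (hsub i)
  refine TAS.producible_of_sequence (𝒯 := inputSystem τ (universalTiles τ) I hI)
    (s := fun i => C.asm hτ (within K ((s i).translate u).dom)) ?_ ?_ ?_
  · exact occurs_asm hτ hin h0' _ (hcfg 0) (hfull 0) (by rw [hrep])
  · intro i
    rcases hs i with h | ⟨β, hβ, hd, h, hst⟩
    · left
      dsimp only
      rw [h]
    · right
      have hd' := disjoint_dom_translate u hd
      have he' : (s (i + 1)).translate u = ((s i).translate u).union (β.translate u) := by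
        rw [h, translate_union]
      have hβ' : (β.translate u).Sub (rep K) := by
        refine Sub.trans ?_ (hsub (i + 1))
        rw [he']
        exact sub_union_right hd'
      have hw : ∀ S ⊆ ((s (i + 1)).translate u).dom,
          within (within K ((s (i + 1)).translate u).dom) S = within K S := fun S hS =>
        subset_antisymm (fun x hx => ⟨hx.1.1, hx.2⟩) fun x hx => ⟨⟨hx.1, hS hx.2⟩, hx.2⟩
      have hab := asm_within hτ (hcfg (i + 1)) hd' (by rw [hrep, he'])
      rw [hw _ (by rw [he', dom_union]; exact Set.subset_union_left),
        hw _ (by rw [he', dom_union]; exact Set.subset_union_right)] at hab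
      refine ⟨C.asm hτ (within K (β.translate u).dom), ?_, hab.1, hab.2, ?_⟩
      · refine occurs_asm hτ hin hβ _ (isConfig_within hK _) (isFull_within hK hf hβ') ?_
        rw [rep_within hK hβ', toSupertile_translate]
      · refine stable_asm hτ (hcfg _) (hfull _) ?_
        rw [hrep]
        exact hst.translate u
  · have hu : K = ⋃ i, within K ((s i).translate u).dom := by
      refine subset_antisymm (fun x hx => ?_) (Set.iUnion_subset fun i x hx => hx.1)
      have := owner_mem_dom hK hx
      rw [hα'.1] at this
      obtain ⟨i, hi⟩ := Set.mem_iUnion.1 this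
      exact Set.mem_iUnion.2 ⟨i, hx, hi⟩
    have hd := hK.disjoint
    rw [hu] at hd
    have := asm_isResult hτ hd
    rwa [← hu] at this

end Completeness

end Coding

namespace Coding

variable {T : Finset TileType} (C : Coding T) {τ : ℕ}

open Assembly

/-! ### The block representation -/

/-- The side length of a block, in tiles. -/
def scale : ℕ := (2 * C.size).toNat

theorem scale_cast : (C.scale : ℤ) = 2 * C.size := by
  have := C.size_pos
  unfold scale; omega

/-- The block shows the square of the body of the macrotile of `t`. -/
def Shows (t : {t : TileType // t ∈ T}) (B : Block (universalTiles τ) C.scale) : Prop :=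
  ∀ i j : Fin C.scale, (i : ℤ) < 2 * C.side → (j : ℤ) < 2 * C.side →
    ∃ s, B (i, j) = some s ∧ s.1 = C.tile τ (.body 0 t) (i, j)

open Classical in
noncomputable def blockRep : BlockRep (universalTiles τ) T C.scale := fun B =>
  if h : ∃ t, C.Shows t B then some h.choose else none

theorem glueAt_north {x : Piece T} {p : ℤ × ℤ} (h : p.2 % 2 = 0) :
    (C.tile τ x p).glue .north = colorGlue τ (C.color x (coarse p)) := by
  refine if_pos ?_
  ext <;> simp [coarse, Dir.vec]; omega

/-- Colour 1 occurs only in the lower left coarse cell of a body, and only the lower left tile of a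
coarse cell has inner sides to the north and to the east. This pins the position of the body. -/
theorem anchor {x : Piece T} {p : ℤ × ℤ} (hp : coarse p ∈ C.cells x)
    (hn : (C.tile τ x p).glue .north = colorGlue τ 1)
    (he : (C.tile τ x p).glue .east = colorGlue τ 1) :
    ∃ q t, x = .body q t ∧ p = (2 : ℤ) • C.size • q := by
  have key : ∀ d, (C.tile τ x p).glue d = colorGlue τ 1 →
      coarse (p + d.vec) = coarse p ∧ C.color x (coarse p) = 1 := by
    intro d hd
    change C.glueAt τ x p d = _ at hd
    unfold glueAt at hd
    split_ifs at hd with h1 h2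
    · exact ⟨h1, colorGlue_injective τ hd⟩
    · exact (colorGlue_ne_extGlue τ 1 hd.symm).elim
    · rcases C.contactAt_cases (τ := τ) x p d with h | ⟨b, k, e, -, -, -, h⟩ <;> rw [h] at hd
      · exact (colorGlue_ne_nullGlue τ 1 hd.symm).elim
      · exact (colorGlue_ne_contactGlue τ 1 _ _ hd.symm).elim
  obtain ⟨h1, h2⟩ := key _ hn
  obtain ⟨h3, -⟩ := key _ he
  rcases x with ⟨q, t⟩ | ⟨q, d, j, g⟩
  · have hloc : C.loc (coarse p) = (0, 0) := by
      by_contra h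
      rw [color, if_neg h] at h2
      split_ifs at h2 <;> exact absurd h2 (by decide)
    have hblk : C.blk (coarse p) = q := by
      rcases hp with ⟨t', h, -⟩ | ⟨ax, a, g, hs, hc⟩
      · cases h
        rfl
      · have := C.strip_bounds hs hc
        have hn := C.n_pos
        rw [hloc] at this
        unfold side at this
        cases ax <;> simp [swapIf] at this <;> omega
    refine ⟨q, t, rfl, ?_⟩
    have h := C.place_blk_loc (coarse p)
    rw [hloc, hblk] at h
    simp only [coarse, Dir.vec, place, Prod.ext_iff, Prod.fst_add, Prod.snd_add] at h1 h3 h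
    ext <;> simp <;> omega
  · simp [color] at h2

theorem Shows.unique {t t' : {t : TileType // t ∈ T}} {B : Block (universalTiles τ) C.scale}
    (h : C.Shows t B) (h' : C.Shows t' B) : t = t' := by
  by_contra hne
  obtain ⟨x, y, hx, hx', hy, hy', hsep⟩ := C.tileCode_sep t t' hne
  have hn := C.n_pos
  have hm := C.scale_cast
  have hsz : C.size = 23 * C.n + 10 := rfl
  have hsd : C.side = 20 * C.n + 10 := rfl
  -- The code is shifted by one cell away from the marked corner, and a cell is two tiles wide.
  let i : Fin C.scale := ⟨(2 * (x + 1)).toNat, by omega⟩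
  let j : Fin C.scale := ⟨(2 * (y + 1)).toNat, by omega⟩
  have hi : (i : ℤ) = 2 * (x + 1) := by simp only [i]; omega
  have hj : (j : ℤ) = 2 * (y + 1) := by simp only [j]; omega
  obtain ⟨s, h1, h2⟩ := h i j (by omega) (by omega)
  obtain ⟨s', h1', h2'⟩ := h' i j (by omega) (by omega)
  rw [h1] at h1'
  cases h1'
  have hg := congrArg (fun u => u.glue .north) (h2.symm.trans h2')
  rw [C.glueAt_north (by simp only [hj]; omega), C.glueAt_north (by simp only [hj]; omega)] at hg
  have hcol := colorGlue_injective τ hg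
  have hc : coarse ((i : ℤ), (j : ℤ)) = (x + 1, y + 1) := by
    rw [hi, hj]; ext <;> simp [coarse]
  have hloc : C.loc (x + 1, y + 1) = (x + 1, y + 1) := by
    ext
    · exact Int.emod_eq_of_lt (by omega) (by omega)
    · exact Int.emod_eq_of_lt (by omega) (by omega)
  rw [hc] at hcol
  have hcl : ∀ t : {t : TileType // t ∈ T}, C.color (.body 0 t) (x + 1, y + 1) = 2 ↔
      C.tileCode t x y := by
    intro t
    rw [color, hloc, if_neg (by simp; omega)]
    rw [add_sub_cancel_right, add_sub_cancel_right]
    split_ifs with hc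
    · exact ⟨fun _ => hc.2.2.2.2, fun _ => rfl⟩
    · refine ⟨fun h => absurd h (by decide), fun h => (hc ⟨?_, ?_, ?_, ?_, h⟩).elim⟩ <;>
        dsimp only <;> omega
  exact hsep ((hcl t).symm.trans ((by rw [hcol]) : _ ↔ _) |>.trans (hcl t'))

theorem blockRep_eq_some {t : {t : TileType // t ∈ T}} {B : Block (universalTiles τ) C.scale} :
    C.blockRep B = some t ↔ C.Shows t B := by
  constructor
  · intro h
    by_cases h' : ∃ t, C.Shows t B
    · rw [blockRep, dif_pos h'] at h
      exact Option.some.inj h ▸ h'.choose_spec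
    · rw [blockRep, dif_neg h'] at h
      cases h
  · intro h
    have h' : ∃ t, C.Shows t B := ⟨t, h⟩
    rw [blockRep, dif_pos h', h'.choose_spec.unique C h]

theorem coarse_block (q : ℤ × ℤ) (i j : ℤ) :
    coarse (C.scale * q.1 + i, C.scale * q.2 + j) = C.place q (i / 2, j / 2) := by
  rw [scale_cast]
  ext <;> simp only [coarse, place]
  · rw [show 2 * C.size * q.1 + i = i + 2 * (C.size * q.1) by ring,
      Int.add_mul_ediv_left _ _ two_ne_zero, add_comm]
  · rw [show 2 * C.size * q.2 + j = j + 2 * (C.size * q.2) by ring,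
      Int.add_mul_ediv_left _ _ two_ne_zero, add_comm]

theorem blk_coarse_block (q : ℤ × ℤ) (i j : Fin C.scale) :
    C.blk (coarse (C.scale * q.1 + (i : ℕ), C.scale * q.2 + (j : ℕ))) = q := by
  have hm := C.scale_cast
  rw [coarse_block, C.blk_place] <;> dsimp only <;> omega

variable {C} {K : Set (Piece T)} (hτ : 2 ≤ τ)

theorem shows_of_mem (hK : K.PairwiseDisjoint C.cells) {q t} (h : Piece.body q t ∈ K) :
    C.Shows t ((C.asm hτ K).block C.scale q) := by
  intro i j hi hj
  have hc : coarse (C.scale * q.1 + (i : ℕ), C.scale * q.2 + (j : ℕ)) ∈ C.cells (.body q t) := by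
    rw [coarse_block]
    apply C.mem_square <;> dsimp only <;> omega
  refine ⟨_, asm_eq hτ hK h hc, ?_⟩
  have := C.tile_shift τ (.body 0 t) q ((i : ℤ), (j : ℤ))
  rw [Piece.shift, zero_add] at this
  rw [← this]
  change C.tile τ _ _ = _
  congr 1
  rw [scale_cast]
  ext <;> simp <;> ring

/-- A block that represents a tile is aligned with a body. -/
theorem exists_body_of_shows {u q : ℤ × ℤ} {t}
    (h : C.Shows t (((C.asm hτ K).translate u).block C.scale q)) :
    ∃ b t', .body b t' ∈ K ∧ u = (2 : ℤ) • C.size • (q - b) := by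
  have hm := C.scale_cast
  have hs := C.size_pos
  have hd := C.side_pos
  obtain ⟨s, h1, h2⟩ := h ⟨0, by omega⟩ ⟨0, by omega⟩ (by simp; omega) (by simp; omega)
  obtain ⟨x, hx, hp, hst⟩ := exists_of_asm_eq hτ h1
  have hc : C.color (.body 0 t) (coarse (0, 0)) = 1 := by
    rw [color]
    exact if_pos (by simp [coarse, loc])
  obtain ⟨b, t', rfl, hb⟩ := C.anchor (τ := τ) hp (by
      rw [← hst, h2]
      exact (if_pos (by simp [coarse, Dir.vec])).trans (congrArg _ hc)) (by
      rw [← hst, h2]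
      exact (if_pos (by simp [coarse, Dir.vec])).trans (congrArg _ hc))
  refine ⟨b, t', hx, ?_⟩
  rw [hm] at hb
  simp [Prod.ext_iff] at hb ⊢
  constructor
  · linarith [hb.1]
  · linarith [hb.2]

theorem assemblyRep_asm (hK : K.PairwiseDisjoint C.cells) :
    assemblyRep C.blockRep (C.asm hτ K) = rep K := by
  funext q
  refine Option.ext fun t => ?_
  rw [rep_eq_some hK]
  change C.blockRep _ = _ ↔ _
  rw [blockRep_eq_some]
  refine ⟨fun h => ?_, shows_of_mem hτ hK⟩
  have h' := h
  rw [← Assembly.translate_zero (C.asm hτ K)] at h'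
  obtain ⟨b, t', hb, hu⟩ := exists_body_of_shows hτ h'
  have hs := C.size_pos
  have : q = b := by
    rw [eq_comm, smul_eq_zero, smul_eq_zero] at hu
    rcases hu with hu | hu | hu
    · omega
    · omega
    · exact sub_eq_zero.1 hu
  subst this
  exact h.unique C (shows_of_mem hτ hK hb) ▸ hb

theorem translate_asm_of_rep (hK : K.PairwiseDisjoint C.cells) {u : ℤ × ℤ}
    (h : (assemblyRep C.blockRep ((C.asm hτ K).translate u)).dom.Nonempty) :
    ∃ w q t, .body q t ∈ K ∧ (C.asm hτ K).translate u = C.asm hτ (Piece.shift w '' K) := by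
  obtain ⟨q, hq⟩ := h
  obtain ⟨t, ht⟩ := Option.ne_none_iff_exists'.1 hq
  obtain ⟨b, t', hb, hu⟩ := exists_body_of_shows hτ (C.blockRep_eq_some.1 ht)
  exact ⟨q - b, b, t', hb, by rw [asm_shift hτ _ hK, hu]⟩

theorem dom_rep_nonempty (hK : C.IsConfig K) (hne : K.Nonempty) : (rep K).dom.Nonempty :=
  hne.elim fun _ hx => ⟨_, owner_mem_dom hK hx⟩

theorem isConfig_shift (hK : C.IsConfig K) (w : ℤ × ℤ) : C.IsConfig (Piece.shift w '' K) := by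
  refine ⟨C.pairwiseDisjoint_shift w hK.disjoint, fun q d j g h => ?_⟩
  rw [mem_shift_image] at h
  obtain ⟨t, ht, hg⟩ := hK.attached _ _ _ _ h
  exact ⟨t, mem_shift_image.2 ht, hg⟩

/-- A translation in which some block represents a tile is a translation by whole blocks, by the
marked corner of a body. It therefore translates the represented assembly. -/
theorem represents_asm (hK : C.IsConfig K) (hne : K.Nonempty) :
    Represents C.blockRep (toSupertile (C.asm hτ K)) (toSupertile (rep K)) := by
  ext β
  constructor
  · rintro ⟨hβ, α, hα, rfl⟩
    obtain ⟨u, rfl⟩ := toSupertile_eq_iff.1 hα.symm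
    obtain ⟨w, -, -, -, hw⟩ := translate_asm_of_rep hτ hK.disjoint hβ
    change toSupertile _ = _
    rw [hw, assemblyRep_asm hτ (isConfig_shift hK w).disjoint, rep_shift hK.disjoint,
      toSupertile_translate]
  · intro hβ
    obtain ⟨w, rfl⟩ := toSupertile_eq_iff.1 (Eq.symm hβ)
    rw [← rep_shift hK.disjoint]
    refine ⟨dom_rep_nonempty (isConfig_shift hK w) (hne.image _), C.asm hτ (Piece.shift w '' K), ?_,
      assemblyRep_asm hτ (isConfig_shift hK w).disjoint⟩
    rw [asm_shift hτ _ hK.disjoint, toSupertile_translate]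

theorem supertileRep_conn (q d j g) :
    supertileRep C.blockRep (toSupertile (C.asm hτ {.conn q d j g})) = ∅ := by
  refine Set.eq_empty_of_forall_notMem ?_
  rintro β ⟨hβ, α, hα, rfl⟩
  obtain ⟨u, rfl⟩ := toSupertile_eq_iff.1 hα.symm
  obtain ⟨w, b, t, hb, -⟩ := translate_asm_of_rep hτ (Set.pairwiseDisjoint_singleton _ _) hβ
  cases hb

theorem supertileRep_single {a : Supertile (universalTiles τ)}
    (ha : a ∈ singletons (universalTiles τ)) :
    supertileRep (C.blockRep (τ := τ)) a = ∅ := by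
  refine Set.eq_empty_of_forall_notMem ?_
  obtain ⟨s, rfl⟩ := ha
  rintro β ⟨⟨q, hq⟩, α, hα, rfl⟩
  obtain ⟨u, rfl⟩ := toSupertile_eq_iff.1 hα.symm
  obtain ⟨t, ht⟩ := Option.ne_none_iff_exists'.1 hq
  have h := C.blockRep_eq_some.1 ht
  have hm := C.scale_cast
  have hs := C.size_pos
  have hd := C.side_pos
  obtain ⟨s1, h1, -⟩ := h ⟨0, by omega⟩ ⟨0, by omega⟩ (by simp; omega) (by simp; omega)
  obtain ⟨s2, h2, -⟩ := h ⟨0, by omega⟩ ⟨1, by omega⟩ (by simp; omega) (by simp; omega)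
  have h1 := mem_dom_of_eq_some (show (single s).translate u _ = _ from h1)
  have h2 := mem_dom_of_eq_some (show (single s).translate u _ = _ from h2)
  rw [translate_single_dom] at h1 h2
  have := (Prod.ext_iff.1 (h1.trans h2.symm)).2
  simp at this

theorem Represents.unique {U : Finset TileType} {m : ℕ} {R : BlockRep U T m} {a : Supertile U}
    {b b' : Supertile T} (h : Represents R a b) (h' : Represents R a b') : b = b' := by
  obtain ⟨β, rfl⟩ := exists_rep b
  have : β ∈ supertileRep R a := by rw [h]; rfl
  rw [h'] at this
  exact this

theorem not_represents_of_empty {U : Finset TileType} {m : ℕ} {R : BlockRep U T m} {a : Supertile U}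
    {b : Supertile T} (h : supertileRep R a = ∅) : ¬ Represents R a b := by
  intro h'
  obtain ⟨β, rfl⟩ := exists_rep b
  have : β ∈ supertileRep R a := by rw [h']; rfl
  rw [h] at this
  exact this

/-- The cells of a piece are in the block of its owner and the adjacent ones. -/
theorem owner_near {x : Piece T} {c : ℤ × ℤ} (h : c ∈ C.cells x) :
    ∃ u v : ℤ, u ^ 2 + v ^ 2 < 2 ∧ C.blk c + (u, v) = x.owner := by
  have key : ∀ {ax b q}, b + (posDir ax).vec = q →
      ∃ u v : ℤ, u ^ 2 + v ^ 2 < 2 ∧ b + (u, v) = q := by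
    rintro ax b q rfl
    exact ⟨(posDir ax).vec.1, (posDir ax).vec.2, by cases ax <;> simp [posDir, Dir.vec], rfl⟩
  have key0 : ∀ {b q : ℤ × ℤ}, b = q → ∃ u v : ℤ, u ^ 2 + v ^ 2 < 2 ∧ b + (u, v) = q := by
    rintro b q rfl
    exact ⟨0, 0, by norm_num, by simp⟩
  rcases h with ⟨t, rfl, -⟩ | ⟨ax, a, g, hs, -⟩
  · exact key0 rfl
  · rcases x with ⟨q, t⟩ | ⟨q, d, j, g'⟩
    · rcases hs with ⟨h, -⟩ | ⟨h, -⟩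
      exacts [key0 h, key h]
    · obtain ⟨-, ⟨-, h, -⟩ | ⟨-, h, -⟩⟩ := hs
      exacts [key0 h, key h]

theorem exists_of_blockNonempty {q : ℤ × ℤ} (h : (C.asm hτ K).BlockNonempty C.scale q) :
    ∃ x ∈ K, ∃ c ∈ C.cells x, C.blk c = q := by
  obtain ⟨⟨i, j⟩, h⟩ := h
  obtain ⟨x, hx, hc⟩ := (mem_dom_asm hτ).1 h
  exact ⟨x, hx, _, hc, C.blk_coarse_block q i j⟩

theorem cleanAssembly_asm (hK : C.IsConfig K) : CleanAssembly C.blockRep (C.asm hτ K) := by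
  refine Or.inl fun q hq => ?_
  obtain ⟨x, hx, c, hc, rfl⟩ := exists_of_blockNonempty hτ hq
  obtain ⟨u, v, huv, h⟩ := owner_near hc
  refine ⟨u, v, huv, ?_⟩
  rw [h, assemblyRep_asm hτ hK.disjoint]
  exact owner_mem_dom hK hx

/-- A connector is one comb and lies in the strip of a single block. -/
theorem cleanAssembly_conn (q d j g) :
    CleanAssembly C.blockRep (C.asm hτ {.conn q d j g}) := by
  have key : ∀ {c c'}, c ∈ C.cells (.conn q d j g) → c' ∈ C.cells (.conn q d j g) →
      C.blk c = C.blk c' := by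
    rintro c c' (⟨t, h, -⟩ | ⟨ax, a, g1, hs, -⟩) (⟨t, h', -⟩ | ⟨ax', a', g1', hs', -⟩)
    · cases h
    · cases h
    · cases h'
    · obtain ⟨-, ⟨rfl, h, -⟩ | ⟨rfl, h, -⟩⟩ := hs <;>
        obtain ⟨-, ⟨h1, h', -⟩ | ⟨h1, h', -⟩⟩ := hs' <;>
        cases ax <;> cases ax' <;> simp [posDir, Dir.opp] at h1 <;>
        first | exact h.trans h'.symm | exact add_right_cancel (h.trans h'.symm)
  refine Or.inr fun b b' h h' => ?_
  obtain ⟨x, rfl, c, hc, rfl⟩ := exists_of_blockNonempty hτ h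
  obtain ⟨x, rfl, c', hc', rfl⟩ := exists_of_blockNonempty hτ h'
  exact key hc hc'

theorem cleanAssembly_single (s : {t : TileType // t ∈ universalTiles τ}) :
    CleanAssembly (C.blockRep (τ := τ)) (single s) := by
  have key : ∀ q, (single s).BlockNonempty C.scale q → q = 0 := by
    rintro q ⟨⟨i, j⟩, h⟩
    have h0 : ((C.scale : ℤ) * q.1 + (i : ℕ), (C.scale : ℤ) * q.2 + (j : ℕ)) = 0 := by
      by_contra hne
      exact h (if_neg hne)
    have := C.blk_coarse_block q i j
    rw [h0] at this
    rw [← this]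
    simp [blk, coarse]
  exact Or.inr fun q q' h h' => (key q h).trans (key q' h').symm

theorem mapsCleanly_of_good {P : Supertile T → Prop} {a : Supertile (universalTiles τ)}
    (ha : C.Good hτ P a) : MapsCleanly (C.blockRep (τ := τ)) a := by
  rcases ha with h | ⟨q, d, j, g, rfl⟩ | ⟨K, hK, hne, -, rfl⟩
  · refine Or.inr ⟨supertileRep_single h, ?_⟩
    obtain ⟨s, rfl⟩ := h
    exact ⟨_, rfl, cleanAssembly_single s⟩
  · exact Or.inr ⟨supertileRep_conn hτ q d j g, _, rfl, cleanAssembly_conn hτ q d j g⟩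
  · refine Or.inl ⟨⟨_, represents_asm hτ hK hne⟩, fun α hα hn => ?_⟩
    obtain ⟨u, rfl⟩ := toSupertile_eq_iff.1 hα.symm
    obtain ⟨w, -, -, -, hw⟩ := translate_asm_of_rep hτ hK.disjoint hn
    rw [hw]
    exact cleanAssembly_asm hτ (isConfig_shift hK w)

/-- The supertiles that represent something come from configurations. -/
theorem exists_config_of_represents {P : Supertile T → Prop} {a : Supertile (universalTiles τ)}
    (ha : C.Good hτ P a) {b} (hb : Represents (C.blockRep (τ := τ)) a b) :
    ∃ K, C.IsConfig K ∧ K.Nonempty ∧ a = toSupertile (C.asm hτ K) ∧ b = toSupertile (rep K) ∧ P b := by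
  rcases ha with h | ⟨q, d, j, g, rfl⟩ | ⟨K, hK, hne, hP, rfl⟩
  · exact (not_represents_of_empty (supertileRep_single h) hb).elim
  · exact (not_represents_of_empty (supertileRep_conn hτ q d j g) hb).elim
  · have := Represents.unique hb (represents_asm hτ hK hne)
    exact ⟨K, hK, hne, rfl, this, this ▸ hP⟩

end Coding

theorem IsInput.spec {U : Finset TileType} {τ : ℕ} {α : Assembly U}
    (h : IsInput τ (toSupertile α)) : α.dom.Finite ∧ α.dom.Nonempty ∧ α.Stable τ := by
  obtain ⟨β, hβ, hfin, ⟨p, hp⟩, hs⟩ := h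
  obtain ⟨u, rfl⟩ := toSupertile_eq_iff.1 hβ
  exact ⟨hfin.preimage sub_left_injective.injOn,
    ⟨p + u, Assembly.mem_dom_translate.2 (by rwa [add_sub_cancel_right])⟩, hs.translate u⟩

theorem TAS.nonempty_of_producible {τ : ℕ} {𝒯 : TAS τ} {α : Assembly 𝒯.tiles}
    (h : 𝒯.Producible (toSupertile α)) : α.dom.Nonempty := by
  obtain ⟨s, β, h0, -, hβ, he⟩ := h
  obtain ⟨u, rfl⟩ := toSupertile_eq_iff.1 he
  obtain ⟨p, hp⟩ := (𝒯.initial_ok _ h0).spec.2.1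
  exact ⟨p + u, Assembly.mem_dom_translate.2
    (by rw [add_sub_cancel_right]; exact (hβ.2 0).mem_dom hp)⟩

namespace Coding

open Assembly

/-! ### Filled configurations and finiteness -/

section Fill

variable {T : Finset TileType} {C : Coding T} {σ : Assembly T}

variable (C) in
theorem isConfig_fill (σ : Assembly T) : C.IsConfig (fill σ) := by
  simpa using isConfig_union_fill (C := C) isConfig_empty (rep_empty_sub (σ := σ))

theorem rep_fill (C : Coding T) (σ : Assembly T) : rep (fill σ) = σ := by
  simpa using rep_union_fill (C := C) isConfig_empty (rep_empty_sub (σ := σ))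

theorem isFull_fill (C : Coding T) (σ : Assembly T) : IsFull (fill σ) := by
  simpa using isFull_union_fill (C := C) isConfig_empty (rep_empty_sub (σ := σ))

theorem fill_nonempty (h : σ.dom.Nonempty) : (fill σ).Nonempty := by
  obtain ⟨q, hq⟩ := h
  obtain ⟨t, ht⟩ := Option.ne_none_iff_exists'.1 hq
  exact ⟨_, body_mem_fill.2 ht⟩

theorem finite_cells (x : Piece T) : {p | coarse p ∈ C.cells x}.Finite := by
  have hs := C.size_pos
  refine (Set.finite_Icc (2 * (C.size * (x.owner.1 - 1)), 2 * (C.size * (x.owner.2 - 1)))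
    (2 * (C.size * (x.owner.1 + 2)), 2 * (C.size * (x.owner.2 + 2)))).subset fun p hp => ?_
  obtain ⟨u, v, huv, ho⟩ := owner_near hp
  have h1 : C.size * (p.1 / 2 / C.size) + p.1 / 2 % C.size = p.1 / 2 :=
    Int.mul_ediv_add_emod _ _
  have h2 : C.size * (p.2 / 2 / C.size) + p.2 / 2 % C.size = p.2 / 2 :=
    Int.mul_ediv_add_emod _ _
  have h3 := Int.emod_nonneg (p.1 / 2) hs.ne'
  have h4 := Int.emod_lt_of_pos (p.1 / 2) hs
  have h5 := Int.emod_nonneg (p.2 / 2) hs.ne'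
  have h6 := Int.emod_lt_of_pos (p.2 / 2) hs
  have e1 : p.1 / 2 / C.size = x.owner.1 - u := by rw [← ho]; simp [blk, coarse]
  have e2 : p.2 / 2 / C.size = x.owner.2 - v := by rw [← ho]; simp [blk, coarse]
  have hu : -1 ≤ u ∧ u ≤ 1 := by constructor <;> nlinarith
  have hv : -1 ≤ v ∧ v ≤ 1 := by constructor <;> nlinarith
  rw [e1] at h1
  rw [e2] at h2
  have b1 := mul_le_mul_of_nonneg_left (show x.owner.1 - 1 ≤ x.owner.1 - u by omega) hs.le
  have b2 := mul_le_mul_of_nonneg_left (show x.owner.1 - u ≤ x.owner.1 + 1 by omega) hs.le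
  have b3 := mul_le_mul_of_nonneg_left (show x.owner.2 - 1 ≤ x.owner.2 - v by omega) hs.le
  have b4 := mul_le_mul_of_nonneg_left (show x.owner.2 - v ≤ x.owner.2 + 1 by omega) hs.le
  have c1 : C.size * (x.owner.1 + 2) = C.size * (x.owner.1 + 1) + C.size := by ring
  have c2 : C.size * (x.owner.2 + 2) = C.size * (x.owner.2 + 1) + C.size := by ring
  refine ⟨⟨?_, ?_⟩, ?_, ?_⟩ <;> dsimp only <;> omega

variable {τ : ℕ} (hτ : 2 ≤ τ) {K : Set (Piece T)}

theorem finite_dom_asm (hK : K.Finite) : (C.asm hτ K).dom.Finite := by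
  refine (hK.biUnion fun x _ => finite_cells (C := C) x).subset fun p hp => ?_
  obtain ⟨x, hx, h⟩ := (mem_dom_asm hτ).1 hp
  exact Set.mem_biUnion hx h

end Fill

variable {τ : ℕ} (hτ : 2 ≤ τ) {𝒯 : TAS τ} {C : Coding 𝒯.tiles}
variable {I : Set (Supertile (universalTiles τ))} {hI : ∀ a ∈ I, IsInput τ a}

/-! ### The simulation -/

theorem equivalentProductions (h1 : C.InputsOf hτ I) (h2 : C.HasInputs hτ I) :
    EquivalentProductions (inputSystem τ (universalTiles τ) I hI) 𝒯 (C.blockRep (τ := τ)) := by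
  refine ⟨subset_antisymm ?_ ?_, fun a ha => mapsCleanly_of_good hτ (good_of_producible hτ h1 ha)⟩
  · rintro b ⟨a, ha, hb⟩
    obtain ⟨-, -, -, -, -, h⟩ := exists_config_of_represents hτ (good_of_producible hτ h1 ha) hb
    exact h
  · intro b hb
    obtain ⟨ρ, rfl⟩ := exists_rep b
    have hrep := represents_asm hτ (isConfig_fill C ρ)
      (fill_nonempty (TAS.nonempty_of_producible hb))
    rw [rep_fill C] at hrep
    exact ⟨_, producible_asm hτ h2 (isConfig_fill C ρ) (isFull_fill C ρ)
      (by rw [rep_fill C]; exact hb), hrep⟩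

theorem follows (h1 : C.InputsOf hτ I) :
    Follows 𝒯 (inputSystem τ (universalTiles τ) I hI) (C.blockRep (τ := τ)) := by
  rintro a a' ha - ⟨c, hc, α, β, hα, rfl, hd, hs, rfl⟩ b hb
  obtain ⟨K, hK, hne, rfl, rfl, -⟩ :=
    exists_config_of_represents hτ (good_of_producible hτ h1 ha) hb
  obtain ⟨u, rfl⟩ := toSupertile_eq_iff.1 hα.symm
  obtain ⟨K', hsub, hK', he, h⟩ := attach_config hτ hK hne (good_of_producible hτ h1 hc) hd hs
  refine ⟨toSupertile (rep K'), ?_, ?_⟩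
  · have hrep := represents_asm hτ hK' (hne.mono hsub)
    rw [← toSupertile_translate _ u, ← he] at hrep
    exact hrep
  · rcases h with h | ⟨γ, hγ, hd, h, hst⟩
    · exact Or.inl (by rw [h])
    · exact Or.inr ⟨_, hγ, _, _, rfl, rfl, hd, h ▸ hst, h ▸ rfl⟩

/-- All connectors for the bonds of the union are added to `K`, and the resulting full configuration
`E` is split into the blocks of `rep K` and those of the partner. The first part arises from `K` by
adding connectors, both parts are producible, and they combine into `E`. No connectors are added
where glues differ, so mismatches do no harm. -/
theorem weaklyModels (h1 : C.InputsOf hτ I) (h2 : C.HasInputs hτ I) :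
    WeaklyModels (inputSystem τ (universalTiles τ) I hI) 𝒯 (C.blockRep (τ := τ)) := by
  rintro a b ha hb ⟨c, hc, α, γ, hα, rfl, hd, hs, rfl⟩ a' ha' hrep
  obtain ⟨K, hK, hne, rfl, rfl, -⟩ :=
    exists_config_of_represents hτ (good_of_producible hτ h1 ha') hrep
  obtain ⟨u, hu⟩ := toSupertile_eq_iff.1 hα
  have hbu : toSupertile (α.union γ) = toSupertile ((rep K).union (γ.translate u)) := by
    rw [← hu, ← translate_union, toSupertile_translate]
  have hd' := disjoint_dom_translate u hd
  have hs' := hs.translate u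
  rw [translate_union] at hs'
  rw [hbu] at hb ⊢
  rw [← toSupertile_translate _ u] at hc
  rw [hu] at hd' hs'
  generalize γ.translate u = β at *
  have hsub : (rep K).Sub ((rep K).union β) := sub_union_left _ _
  have hE := isConfig_union_fill hK hsub
  have hrE := rep_union_fill hK hsub
  have hfE := isFull_union_fill hK hsub
  have hKE : K ⊆ K ∪ fill ((rep K).union β) := Set.subset_union_left
  generalize K ∪ fill ((rep K).union β) = E at *
  have hsα : (rep K).Sub (rep E) := by rwa [hrE]
  have hsβ : β.Sub (rep E) := by
    rw [hrE]
    exact sub_union_right hd'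
  have hα' := isConfig_within hE (rep K).dom
  have hrα := rep_within hE hsα
  have hKα : K ⊆ within E (rep K).dom := fun x hx => ⟨hKE hx, owner_mem_dom hK hx⟩
  have hrepα := represents_asm hτ hα' (hne.mono hKα)
  have hrepE := represents_asm hτ hE (hne.mono hKE)
  rw [hrα] at hrepα
  rw [hrE] at hrepE
  refine ⟨toSupertile (C.asm hτ (within E (rep K).dom)), ?_, hrepα, ?_,
    toSupertile (C.asm hτ E), ?_, hrepE, toSupertile (C.asm hτ (within E β.dom)), ?_, ?_⟩
  · exact producible_asm hτ h2 hα' (isFull_within hE hfE hsα) (by rwa [hrα])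
  · obtain ⟨s, hs0, hsu, -, hseq⟩ := exists_filling hτ (hI := hI) h2.conn hα' hKα
      (fun q t ht => by
        rw [← rep_eq_some hα'.disjoint, hrα, rep_eq_some hK.disjoint] at ht
        exact ht) (TAS.stable_of_producible ha')
    have hdis := hα'.disjoint
    rw [← hsu] at hdis
    refine ⟨_, _, by rw [hs0]; rfl, fun i => ?_, asm_isResult hτ hdis, by rw [hsu]⟩
    exact (hseq i).imp_right fun ⟨β, hβ, h⟩ => ⟨β, hβ.producible, h⟩
  · exact producible_asm hτ h2 hE hfE (by rwa [hrE])
  · exact producible_asm hτ h2 (isConfig_within hE _) (isFull_within hE hfE hsβ)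
      (by rwa [rep_within hE hsβ])
  · exact combines_within hτ hE hfE (hrE ▸ hs') hd' hrE

theorem simulates (h1 : C.InputsOf hτ I) (h2 : C.HasInputs hτ I) :
    Simulates (inputSystem τ (universalTiles τ) I hI) 𝒯 (C.blockRep (τ := τ)) :=
  ⟨equivalentProductions hτ h1 h2, follows hτ h1, weaklyModels hτ h1 h2⟩

/-! ### The input supertiles -/

variable (𝒯 C) in
/-- The single connectors, and configurations for the initial supertiles of `𝒯`. -/
def inputs : Set (Supertile (universalTiles τ)) :=
  (Set.range fun z : Dir × Bool × GlueOf 𝒯.tiles =>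
    toSupertile (C.asm hτ {.conn 0 z.1 z.2.1 z.2.2})) ∪
  (fun a => toSupertile (C.asm hτ (fill (Quotient.out a)))) '' 𝒯.initial

theorem inputsOf_inputs : C.InputsOf hτ (C.inputs hτ 𝒯) := by
  rintro a (⟨z, rfl⟩ | ⟨b, hb, rfl⟩)
  · exact Or.inl ⟨_, _, _, _, rfl⟩
  · have hout : toSupertile b.out = b := Quotient.out_eq b
    refine Or.inr ⟨_, isConfig_fill C _, fill_nonempty ?_, ?_, rfl⟩
    · exact (𝒯.initial_ok _ (hout.symm ▸ hb)).spec.2.1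
    · rwa [rep_fill C, hout]

theorem hasInputs_inputs : C.HasInputs hτ (C.inputs hτ 𝒯) :=
  ⟨fun d j g => Or.inl ⟨(d, j, g), rfl⟩,
    fun a ha => ⟨a.out, Quotient.out_eq a, Or.inr ⟨a, ha, rfl⟩⟩⟩

theorem isInput_of_mem_inputs : ∀ a ∈ C.inputs hτ 𝒯, IsInput τ a := by
  rintro a (⟨z, rfl⟩ | ⟨b, hb, rfl⟩)
  · exact ⟨_, rfl, finite_dom_asm hτ (Set.finite_singleton _),
      asm_dom_nonempty hτ (Set.singleton_nonempty _), stable_singleton hτ _⟩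
  · have hout : toSupertile b.out = b := Quotient.out_eq b
    obtain ⟨h1, h2, h3⟩ := (𝒯.initial_ok _ (hout.symm ▸ hb)).spec
    refine ⟨_, rfl, finite_dom_asm hτ (finite_of_rep (isConfig_fill C _) ?_),
      asm_dom_nonempty hτ (fill_nonempty h2),
      stable_asm hτ (isConfig_fill C _) (isFull_fill C _) ?_⟩ <;> rwa [rep_fill C]

/-- Four directions, two indices and at most 4|T| glues give at most 32|T| connectors. -/
theorem encard_inputs_le :
    (C.inputs hτ 𝒯).encard ≤ 32 * (𝒯.tiles.card : ℕ∞) + 𝒯.initial.encard := by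
  refine (Set.encard_union_le _ _).trans (add_le_add ?_ (Set.encard_image_le _ _))
  rw [← Set.image_univ]
  refine (Set.encard_image_le _ _).trans ?_
  have hsurj : Function.Surjective
      (fun z : {t : TileType // t ∈ 𝒯.tiles} × Dir => glueOf z.1 z.2) := by
    rintro ⟨g, t, ht, d, rfl⟩
    exact ⟨(⟨t, ht⟩, d), rfl⟩
  have hcard : Nat.card (GlueOf 𝒯.tiles) ≤ 𝒯.tiles.card * 4 := by
    refine (Nat.card_le_card_of_surjective _ hsurj).trans ?_
    rw [Nat.card_prod, Nat.card_eq_finsetCard, Dir.card]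
  have h : Nat.card (Dir × Bool × GlueOf 𝒯.tiles) ≤ 32 * 𝒯.tiles.card := by
    rw [Nat.card_prod, Nat.card_prod, Dir.card, Nat.card_eq_fintype_card (α := Bool),
      Fintype.card_bool]
    omega
  rw [Set.encard_univ, ENat.card_eq_coe_natCard]
  exact_mod_cast h

end Coding

/-- With `k = ⌊log₂ max(N, 2)⌋` one has `4N < 2 ^ (k + 3)`, so `n = ⌊√(k + 3)⌋ + 1` suffices. The
number `46n + 20` is the side of a block in tiles. -/
theorem exists_scale (N : ℕ) : ∃ n : ℕ, 0 < n ∧ 4 * N ≤ 2 ^ (n * n) ∧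
    ((46 * n + 20 : ℕ) : ℝ) ≤ 4656 * Real.sqrt (Real.log (max (N : ℝ) 2)) := by
  set k := Nat.log 2 (max N 2) with hk
  set r := Nat.sqrt (k + 3) with hr
  refine ⟨r + 1, Nat.succ_pos _, ?_, ?_⟩
  · have h1 : max N 2 < 2 ^ (k + 1) := Nat.lt_pow_succ_log_self one_lt_two _
    have h2 : k + 3 ≤ (r + 1) * (r + 1) := (Nat.lt_succ_sqrt (k + 3)).le
    calc 4 * N ≤ 4 * 2 ^ (k + 1) := by have := le_max_left N 2; omega
      _ = 2 ^ (k + 3) := by ring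
      _ ≤ _ := Nat.pow_le_pow_right two_pos h2
  · set x := Real.log (max (N : ℝ) 2) with hx
    have hl : Real.log 2 ≤ x := Real.log_le_log two_pos (le_max_right _ _)
    have hlk : (k : ℝ) * Real.log 2 ≤ x := by
      rw [← Real.log_pow]
      refine Real.log_le_log (by positivity) ?_
      have : 2 ^ k ≤ max N 2 := Nat.pow_log_le_self 2 (by positivity)
      exact_mod_cast this
    have h2 := Real.log_two_gt_d9
    have hx0 : 0 ≤ x := by linarith
    have hs := Real.sqrt_nonneg x
    have hsq := Real.mul_self_sqrt hx0
    have hk0 : (0 : ℝ) ≤ k := Nat.cast_nonneg k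
    -- From `log 2 > 0.69` both `k ≤ 1.45 x` and `3 ≤ 4.4 x` follow.
    have hkx : (k : ℝ) + 3 ≤ 6 * x := by nlinarith
    have hrk : (r : ℝ) * r ≤ k + 3 := by exact_mod_cast Nat.sqrt_le (k + 3)
    have h3 : (r : ℝ) ≤ 3 * Real.sqrt x := by
      refine abs_le_of_sq_le_sq' ?_ (by positivity) |>.2
      nlinarith
    have h4 : 1 ≤ 3 * Real.sqrt x := by
      refine abs_le_of_sq_le_sq' ?_ (by positivity) |>.2
      nlinarith
    push_cast
    linarith

end TwoHAM

theorem mainTheorem10 :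
    ∃ C : ℕ, ∀ τ : ℕ, 2 ≤ τ →
      ∃ U : Finset TwoHAM.TileType, U.card ≤ C * τ ∧
        ∀ 𝒯 : TwoHAM.TAS τ,
          ∃ (I : Set (TwoHAM.Supertile U)) (hI : ∀ a ∈ I, TwoHAM.IsInput τ a),
            I.encard ≤ (C : ℕ∞) * ((𝒯.tiles.card : ℕ∞) + 𝒯.initial.encard) ∧
            ∃ m : ℕ, 0 < m ∧
              (m : ℝ) ≤ (C : ℝ) * Real.sqrt (Real.log (max (𝒯.tiles.card : ℝ) 2)) ∧
              ∃ R : TwoHAM.BlockRep U 𝒯.tiles m,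
                TwoHAM.Simulates (TwoHAM.inputSystem τ U I hI) 𝒯 R := by
  -- The constant comes from the number of tiles; the input count and the scale would allow much
  -- smaller ones.
  refine ⟨4656, fun τ hτ => ⟨TwoHAM.universalTiles τ,
    TwoHAM.card_universalTiles_le (by omega), fun 𝒯 => ?_⟩⟩
  obtain ⟨n, hn, hcard, hscale⟩ := TwoHAM.exists_scale 𝒯.tiles.card
  obtain ⟨C, hC⟩ := TwoHAM.exists_coding 𝒯.tiles n hn hcard
  have hm : C.scale = 46 * n + 20 := by
    have := C.scale_cast
    rw [TwoHAM.Coding.size, hC] at this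
    omega
  refine ⟨C.inputs hτ 𝒯, TwoHAM.Coding.isInput_of_mem_inputs hτ, ?_, C.scale, by omega, ?_,
    C.blockRep, TwoHAM.Coding.simulates hτ (TwoHAM.Coding.inputsOf_inputs hτ)
      (TwoHAM.Coding.hasInputs_inputs hτ)⟩
  · refine (TwoHAM.Coding.encard_inputs_le hτ).trans ?_
    rw [mul_add]
    refine add_le_add (mul_le_mul_left ?_ _) ?_
    · norm_num
    · exact le_mul_of_one_le_left zero_le (by norm_num)
  · rw [hm]
    exact_mod_cast hscale
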